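/- Let $R$ be a commutative ring with $1$, let $m\ge 1$, $r\ge 0$ be integers, $q\in R$ a unit and $u_1,\dots,u_m\in R$. Let $\mathbf H=\mathbf H_m^r$ be the Ariki–Koike algebra: the associative unital $R$-algebra with generators $T_0,\dots,T_{r-1}$ and relations $T_0T_1T_0T_1=T_1T_0T_1T_0$; $T_iT_{i+1}T_i=T_{i+1}T_iT_{i+1}$ for $1\le i\le r-2$; $T_iT_j=T_jT_i$ for $|i-j|\ge 2$; $(T_i-q)(T_i+1)=0$ for $i\ne 0$; $(T_0-u_1)\cdots(T_0-u_m)=0$. Put $L_1=T_0$, $L_i=q^{-1}T_{i-1}L_{i-1}T_{i-1}$ for $2\le i\le r$, and $\pi_b(x)=\prod_{j=1}^{b}(L_j-x)$ for $0\le b\le r$, $x\in R$. Let $\mathfrak S_r$ act on $\{1,\dots,r\}$ from the right, with basic transpositions $s_i=(i,i+1)$, and let $T_w=T_{i_1}\cdots T_{i_k}$ for a reduced expression $w=s_{i_1}\cdots s_{i_k}$. Let $\Lambda[m,r]$ be the set of integer sequences $\mathbf a=[a_0,\dots,a_m]$ with $0=a_0\le a_1\le\cdots\le a_m=r$. For $\mathbf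 a\in\Lambda[m,r]$ let $\mathbf a'=[0,r-a_{m-1},\dots,r-a_1,r]$; let $\mathfrak S_{\mathbf a}$ be the Young subgroup of permutations preserving each block $\{a_{i-1}+1,\dots,a_i\}$; let $\mathcal H(\mathfrak S_{\mathbf a})$ be the subalgebra of $\mathbf H$ generated by the $T_i$ ($i\ge1$) with $s_i\in\mathfrak S_{\mathbf a}$; let $w_{\mathbf a}\in\mathfrak S_r$ be given by $(a_{i-1}+l)w_{\mathbf a}=r-a_i+l$ for $1\le l\le a_i-a_{i-1}$, and $h_{\mathbf a}=T_{w_{\mathbf a}}$; and put $$\pi_{\mathbf a}=\pi_{a_1}(u_2)\cdots\pi_{a_{m-1}}(u_m),\quad \tilde\pi_{\mathbf a}=\pi_{a_1}(u_{m-1})\cdots\pi_{a_{m-1}}(u_1),\quad v_{\mathbf a}=\pi_{\mathbf a}h_{\mathbf a}\tilde\pi_{\mathbf a'}.$$ Proposition. Let $\mathbf a\in\Lambda[m,r]$. There are unique elements $z_{\mathbf a}\in\mathcal H(\mathfrak S_{\mathbf a})$ and $z_{\mathbf a'}\in\mathcal H(\mathfrak S_{\mathbf a'})$ with $v_{\mathbf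 a}h_{\mathbf a'}v_{\mathbf a}=z_{\mathbf a}v_{\mathbf a}=v_{\mathbf a}z_{\mathbf a'}$; they are central in $\mathcal H(\mathfrak S_{\mathbf a})$ and $\mathcal H(\mathfrak S_{\mathbf a'})$ respectively; and the following are equivalent: (a) $z_{\mathbf a}$ is invertible in $\mathcal H(\mathfrak S_{\mathbf a})$; (a$'$) $z_{\mathbf a'}$ is invertible in $\mathcal H(\mathfrak S_{\mathbf a'})$; (b) $z_{\mathbf a}$ has an inverse $z_{\mathbf a}^{-1}$ in $\mathcal H(\mathfrak S_{\mathbf a})$, and $e_{\mathbf a}=v_{\mathbf a}h_{\mathbf a'}z_{\mathbf a}^{-1}$ is an idempotent; (c) $v_{\mathbf a}\mathbf H$ is a projective right $\mathbf H$-module. -/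

import Mathlib

/-! Ariki–Koike algebras, the poset `Λ[m,r]` and the elements attached to it.
Permutations act on the right, as in `(i)w`, so that a word `s_{i₁}⋯s_{i_k}` applies `s_{i₁}` first.
A point `p : Fin r` stands for the letter `p + 1` of `{1,…,r}`. -/

namespace ArikiKoike

/-- `Λ[m,r]`: sequences `0 = a_0 ≤ a_1 ≤ ⋯ ≤ a_m = r` of integers. -/
@[ext] structure Lam (m r : ℕ) where
  val : Fin (m + 1) → ℕ
  mono : Monotone val
  zero : val 0 = 0
  last : val (Fin.last m) = r

/-- `a' = [0, r - a_{m-1}, …, r - a_1, r]`, that is `a'_i = r - a_{m-i}`. -/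
def Lam.dual {m r : ℕ} (a : Lam m r) : Lam m r where
  val i := r - a.val i.rev
  mono i j h := Nat.sub_le_sub_left (a.mono (Fin.rev_le_rev.mpr h)) r
  zero := by simp [a.last]
  last := by simp [a.zero]

theorem Lam.le_last {m r : ℕ} (a : Lam m r) (i : Fin (m + 1)) : a.val i ≤ r :=
  (a.mono (Fin.le_last i)).trans a.last.le

theorem Lam.dual_dual {m r : ℕ} (a : Lam m r) : a.dual.dual = a := by
  ext i
  have := a.le_last i
  simp only [Lam.dual, Fin.rev_rev]
  omega

/-- Every letter lies in a block `{a_i + 1, …, a_{i+1}}`. -/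
theorem Lam.exists_block {m r : ℕ} (a : Lam m r) (p : Fin r) :
    ∃ i : Fin m, a.val i.castSucc ≤ p ∧ (p : ℕ) < a.val i.succ := by
  by_contra! hcon
  have key : ∀ i : Fin (m + 1), a.val i ≤ p := by
    intro i
    induction i using Fin.induction with
    | zero => simp [a.zero]
    | succ i ih => exact hcon i ih
  have := key (Fin.last m)
  rw [a.last] at this
  exact absurd p.isLt (by omega)

theorem Lam.block_unique {m r : ℕ} (a : Lam m r) {p : ℕ} {i j : Fin m}
    (hi : a.val i.castSucc ≤ p) (hi' : p < a.val i.succ)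
    (hj : a.val j.castSucc ≤ p) (hj' : p < a.val j.succ) : i = j := by
  rcases lt_trichotomy i j with h | h | h
  · have : a.val i.succ ≤ a.val j.castSucc := a.mono (Nat.succ_le_of_lt h)
    omega
  · exact h
  · have : a.val j.succ ≤ a.val i.castSucc := a.mono (Nat.succ_le_of_lt h)
    omega

/-- The index of the block of `a` that contains the letter `p`. -/
noncomputable def Lam.block {m r : ℕ} (a : Lam m r) (p : Fin r) : Fin m :=
  (a.exists_block p).choose

theorem Lam.block_spec {m r : ℕ} (a : Lam m r) (p : Fin r) :
    a.val (a.block p).castSucc ≤ p ∧ (p : ℕ) < a.val (a.block p).succ :=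
  (a.exists_block p).choose_spec

/-- The map `a_{i-1} + l ↦ r - a_i + l` for `1 ≤ l ≤ a_i - a_{i-1}`. -/
noncomputable def Lam.wFun {m r : ℕ} (a : Lam m r) (p : Fin r) : Fin r :=
  ⟨r - a.val (a.block p).succ + ((p : ℕ) - a.val (a.block p).castSucc), by
    have h := a.block_spec p
    have h' := a.le_last (a.block p).succ
    omega⟩

theorem Lam.wFun_eq {m r : ℕ} (a : Lam m r) (p : Fin r) (i : Fin m)
    (h : a.val i.castSucc ≤ p) (h' : (p : ℕ) < a.val i.succ) :
    (a.wFun p : ℕ) = r - a.val i.succ + ((p : ℕ) - a.val i.castSucc) := by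
  have hb := a.block_spec p
  obtain rfl := a.block_unique h h' hb.1 hb.2
  rfl

theorem Lam.dual_wFun {m r : ℕ} (a : Lam m r) (p : Fin r) : a.dual.wFun (a.wFun p) = p := by
  obtain ⟨i, h, h'⟩ := a.exists_block p
  have hw := a.wFun_eq p i h h'
  have hs := a.le_last i.succ
  have hc := a.le_last i.castSucc
  have e1 : a.dual.val i.rev.castSucc = r - a.val i.succ := by
    simp [Lam.dual, Fin.rev_castSucc]
  have e2 : a.dual.val i.rev.succ = r - a.val i.castSucc := by
    simp [Lam.dual, Fin.rev_succ]
  have := a.dual.wFun_eq (a.wFun p) i.rev (by rw [e1, hw]; omega) (by rw [e2, hw]; omega)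
  ext
  rw [this, e1, e2, hw]
  omega

/-- The permutation `w_a`: `(a_{i-1} + l) w_a = r - a_i + l` for `1 ≤ l ≤ a_i - a_{i-1}`. -/
noncomputable def Lam.w {m r : ℕ} (a : Lam m r) : Equiv.Perm (Fin r) where
  toFun := a.wFun
  invFun := a.dual.wFun
  left_inv := a.dual_wFun
  right_inv p := by
    have := a.dual.dual_wFun p
    rwa [a.dual_dual] at this

/-- The index `i + 1 ∈ {1,…,r-1}` of the `i`-th basic transposition or Hecke generator. -/
def succIdx {r : ℕ} (i : Fin (r - 1)) : Fin r := ⟨(i : ℕ) + 1, by have := i.isLt; omega⟩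

/-- The basic transposition `s_{i+1} = (i+1, i+2)`, for `i : Fin (r - 1)`. -/
def s {r : ℕ} (i : Fin (r - 1)) : Equiv.Perm (Fin r) :=
  Equiv.swap ⟨i, by omega⟩ (succIdx i)

/-- The permutation `s_{i₁} ⋯ s_{i_k}` (acting on the right: `s_{i₁}` is applied first). -/
def wordPerm {r : ℕ} : List (Fin (r - 1)) → Equiv.Perm (Fin r)
  | [] => Equiv.refl _
  | i :: l => (s i).trans (wordPerm l)

/-- `l` is a reduced expression of `w`. -/
def IsReducedWord {r : ℕ} (w : Equiv.Perm (Fin r)) (l : List (Fin (r - 1))) : Prop :=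
  wordPerm l = w ∧ ∀ l' : List (Fin (r - 1)), wordPerm l' = w → l.length ≤ l'.length

theorem wordPerm_append {r : ℕ} (l l' : List (Fin (r - 1))) :
    wordPerm (l ++ l') = (wordPerm l).trans (wordPerm l') := by
  induction l with
  | nil => rfl
  | cons i l ih => simp [wordPerm, ih, Equiv.trans_assoc]

theorem exists_wordPerm {r : ℕ} (w : Equiv.Perm (Fin r)) : ∃ l, wordPerm l = w := by
  cases r with
  | zero => exact ⟨[], Subsingleton.elim _ _⟩
  | succ n =>
    have hw : w ∈ Submonoid.closure
        (Set.range fun i : Fin n => Equiv.swap i.castSucc i.succ) := by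
      rw [Equiv.Perm.mclosure_swap_castSucc_succ]; trivial
    induction hw using Submonoid.closure_induction with
    | mem x hx =>
      obtain ⟨i, rfl⟩ := hx
      exact ⟨[i], rfl⟩
    | one => exact ⟨[], rfl⟩
    | mul x y _ _ hx hy =>
      obtain ⟨l, rfl⟩ := hx
      obtain ⟨l', rfl⟩ := hy
      exact ⟨l' ++ l, wordPerm_append _ _⟩

theorem exists_isReducedWord {r : ℕ} (w : Equiv.Perm (Fin r)) : ∃ l, IsReducedWord w l := by
  obtain ⟨l, hl, hmin⟩ := exists_minimalFor_of_wellFoundedLT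
    (fun l : List (Fin (r - 1)) => wordPerm l = w) List.length (exists_wordPerm w)
  exact ⟨l, hl, fun l' h' => (le_total l.length l'.length).elim id (hmin h')⟩

/-- The Young subgroup `𝔖_a`: the permutations that stabilise every block of `a`. -/
def Lam.young {m r : ℕ} (a : Lam m r) : Subgroup (Equiv.Perm (Fin r)) where
  carrier := {w | ∀ p (j : Fin (m + 1)), (w p : ℕ) < a.val j ↔ (p : ℕ) < a.val j}
  one_mem' := fun _ _ => Iff.rfl
  mul_mem' := fun {x y} hx hy p j => (hx (y p) j).trans (hy p j)
  inv_mem' := fun {x} hx p j => by simpa using (hx (x⁻¹ p) j).symm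

section Algebra

variable {R : Type*} [CommRing R] {m r : ℕ}

/-- The defining relations of the Ariki–Koike algebra on generators `T_0, …, T_{r-1}`.
`u : Fin m → R` lists the parameters `u_1, …, u_m`. -/
inductive Rel (r : ℕ) (q : Rˣ) (u : Fin m → R) :
    FreeAlgebra R (Fin r) → FreeAlgebra R (Fin r) → Prop
  | braid4 (i j : Fin r) (hi : (i : ℕ) = 0) (hj : (j : ℕ) = 1) :
      Rel r q u
        (FreeAlgebra.ι R i * FreeAlgebra.ι R j * FreeAlgebra.ι R i * FreeAlgebra.ι R j)
        (FreeAlgebra.ι R j * FreeAlgebra.ι R i * FreeAlgebra.ι R j * FreeAlgebra.ι R i)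
  | braid3 (i j : Fin r) (hi : 1 ≤ (i : ℕ)) (hj : (j : ℕ) = i + 1) :
      Rel r q u
        (FreeAlgebra.ι R i * FreeAlgebra.ι R j * FreeAlgebra.ι R i)
        (FreeAlgebra.ι R j * FreeAlgebra.ι R i * FreeAlgebra.ι R j)
  | comm (i j : Fin r) (h : (i : ℕ) + 2 ≤ j) :
      Rel r q u
        (FreeAlgebra.ι R i * FreeAlgebra.ι R j)
        (FreeAlgebra.ι R j * FreeAlgebra.ι R i)
  | quad (i : Fin r) (hi : (i : ℕ) ≠ 0) :
      Rel r q u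
        ((FreeAlgebra.ι R i - algebraMap R _ (q : R)) * (FreeAlgebra.ι R i + 1)) 0
  | cyc (i : Fin r) (hi : (i : ℕ) = 0) :
      Rel r q u
        (List.ofFn fun k : Fin m => FreeAlgebra.ι R i - algebraMap R _ (u k)).prod 0

/-- The Ariki–Koike algebra `H = H_m^r` over `R` with parameters `q, u_1, …, u_m`
(for `r = 0` there are no generators and `H = R`). -/
abbrev H (r : ℕ) (q : Rˣ) (u : Fin m → R) : Type _ := RingQuot (Rel r q u)

/-- The generator `T_i`, `0 ≤ i ≤ r - 1`. -/
def T (q : Rˣ) (u : Fin m → R) (i : Fin r) : H r q u :=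
  RingQuot.mkAlgHom R (Rel r q u) (FreeAlgebra.ι R i)

/-- The element `L_{j+1}`, `j : Fin r`: `L_1 = T_0` and `L_{i+1} = q⁻¹ T_i L_i T_i`. -/
def L (q : Rˣ) (u : Fin m → R) : (j : ℕ) → j < r → H r q u
  | 0, h => T q u ⟨0, h⟩
  | j + 1, h =>
    ((q⁻¹ : Rˣ) : R) • (T q u ⟨j + 1, h⟩ * L q u j (Nat.lt_of_succ_lt h) * T q u ⟨j + 1, h⟩)

/-- `π_b(x) = (L_1 - x) ⋯ (L_b - x)` for `b ≤ r`. -/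
def piElt (q : Rˣ) (u : Fin m → R) (b : ℕ) (hb : b ≤ r) (x : R) : H r q u :=
  (List.ofFn fun j : Fin b => L q u (j : ℕ) (j.isLt.trans_le hb) - algebraMap R _ x).prod

/-- `π_a = π_{a_1}(u_2) ⋯ π_{a_{m-1}}(u_m)`. -/
def piA (q : Rˣ) (u : Fin m → R) (a : Lam m r) : H r q u :=
  (List.ofFn fun i : Fin (m - 1) =>
    piElt q u (a.val ⟨i + 1, by omega⟩) (a.le_last _) (u ⟨i + 1, by omega⟩)).prod

/-- `π̃_a = π_{a_1}(u_{m-1}) ⋯ π_{a_{m-1}}(u_1)`. -/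
def piTilde (q : Rˣ) (u : Fin m → R) (a : Lam m r) : H r q u :=
  (List.ofFn fun i : Fin (m - 1) =>
    piElt q u (a.val ⟨i + 1, by omega⟩) (a.le_last _) (u ⟨m - 2 - i, by omega⟩)).prod

/-- `T_{i₁} ⋯ T_{i_k}` for the word `s_{i₁} ⋯ s_{i_k}`. -/
def wordT (q : Rˣ) (u : Fin m → R) (l : List (Fin (r - 1))) : H r q u :=
  (l.map fun i => T q u (succIdx i)).prod

/-- `T_w = T_{i₁} ⋯ T_{i_k}` for a reduced expression `w = s_{i₁} ⋯ s_{i_k}`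
(by the braid relations the choice of the reduced expression does not matter). -/
noncomputable def Tw (q : Rˣ) (u : Fin m → R) (w : Equiv.Perm (Fin r)) : H r q u :=
  wordT q u (exists_isReducedWord w).choose

/-- `h_a = T_{w_a}`. -/
noncomputable def hA (q : Rˣ) (u : Fin m → R) (a : Lam m r) : H r q u :=
  Tw q u a.w

/-- `v_a = π_a T_{w_a} π̃_{a'}`. -/
noncomputable def vA (q : Rˣ) (u : Fin m → R) (a : Lam m r) : H r q u :=
  piA q u a * hA q u a * piTilde q u a.dual

/-- `ℋ(𝔖_a)`: the subalgebra of `H` generated by the `T_i`, `1 ≤ i ≤ r - 1`, with `s_i ∈ 𝔖_a`. -/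
def heckeYoung (q : Rˣ) (u : Fin m → R) (a : Lam m r) : Subalgebra R (H r q u) :=
  Algebra.adjoin R
    {x | ∃ i : Fin (r - 1), s i ∈ a.young ∧ x = T q u (succIdx i)}

end Algebra

end ArikiKoike

/-!
The algebra `H` is a Frobenius extension of the finite Hecke algebra `ℋ(𝔖_r)` (`Hfin`), and the
element `v = v_a` has an invertible value under the Frobenius homomorphism. These two facts carry
the proposition; the rest is formal.

*The bimodule.* Write `v = π T_w π̃` with `w = w_a`. The products `π_b(x)` commute with the Hecke
generators that preserve `{1, …, b}`, and complementary products of linear factors in the `L_j` on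
both sides of `T_σ` annihilate it, by the cyclotomic relation, if `σ` maps a letter of the first
product to one of the second (`ev_mul_Tw_mul_ev_eq_zero`). Cutting `w` into minimal coset
representatives, this gives `π H π̃ = ℋ(𝔖_a) v = v ℋ(𝔖_{a'})` (`Datum.exists_pp_mul_mul_pp`) and
`v H = v ℋ(𝔖_r)` (`Datum.exists_vD_mul`); conjugation by `T_w` identifies `ℋ(𝔖_a)` with
`ℋ(𝔖_{a'})` compatibly with the action on `v` (`Datum.exists_mul_vD`). In particular `z` and `z'`
exist, since `v h_{a'} v` lies in `π H π̃`.

*The Frobenius homomorphism.* Let `E = ℋ(𝔖_r)`. Polynomials in `X_1, …, X_r` with coefficients in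
`E`, all of whose exponents are less than `m`, carry a representation of `H` in which `T_i`
(`i ≥ 1`) acts by a Demazure–Lusztig operator `op` and `T_0` acts by multiplication with `X_1`
modulo `(X_1 - u_1) ⋯ (X_1 - u_m)` (`isAK_opN`). Evaluation of `X_p` at `L_p` inverts the action on
the vector `1` (`ofPoly_rep_one`), so the monomials in the `L_p` form a basis of `H` over `E`, and
`Phi`, the coefficient of `(L_1 ⋯ L_r)^{m-1}`, is well defined. It is `E`-linear on both sides. The
pairing `(x, y) ↦ Phi (x y)` is triangular on monomials (`rep_mon_top_eq_zero`), hence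
nondegenerate (`eq_zero_of_Phi_mul_left`, `eq_zero_of_Phi_mul_right`).

*The value at `v`.* The factor `π̃` has leading monomial `X^β` with `β` antitone. Moving `T_w` past
it sorts the exponent: `T_w X^β` is `X^{β ∘ w}` times a unit of `E`, up to exponents strictly
majorized by `β` (`exists_rep_Tw_single`). The exponent `β ∘ w` is complementary to the leading
exponent of `π`, and the remaining terms do not reach the top exponent. So `Phi v` is a unit
(`Datum.isUnit_Phi_vD`), and therefore `x v = 0` or `v x = 0` with `x` in `E` forces `x = 0`. This
gives the uniqueness and the centrality of `z` and `z'`, and the equivalence of the invertibility of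
`z` with that of `z'`.

*Projectivity.* If `z` is invertible, then `e = v h_{a'} z⁻¹` satisfies `e v = v`, so `e` is an
idempotent and `v H = e H` is a direct summand of `H`. Conversely, a splitting of `H → v H` sends
`v` to an element `e` with `v e = v` that is killed on the right by all `x` with `v x = 0`.
Comparing `Phi (e x)` with `Phi (v x)`, nondegeneracy yields `e = c v` with `c` in `E`
(`Datum.exists_mul_vD_eq`). Then `v = v c v`, and the description of `π̃ H π` turns this into
`v = x z v` for some `x` in `ℋ(𝔖_a)`, so that `x z = 1`.
-/

namespace ArikiKoike

/-! ### Reduced words in the symmetric group -/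

section Words

variable {r : ℕ}

/-- The smaller of the two letters exchanged by `s i`; the larger one is `succIdx i`. -/
def lo (i : Fin (r - 1)) : Fin r := ⟨i, by omega⟩

theorem lo_val (i : Fin (r - 1)) : (lo i : ℕ) = i := rfl

theorem succIdx_val (i : Fin (r - 1)) : (succIdx i : ℕ) = i + 1 := rfl

theorem lo_lt (i : Fin (r - 1)) : lo i < succIdx i := by
  simp [Fin.lt_def, lo_val, succIdx_val]

theorem lo_ne (i : Fin (r - 1)) : lo i ≠ succIdx i := (lo_lt i).ne

theorem s_eq (i : Fin (r - 1)) : s i = Equiv.swap (lo i) (succIdx i) := rfl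

theorem s_lo (i : Fin (r - 1)) : s i (lo i) = succIdx i := Equiv.swap_apply_left _ _

theorem s_hi (i : Fin (r - 1)) : s i (succIdx i) = lo i := Equiv.swap_apply_right _ _

theorem s_of_ne {i : Fin (r - 1)} {p : Fin r} (h : p ≠ lo i) (h' : p ≠ succIdx i) : s i p = p :=
  Equiv.swap_apply_of_ne_of_ne h h'

theorem s_s (i : Fin (r - 1)) (p : Fin r) : s i (s i p) = p :=
  congrArg (fun e : Equiv.Perm (Fin r) => e p) (Equiv.swap_swap (lo i) (succIdx i))

theorem s_symm (i : Fin (r - 1)) : (s i).symm = s i := Equiv.symm_swap _ _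

theorem s_trans_s_trans (i : Fin (r - 1)) (w : Equiv.Perm (Fin r)) :
    (s i).trans ((s i).trans w) = w := by
  ext p; simp [s_s]

theorem trans_s_trans_s (i : Fin (r - 1)) (w : Equiv.Perm (Fin r)) :
    (w.trans (s i)).trans (s i) = w := by
  ext p; simp [s_s]

/-- `s i` preserves the order of every pair of letters but `lo i < succIdx i`. -/
theorem s_lt_s {i : Fin (r - 1)} {p p' : Fin r} (h : p < p') (hne : ¬ (p = lo i ∧ p' = succIdx i)) :
    s i p < s i p' := by
  rw [s_eq, Equiv.swap_apply_def, Equiv.swap_apply_def]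
  have h1 := lo_val i
  have h2 := succIdx_val i
  simp only [Fin.ext_iff, Fin.lt_def] at *
  split_ifs <;> omega

/-- The inversions of `w`. -/
def invSet (w : Equiv.Perm (Fin r)) : Finset (Fin r × Fin r) :=
  Finset.univ.filter fun x => x.1 < x.2 ∧ w x.2 < w x.1

theorem mem_invSet {w : Equiv.Perm (Fin r)} {x : Fin r × Fin r} :
    x ∈ invSet w ↔ x.1 < x.2 ∧ w x.2 < w x.1 := by
  simp [invSet]

/-- The number of inversions of `w`, which is its Coxeter length. -/
def inv (w : Equiv.Perm (Fin r)) : ℕ := (invSet w).card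

theorem inv_one : inv (Equiv.refl (Fin r)) = 0 := by
  rw [inv, Finset.card_eq_zero, invSet, Finset.filter_eq_empty_iff]
  rintro ⟨p, p'⟩ - ⟨h, h'⟩
  exact lt_asymm h h'

theorem inv_s_trans {w : Equiv.Perm (Fin r)} {i : Fin (r - 1)} (h : w (lo i) < w (succIdx i)) :
    inv ((s i).trans w) = inv w + 1 := by
  have hset : invSet ((s i).trans w) = insert (lo i, succIdx i)
      ((invSet w).map ((s i).prodCongr (s i)).toEmbedding) := by
    ext ⟨p, p'⟩
    rw [Finset.mem_insert, Finset.mem_map_equiv, mem_invSet, mem_invSet]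
    simp only [Equiv.trans_apply, Equiv.prodCongr_symm, s_symm, Equiv.prodCongr_apply,
      Prod.map, Prod.mk.injEq]
    constructor
    · rintro ⟨h1, h2⟩
      by_cases hp : p = lo i ∧ p' = succIdx i
      · exact Or.inl hp
      · exact Or.inr ⟨s_lt_s h1 hp, h2⟩
    · rintro (⟨rfl, rfl⟩ | ⟨h1, h2⟩)
      · exact ⟨lo_lt i, by rwa [s_lo, s_hi]⟩
      · refine ⟨?_, h2⟩
        have := s_lt_s (i := i) h1 (by
          rintro ⟨e1, e2⟩
          rw [e1, e2] at h2
          exact lt_asymm h h2)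
        rwa [s_s, s_s] at this
  rw [inv, hset, Finset.card_insert_of_notMem, Finset.card_map, inv]
  rw [Finset.mem_map_equiv]
  simp only [mem_invSet, Equiv.prodCongr_symm, s_symm,
    Equiv.prodCongr_apply, Prod.map, s_lo, s_hi, not_and]
  exact fun h' => absurd h' (lo_lt i).asymm

theorem inv_symm (w : Equiv.Perm (Fin r)) : inv w.symm = inv w := by
  refine Finset.card_bij (fun x _ => (w.symm x.2, w.symm x.1)) ?_ ?_ ?_
  · rintro ⟨p, p'⟩ hx
    simp only [mem_invSet] at hx ⊢
    simpa using hx.symm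
  · rintro ⟨p, p'⟩ _ ⟨q, q'⟩ _ h
    simpa [and_comm] using h
  · rintro ⟨p, p'⟩ hx
    refine ⟨(w p', w p), ?_, by simp⟩
    simp only [mem_invSet] at hx ⊢
    simpa using hx.symm

theorem s_trans_lo {w : Equiv.Perm (Fin r)} {i : Fin (r - 1)} (h : w (succIdx i) < w (lo i)) :
    ((s i).trans w) (lo i) < ((s i).trans w) (succIdx i) := by
  simpa [s_lo, s_hi] using h

theorem inv_of_descent {w : Equiv.Perm (Fin r)} {i : Fin (r - 1)} (h : w (succIdx i) < w (lo i)) :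
    inv w = inv ((s i).trans w) + 1 := by
  rw [← inv_s_trans (s_trans_lo h), s_trans_s_trans]

theorem lt_or_gt (w : Equiv.Perm (Fin r)) (i : Fin (r - 1)) :
    w (lo i) < w (succIdx i) ∨ w (succIdx i) < w (lo i) :=
  lt_or_gt_of_ne fun h => lo_ne i (w.injective h)

theorem eq_refl_of_ascents {w : Equiv.Perm (Fin r)} (h : ∀ i, w (lo i) < w (succIdx i)) :
    w = Equiv.refl _ := by
  cases r with
  | zero => exact Subsingleton.elim _ _
  | succ n =>
    have hm : StrictMono w := by
      rw [Fin.strictMono_iff_lt_succ]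
      exact fun i => h i
    ext p
    have := congrArg (fun f : Fin (n + 1) ≃o Fin (n + 1) => ((f p : Fin (n + 1)) : ℕ))
      (Subsingleton.elim (hm.orderIsoOfSurjective w w.surjective) (OrderIso.refl _))
    simpa using this

/-- Every permutation is built from the identity by length-increasing left multiplications. -/
theorem perm_induction {P : Equiv.Perm (Fin r) → Prop} (h1 : P (Equiv.refl _))
    (hs : ∀ w i, w (lo i) < w (succIdx i) → P w → P ((s i).trans w)) (w : Equiv.Perm (Fin r)) :
    P w := by
  induction hn : inv w using Nat.strong_induction_on generalizing w with
  | _ n ih =>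
    by_cases hw : ∀ i, w (lo i) < w (succIdx i)
    · rw [eq_refl_of_ascents hw]; exact h1
    · push Not at hw
      obtain ⟨i, hi⟩ := hw
      have hi' : w (succIdx i) < w (lo i) := (lt_or_gt w i).resolve_left (not_lt.mpr hi)
      have hl := inv_of_descent hi'
      have := hs ((s i).trans w) i (s_trans_lo hi') (ih _ (by omega) _ rfl)
      rwa [s_trans_s_trans] at this

theorem inv_wordPerm_le (l : List (Fin (r - 1))) : inv (wordPerm l) ≤ l.length := by
  induction l with
  | nil => simp [wordPerm, inv_one]
  | cons i l ih =>
    rw [wordPerm, List.length_cons]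
    rcases lt_or_gt (wordPerm l) i with h | h
    · rw [inv_s_trans h]; omega
    · have := inv_of_descent h; omega

theorem exists_word_length_eq_inv (w : Equiv.Perm (Fin r)) :
    ∃ l, wordPerm l = w ∧ l.length = inv w := by
  induction w using perm_induction with
  | h1 => exact ⟨[], rfl, inv_one.symm⟩
  | hs w i h ih =>
    obtain ⟨l, rfl, hl⟩ := ih
    exact ⟨i :: l, rfl, by rw [inv_s_trans h, List.length_cons, hl]⟩

theorem isReducedWord_iff {w : Equiv.Perm (Fin r)} {l : List (Fin (r - 1))} :
    IsReducedWord w l ↔ wordPerm l = w ∧ l.length = inv w := by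
  constructor
  · rintro ⟨rfl, hmin⟩
    obtain ⟨l', h, h'⟩ := exists_word_length_eq_inv (wordPerm l)
    exact ⟨rfl, le_antisymm (h' ▸ hmin l' h) (inv_wordPerm_le l)⟩
  · rintro ⟨rfl, h⟩
    exact ⟨rfl, fun l' h' => h ▸ h' ▸ inv_wordPerm_le l'⟩

theorem isReducedWord_cons {w : Equiv.Perm (Fin r)} {i : Fin (r - 1)} {l : List (Fin (r - 1))} :
    IsReducedWord w (i :: l) ↔ w (succIdx i) < w (lo i) ∧ IsReducedWord ((s i).trans w) l := by
  rw [isReducedWord_iff, isReducedWord_iff]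
  constructor
  · rintro ⟨rfl, hl⟩
    rw [wordPerm] at hl ⊢
    rw [s_trans_s_trans]
    have := inv_wordPerm_le l
    rw [List.length_cons] at hl
    rcases lt_or_gt (wordPerm l) i with h | h
    · rw [inv_s_trans h] at hl
      exact ⟨by simpa [s_lo, s_hi] using h, rfl, by omega⟩
    · have := inv_of_descent h; omega
  · rintro ⟨h, h1, h2⟩
    refine ⟨by rw [wordPerm, h1, s_trans_s_trans], ?_⟩
    rw [List.length_cons, h2, inv_of_descent h]

variable {M : Type*} [Monoid M]

/-- Matsumoto's theorem for the symmetric group: if two reduced words start with different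
letters `i`, `j`, then `i` and `j` are descents of `w`, and `w` has a reduced word starting with
the longest element of the parabolic subgroup of `s i` and `s j`. -/
theorem prod_eq_of_isReducedWord {g : Fin (r - 1) → M}
    (hbraid : ∀ i j : Fin (r - 1), (j : ℕ) = i + 1 → g i * g j * g i = g j * g i * g j)
    (hcomm : ∀ i j : Fin (r - 1), (i : ℕ) + 2 ≤ j → g i * g j = g j * g i)
    {w : Equiv.Perm (Fin r)} {l l' : List (Fin (r - 1))}
    (hl : IsReducedWord w l) (hl' : IsReducedWord w l') : (l.map g).prod = (l'.map g).prod := by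
  induction hn : inv w using Nat.strong_induction_on generalizing w l l' with
  | _ n ih =>
  have hlen := (isReducedWord_iff.mp hl).2
  have hlen' := (isReducedWord_iff.mp hl').2
  have step : ∀ {i l₁ l₂}, IsReducedWord w (i :: l₁) → IsReducedWord w (i :: l₂) →
      ((i :: l₁).map g).prod = ((i :: l₂).map g).prod := by
    intro i l₁ l₂ h₁ h₂
    rw [isReducedWord_cons] at h₁ h₂
    have := inv_of_descent h₁.1
    simp only [List.map_cons, List.prod_cons]
    rw [ih _ (by omega) h₁.2 h₂.2 rfl]
  have aux : ∀ {i j : Fin (r - 1)} {l₁ l₂}, (i : ℕ) < j → IsReducedWord w (i :: l₁) → IsReducedWord w (j :: l₂) →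
      ((i :: l₁).map g).prod = ((j :: l₂).map g).prod := by
    intro i j l₁ l₂ hij h₁ h₂
    have hi := (isReducedWord_cons.mp h₁).1
    have hj := (isReducedWord_cons.mp h₂).1
    rcases Nat.lt_or_ge (i + 1) (j : ℕ) with hlt | hge
    · obtain ⟨l₃, h₃⟩ := exists_isReducedWord ((s j).trans ((s i).trans w))
      have e1 : s i (lo j) = lo j := s_of_ne (by rw [Ne, Fin.ext_iff]; simp only [lo_val]; omega)
        (by rw [Ne, Fin.ext_iff]; simp only [lo_val, succIdx_val]; omega)
      have e2 : s i (succIdx j) = succIdx j := s_of_ne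
        (by rw [Ne, Fin.ext_iff]; simp only [lo_val, succIdx_val]; omega)
        (by rw [Ne, Fin.ext_iff]; simp only [succIdx_val]; omega)
      have e3 : s j (lo i) = lo i := s_of_ne (by rw [Ne, Fin.ext_iff]; simp only [lo_val]; omega)
        (by rw [Ne, Fin.ext_iff]; simp only [lo_val, succIdx_val]; omega)
      have e4 : s j (succIdx i) = succIdx i := s_of_ne
        (by rw [Ne, Fin.ext_iff]; simp only [lo_val, succIdx_val]; omega)
        (by rw [Ne, Fin.ext_iff]; simp only [succIdx_val]; omega)
      have hc : (s j).trans ((s i).trans w) = (s i).trans ((s j).trans w) := by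
        ext p
        simp only [Equiv.trans_apply]
        congr 2
        by_cases a1 : p = lo i
        · subst a1; rw [e3, s_lo, e4]
        by_cases a2 : p = succIdx i
        · subst a2; rw [e4, s_hi, e3]
        by_cases a3 : p = lo j
        · subst a3; rw [e1, s_lo, e2]
        by_cases a4 : p = succIdx j
        · subst a4; rw [e2, s_hi, e1]
        rw [s_of_ne a1 a2, s_of_ne a3 a4, s_of_ne a1 a2]
      have k₁ : IsReducedWord w (i :: j :: l₃) := by
        rw [isReducedWord_cons, isReducedWord_cons]
        refine ⟨hi, ?_, h₃⟩
        simpa [e1, e2] using hj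
      have k₂ : IsReducedWord w (j :: i :: l₃) := by
        rw [isReducedWord_cons, isReducedWord_cons]
        refine ⟨hj, ?_, hc ▸ h₃⟩
        simpa [e3, e4] using hi
      rw [step h₁ k₁, step h₂ k₂]
      simp only [List.map_cons, List.prod_cons, ← mul_assoc, hcomm i j hlt]
    · have hj1 : (j : ℕ) = i + 1 := by omega
      have hm : succIdx i = lo j := by simp [Fin.ext_iff, lo_val, succIdx_val, hj1]
      have e1 : s i (succIdx j) = succIdx j := s_of_ne
        (by rw [Ne, Fin.ext_iff]; simp only [lo_val, succIdx_val]; omega)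
        (by rw [Ne, Fin.ext_iff]; simp only [succIdx_val]; omega)
      have e2 : s j (lo i) = lo i := s_of_ne (by rw [Ne, Fin.ext_iff]; simp only [lo_val]; omega)
        (by rw [Ne, Fin.ext_iff]; simp only [lo_val, succIdx_val]; omega)
      have e3 : s i (lo j) = lo i := by rw [← hm, s_hi]
      have e4 : s j (succIdx i) = succIdx j := by rw [hm, s_lo]
      have hc : (s i).trans ((s j).trans ((s i).trans w)) =
          (s j).trans ((s i).trans ((s j).trans w)) := by
        ext p
        simp only [Equiv.trans_apply]
        congr 2
        by_cases a1 : p = lo i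
        · subst a1; rw [s_lo, e4, e1, e2, s_lo, e4]
        by_cases a2 : p = succIdx i
        · subst a2; rw [s_hi, e2, s_lo, e4, e1, hm, s_hi]
        by_cases a4 : p = succIdx j
        · subst a4; rw [e1, s_hi, e3, e2]
        have a3 : p ≠ lo j := hm ▸ a2
        rw [s_of_ne a1 a2, s_of_ne a3 a4, s_of_ne a1 a2, s_of_ne a3 a4]
      obtain ⟨l₃, h₃⟩ := exists_isReducedWord ((s i).trans ((s j).trans ((s i).trans w)))
      have hj' : w (succIdx j) < w (succIdx i) := hm ▸ hj
      have k₁ : IsReducedWord w (i :: j :: i :: l₃) := by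
        rw [isReducedWord_cons, isReducedWord_cons, isReducedWord_cons]
        refine ⟨hi, ?_, ?_, h₃⟩
        · simpa [e1, e3] using hj'.trans hi
        · simpa [e1, e2, e4, s_lo] using hj'
      have k₂ : IsReducedWord w (j :: i :: j :: l₃) := by
        rw [isReducedWord_cons, isReducedWord_cons, isReducedWord_cons]
        refine ⟨hj, ?_, ?_, hc ▸ h₃⟩
        · simpa [e2, e4] using hj'.trans hi
        · rw [hm] at hi
          simpa [e1, e2, e3, s_hi] using hi
      rw [step h₁ k₁, step h₂ k₂]
      simp only [List.map_cons, List.prod_cons, ← mul_assoc, hbraid i j hj1]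
  cases l with
  | nil =>
    cases l' with
    | nil => rfl
    | cons j l₂ => simp at hlen hlen'; omega
  | cons i l₁ =>
    cases l' with
    | nil => simp at hlen hlen'; omega
    | cons j l₂ =>
      rcases lt_trichotomy (i : ℕ) j with h | h | h
      · exact aux h hl hl'
      · obtain rfl : i = j := Fin.ext h
        exact step hl hl'
      · exact (aux h hl' hl).symm

end Words


/-! ### Relations in the Ariki–Koike algebra -/

section Relations

open MvPolynomial

variable {R : Type*} [CommRing R] {m r : ℕ}

/-- The family `F` in an `R`-algebra satisfies the defining relations of the generators
`T_0, …, T_{r-1}`. -/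
structure IsAK {B : Type*} [Ring B] [Algebra R B] (q : Rˣ) (u : Fin m → R) (F : Fin r → B) :
    Prop where
  braid4 : ∀ i j : Fin r, (i : ℕ) = 0 → (j : ℕ) = 1 → F i * F j * F i * F j = F j * F i * F j * F i
  braid3 : ∀ i j : Fin r, 1 ≤ (i : ℕ) → (j : ℕ) = i + 1 → F i * F j * F i = F j * F i * F j
  comm : ∀ i j : Fin r, (i : ℕ) + 2 ≤ j → F i * F j = F j * F i
  quad : ∀ i : Fin r, (i : ℕ) ≠ 0 → F i * F i = ((q : R) - 1) • F i + (q : R) • 1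
  cyc : ∀ i : Fin r, (i : ℕ) = 0 →
    Polynomial.aeval (F i) (∏ k, (Polynomial.X - Polynomial.C (u k))) = 0

theorem prod_ofFn_sub_algebraMap {B : Type*} [Ring B] [Algebra R B] (u : Fin m → R) (x : B) :
    (List.ofFn fun k => x - algebraMap R B (u k)).prod =
      Polynomial.aeval x (∏ k, (Polynomial.X - Polynomial.C (u k))) := by
  rw [← List.prod_ofFn, map_list_prod, List.map_ofFn]
  congr 2
  ext k
  simp

theorem quad_iff {B : Type*} [Ring B] [Algebra R B] (q : R) (x : B) :
    (x - algebraMap R B q) * (x + 1) = 0 ↔ x * x = (q - 1) • x + q • 1 := by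
  rw [← sub_eq_zero (a := x * x)]
  have : (x - algebraMap R B q) * (x + 1) = x * x - ((q - 1) • x + q • 1) := by
    rw [Algebra.algebraMap_eq_smul_one]
    simp only [sub_mul, mul_add, smul_mul_assoc, one_mul, mul_one, sub_smul, one_smul]
    abel
  rw [this]

theorem isAK_T (q : Rˣ) (u : Fin m → R) : IsAK q u (T (r := r) q u) where
  braid4 i j hi hj := by
    have := RingQuot.mkAlgHom_rel R (Rel.braid4 (q := q) (u := u) i j hi hj)
    simpa only [map_mul, T] using this
  braid3 i j hi hj := by
    have := RingQuot.mkAlgHom_rel R (Rel.braid3 (q := q) (u := u) i j hi hj)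
    simpa only [map_mul, T] using this
  comm i j h := by
    have := RingQuot.mkAlgHom_rel R (Rel.comm (q := q) (u := u) i j h)
    simpa only [map_mul, T] using this
  quad i hi := by
    have := RingQuot.mkAlgHom_rel R (Rel.quad (q := q) (u := u) i hi)
    rw [← quad_iff]
    simpa only [T, map_mul, map_sub, map_add, map_one, map_zero, AlgHom.commutes] using this
  cyc i hi := by
    have := RingQuot.mkAlgHom_rel R (Rel.cyc (q := q) (u := u) i hi)
    rw [prod_ofFn_sub_algebraMap, ← Polynomial.aeval_algHom_apply, map_zero] at this
    exact this

/-- The universal property of the Ariki–Koike algebra. -/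
def liftH {B : Type*} [Ring B] [Algebra R B] {q : Rˣ} {u : Fin m → R} {F : Fin r → B}
    (hF : IsAK q u F) : H r q u →ₐ[R] B :=
  RingQuot.liftAlgHom R ⟨FreeAlgebra.lift R F, by
    intro x y hxy
    cases hxy with
    | braid4 i j hi hj => simpa using hF.braid4 i j hi hj
    | braid3 i j hi hj => simpa using hF.braid3 i j hi hj
    | comm i j h => simpa using hF.comm i j h
    | quad i hi =>
      have := (quad_iff (q : R) (F i)).mpr (hF.quad i hi)
      simpa only [map_mul, map_sub, map_add, map_one, map_zero, AlgHom.commutes,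
        FreeAlgebra.lift_ι_apply] using this
    | cyc i hi =>
      rw [prod_ofFn_sub_algebraMap, ← Polynomial.aeval_algHom_apply, FreeAlgebra.lift_ι_apply,
        map_zero]
      exact hF.cyc i hi⟩

theorem liftH_T {B : Type*} [Ring B] [Algebra R B] {q : Rˣ} {u : Fin m → R} {F : Fin r → B}
    (hF : IsAK q u F) (i : Fin r) : liftH hF (T q u i) = F i := by
  rw [liftH, T, RingQuot.liftAlgHom_mkAlgHom_apply]
  exact FreeAlgebra.lift_ι_apply _ _

variable (q : Rˣ) (u : Fin m → R)

theorem adjoin_T : Algebra.adjoin R (Set.range (T (r := r) q u)) = ⊤ := by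
  have h : Set.range (T (r := r) q u) =
      RingQuot.mkAlgHom R (Rel r q u) '' Set.range (FreeAlgebra.ι R) := by
    rw [← Set.range_comp]; rfl
  rw [h, ← AlgHom.map_adjoin, FreeAlgebra.adjoin_range_ι, Algebra.map_top, AlgHom.range_eq_top]
  exact RingQuot.mkAlgHom_surjective R _

variable {q u} in
/-- A left ideal that contains `1` and is stable under the generators is everything. -/
theorem eq_top_of_T_mul_mem {S : Submodule R (H r q u)} (h1 : 1 ∈ S)
    (hT : ∀ i, ∀ x ∈ S, T q u i * x ∈ S) : S = ⊤ := by
  have key : ∀ y : H r q u, ∀ x ∈ S, y * x ∈ S := by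
    intro y
    have hy : y ∈ Algebra.adjoin R (Set.range (T (r := r) q u)) := by rw [adjoin_T]; trivial
    induction hy using Algebra.adjoin_induction with
    | mem y hy => obtain ⟨i, rfl⟩ := hy; exact hT i
    | algebraMap c => intro x hx; rw [← Algebra.smul_def]; exact S.smul_mem c hx
    | add y z _ _ hy hz => intro x hx; rw [add_mul]; exact S.add_mem (hy x hx) (hz x hx)
    | mul y z _ _ hy hz => intro x hx; rw [mul_assoc]; exact hy _ (hz x hx)
  rw [eq_top_iff]
  intro y _
  simpa using key y 1 h1

/-- The Hecke generator attached to the basic transposition `s i`. -/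
def G (i : Fin (r - 1)) : H r q u := T q u (succIdx i)

variable {q u} in
/-- The generators are `T_0` and the Hecke generators. -/
theorem eq_top_of_mul_mem {S : Submodule R (H r q u)} (h1 : 1 ∈ S)
    (h0 : ∀ p : Fin r, (p : ℕ) = 0 → ∀ x ∈ S, T q u p * x ∈ S)
    (hG : ∀ i, ∀ x ∈ S, G q u i * x ∈ S) : S = ⊤ := by
  refine eq_top_of_T_mul_mem h1 fun i x hx => ?_
  by_cases hi : (i : ℕ) = 0
  · exact h0 i hi x hx
  · obtain ⟨j, rfl⟩ : ∃ j, succIdx j = i :=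
      ⟨⟨i - 1, by omega⟩, by rw [Fin.ext_iff, succIdx_val]; simp only; omega⟩
    exact hG j x hx

theorem G_braid (i j : Fin (r - 1)) (h : (j : ℕ) = i + 1) :
    G q u i * G q u j * G q u i = G q u j * G q u i * G q u j :=
  (isAK_T q u).braid3 _ _ (by rw [succIdx_val]; omega) (by rw [succIdx_val, succIdx_val, h])

theorem G_comm (i j : Fin (r - 1)) (h : (i : ℕ) + 2 ≤ j) :
    G q u i * G q u j = G q u j * G q u i :=
  (isAK_T q u).comm _ _ (by rw [succIdx_val, succIdx_val]; omega)

theorem G_sq (i : Fin (r - 1)) :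
    G q u i * G q u i = ((q : R) - 1) • G q u i + (q : R) • 1 :=
  (isAK_T q u).quad _ (by rw [succIdx_val]; omega)

/-- The Jucys–Murphy element `L_{p+1}`. -/
def J (p : Fin r) : H r q u := L q u p p.isLt

theorem J_zero (p : Fin r) (hp : (p : ℕ) = 0) : J q u p = T q u p := by
  obtain ⟨p, h⟩ := p
  obtain rfl : p = 0 := hp
  rfl

theorem J_hi (i : Fin (r - 1)) :
    J q u (succIdx i) = ((q⁻¹ : Rˣ) : R) • (G q u i * J q u (lo i) * G q u i) := rfl

/-- An induction principle along the recursive definition of the elements `L_j`. -/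
theorem pos_induction {P : Fin r → Prop} (h0 : ∀ p : Fin r, (p : ℕ) = 0 → P p)
    (hs : ∀ i : Fin (r - 1), P (lo i) → P (succIdx i)) (p : Fin r) : P p := by
  obtain ⟨p, h⟩ := p
  induction p with
  | zero => exact h0 _ rfl
  | succ p ih => exact hs ⟨p, by omega⟩ (ih (by omega))

theorem T_zero_comm_G (p : Fin r) (hp : (p : ℕ) = 0) (i : Fin (r - 1)) (hi : (i : ℕ) ≠ 0) :
    Commute (T q u p) (G q u i) :=
  (isAK_T q u).comm _ _ (by rw [succIdx_val]; omega)

theorem J_comm_G_of_lt (p : Fin r) : ∀ i : Fin (r - 1), p < lo i → Commute (J q u p) (G q u i) := by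
  induction p using pos_induction with
  | h0 p hp =>
    intro i hi
    rw [J_zero q u p hp]
    refine T_zero_comm_G q u p hp i ?_
    have : (p : ℕ) < i := hi
    omega
  | hs j ih =>
    intro i hi
    have hi' : (j : ℕ) + 1 < i := hi
    have h1 : Commute (G q u j) (G q u i) := G_comm q u j i (by omega)
    rw [J_hi]
    exact (((h1.mul_left (ih i ((lo_lt j).trans hi))).mul_left h1).smul_left _)

theorem J_comm_G_of_gt (p : Fin r) :
    ∀ i : Fin (r - 1), succIdx i < p → Commute (J q u p) (G q u i) := by
  induction p using pos_induction with
  | h0 p hp =>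
    intro i hi
    rw [Fin.lt_def, hp] at hi
    omega
  | hs j ih =>
    intro i hi
    have hi' : (i : ℕ) + 1 < j + 1 := hi
    rcases Nat.lt_or_ge (i + 1) j with h | h
    · have h1 : Commute (G q u j) (G q u i) := (G_comm q u i j (by omega)).symm
      rw [J_hi]
      exact (((h1.mul_left (ih i h)).mul_left h1).smul_left _)
    · have hj : (j : ℕ) = i + 1 := by omega
      have hl : lo j = succIdx i := by rw [Fin.ext_iff, lo_val, succIdx_val, hj]
      have hb := G_braid q u i j hj
      have hc : Commute (J q u (lo i)) (G q u j) := J_comm_G_of_lt q u (lo i) j (by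
        rw [hl]; exact lo_lt i)
      rw [J_hi, hl, J_hi]
      refine Commute.smul_left ?_ _
      rw [mul_smul_comm, smul_mul_assoc]
      refine Commute.smul_left ?_ _
      rw [commute_iff_eq]
      calc G q u j * (G q u i * J q u (lo i) * G q u i) * G q u j * G q u i
          = G q u j * G q u i * J q u (lo i) * (G q u i * G q u j * G q u i) := by
            simp only [mul_assoc]
        _ = G q u j * G q u i * (J q u (lo i) * G q u j) * G q u i * G q u j := by
            rw [hb]; simp only [mul_assoc]
        _ = (G q u j * G q u i * G q u j) * J q u (lo i) * G q u i * G q u j := by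
            rw [hc.eq]; simp only [mul_assoc]
        _ = _ := by rw [← hb]; simp only [mul_assoc]

theorem J_comm_G {p : Fin r} {i : Fin (r - 1)} (h : p ≠ lo i) (h' : p ≠ succIdx i) :
    Commute (J q u p) (G q u i) := by
  rcases lt_or_gt_of_ne h with h1 | h1
  · exact J_comm_G_of_lt q u p i h1
  · refine J_comm_G_of_gt q u p i (lt_of_le_of_ne ?_ h'.symm)
    rw [Fin.le_def, succIdx_val]
    exact h1

theorem J_comm_J_of_lt (p : Fin r) : ∀ p' : Fin r, p < p' → Commute (J q u p) (J q u p') := by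
  induction p using pos_induction with
  | h0 p hp =>
    intro p'
    rw [J_zero q u p hp]
    induction p' using pos_induction with
    | h0 p' hp' => intro h; rw [Fin.lt_def] at h; omega
    | hs j ih =>
      intro _
      rw [J_hi]
      refine Commute.smul_right ?_ _
      by_cases hj : (j : ℕ) = 0
      · have hpj : lo j = p := by rw [Fin.ext_iff, lo_val, hj, hp]
        rw [hpj, J_zero q u p hp, commute_iff_eq]
        have := (isAK_T q u).braid4 p (succIdx j) hp (by rw [succIdx_val, hj])
        simpa only [mul_assoc, G] using this
      · have hc := T_zero_comm_G q u p hp j hj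
        exact (hc.mul_right (ih (by rw [Fin.lt_def, lo_val]; omega))).mul_right hc
  | hs i ih =>
    intro p' hp'
    rw [J_hi]
    have hc := (J_comm_G_of_gt q u p' i hp').symm
    exact ((hc.mul_left (ih p' ((lo_lt i).trans hp'))).mul_left hc).smul_left _

theorem J_comm_J (p p' : Fin r) : Commute (J q u p) (J q u p') := by
  rcases lt_trichotomy p p' with h | rfl | h
  · exact J_comm_J_of_lt q u p p' h
  · exact Commute.refl _
  · exact (J_comm_J_of_lt q u p' p h).symm

theorem inv_smul_q_smul (x : H r q u) : ((q⁻¹ : Rˣ) : R) • (q : R) • x = x := by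
  rw [smul_smul, Units.inv_mul, one_smul]

theorem G_mul_J_lo (i : Fin (r - 1)) :
    G q u i * J q u (lo i) = J q u (succIdx i) * G q u i - ((q : R) - 1) • J q u (succIdx i) := by
  rw [J_hi, smul_mul_assoc, mul_assoc _ (G q u i) (G q u i), G_sq, mul_add, mul_smul_comm,
    mul_smul_comm, mul_one, smul_add, inv_smul_q_smul, smul_comm (_ : R) ((q : R) - 1)]
  abel

theorem G_mul_J_hi (i : Fin (r - 1)) :
    G q u i * J q u (succIdx i) = J q u (lo i) * G q u i + ((q : R) - 1) • J q u (succIdx i) := by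
  rw [J_hi, mul_smul_comm, mul_assoc (G q u i) (J q u _), ← mul_assoc (G q u i) (G q u i), G_sq,
    add_mul, smul_mul_assoc, smul_mul_assoc, one_mul, smul_add, inv_smul_q_smul,
    smul_comm (_ : R) ((q : R) - 1)]
  abel

/-- The (commutative) subalgebra generated by the elements `L_j`. -/
def jmAlg : Subalgebra R (H r q u) := Algebra.adjoin R (Set.range (J q u))

instance : IsMulCommutative (jmAlg (r := r) q u) :=
  Algebra.isMulCommutative_adjoin R (by
    rintro _ ⟨p, rfl⟩ _ ⟨p', rfl⟩
    exact J_comm_J q u p p')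

open scoped IsMulCommutative in
/-- Evaluation of polynomials at the commuting elements `L_1, …, L_r`. -/
noncomputable def ev : MvPolynomial (Fin r) R →ₐ[R] H r q u :=
  (jmAlg (r := r) q u).val.comp
    (aeval fun p => (⟨J q u p, Algebra.subset_adjoin ⟨p, rfl⟩⟩ : jmAlg (r := r) q u))

theorem ev_X (p : Fin r) : ev q u (X p) = J q u p := by
  simp [ev]

theorem ev_comm (f g : MvPolynomial (Fin r) R) : Commute (ev q u f) (ev q u g) := by
  rw [commute_iff_eq, ← map_mul, mul_comm, map_mul]

theorem exists_G_mul_ev (i : Fin (r - 1)) (f : MvPolynomial (Fin r) R) :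
    ∃ f₁ f₂, G q u i * ev q u f = ev q u f₁ * G q u i + ev q u f₂ := by
  induction f using MvPolynomial.induction_on with
  | C c =>
    refine ⟨C c, 0, ?_⟩
    rw [map_zero, add_zero]
    rw [← MvPolynomial.algebraMap_eq, AlgHom.commutes]
    exact (Algebra.commutes c _).symm
  | add f g hf hg =>
    obtain ⟨f₁, f₂, hf⟩ := hf
    obtain ⟨g₁, g₂, hg⟩ := hg
    refine ⟨f₁ + g₁, f₂ + g₂, ?_⟩
    simp only [map_add, mul_add, add_mul, hf, hg]
    abel
  | mul_X f p hf =>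
    obtain ⟨f₁, f₂, hf⟩ := hf
    rw [map_mul, ← mul_assoc, hf, add_mul, mul_assoc, ev_X]
    by_cases h : p = lo i
    · subst h
      refine ⟨f₁ * X (succIdx i), f₂ * X (lo i) - ((q : R) - 1) • (f₁ * X (succIdx i)), ?_⟩
      rw [G_mul_J_lo]
      simp only [map_mul, map_sub, map_smul, ev_X, mul_sub, mul_smul_comm, mul_assoc]
      abel
    by_cases h' : p = succIdx i
    · subst h'
      refine ⟨f₁ * X (lo i), f₂ * X (succIdx i) + ((q : R) - 1) • (f₁ * X (succIdx i)), ?_⟩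
      rw [G_mul_J_hi]
      simp only [map_mul, map_add, map_smul, ev_X, mul_add, mul_smul_comm, mul_assoc]
      abel
    · refine ⟨f₁ * X p, f₂ * X p, ?_⟩
      rw [← (J_comm_G q u h h').eq]
      simp only [map_mul, ev_X, mul_assoc]

/-- The subalgebra generated by the Hecke generators. -/
def Hfin (r : ℕ) (q : Rˣ) (u : Fin m → R) : Subalgebra R (H r q u) :=
  Algebra.adjoin R (Set.range (G q u))

theorem G_mem_Hfin (i : Fin (r - 1)) : G q u i ∈ Hfin r q u := Algebra.subset_adjoin ⟨i, rfl⟩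

/-- `H = R[L_1, …, L_r] · ℋ(𝔖_r)`. -/
theorem span_ev_mul : Submodule.span R
    {x : H r q u | ∃ f, ∃ h ∈ Hfin r q u, x = ev q u f * h} = ⊤ := by
  set S := Submodule.span R {x : H r q u | ∃ f, ∃ h ∈ Hfin r q u, x = ev q u f * h} with hS
  have hmem : ∀ f, ∀ h ∈ Hfin r q u, ev q u f * h ∈ S := fun f h hh =>
    Submodule.subset_span ⟨f, h, hh, rfl⟩
  refine eq_top_of_mul_mem ?_ ?_ ?_
  · simpa using hmem 1 1 (Subalgebra.one_mem _)
  · intro p hp x hx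
    induction hx using Submodule.span_induction with
    | mem x hx =>
      obtain ⟨f, h, hh, rfl⟩ := hx
      rw [← J_zero q u p hp, ← ev_X, ← mul_assoc, ← map_mul]
      exact hmem _ _ hh
    | zero => rw [mul_zero]; exact S.zero_mem
    | add x y _ _ hx hy => rw [mul_add]; exact S.add_mem hx hy
    | smul c x _ hx => rw [mul_smul_comm]; exact S.smul_mem c hx
  · intro i x hx
    induction hx using Submodule.span_induction with
    | mem x hx =>
      obtain ⟨f, h, hh, rfl⟩ := hx
      obtain ⟨f₁, f₂, hf⟩ := exists_G_mul_ev q u i f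
      rw [← mul_assoc, hf, add_mul, mul_assoc]
      exact S.add_mem (hmem _ _ (Subalgebra.mul_mem _ (G_mem_Hfin q u i) hh)) (hmem _ _ hh)
    | zero => rw [mul_zero]; exact S.zero_mem
    | add x y _ _ hx hy => rw [mul_add]; exact S.add_mem hx hy
    | smul c x _ hx => rw [mul_smul_comm]; exact S.smul_mem c hx

/-- The anti-automorphism of `H` that fixes the generators, as a map to the opposite algebra. -/
def invol : H r q u →ₐ[R] (H r q u)ᵐᵒᵖ :=
  liftH (F := fun i => MulOpposite.op (T q u i))
    { braid4 := fun i j hi hj => by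
        simpa only [← MulOpposite.op_mul, mul_assoc] using
          congrArg MulOpposite.op ((isAK_T q u).braid4 i j hi hj).symm
      braid3 := fun i j hi hj => by
        simpa only [← MulOpposite.op_mul, mul_assoc] using
          congrArg MulOpposite.op ((isAK_T q u).braid3 i j hi hj)
      comm := fun i j h => by
        simpa only [← MulOpposite.op_mul, mul_assoc] using
          congrArg MulOpposite.op ((isAK_T q u).comm i j h).symm
      quad := fun i h => by
        rw [← MulOpposite.op_mul, (isAK_T q u).quad i h]; rfl
      cyc := fun i h => by
        have h1 : ∀ f : Polynomial R, Polynomial.aeval (MulOpposite.op (T q u i)) f =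
            MulOpposite.op (Polynomial.aeval (T q u i) f) := by
          intro f
          induction f using Polynomial.induction_on with
          | C c => simp
          | add f g hf hg => simp [hf, hg]
          | monomial n c _ =>
            simp only [map_mul, map_pow, Polynomial.aeval_C, Polynomial.aeval_X,
              MulOpposite.op_mul, MulOpposite.op_pow, MulOpposite.algebraMap_apply]
            rw [← MulOpposite.algebraMap_apply, Algebra.commutes]
        rw [h1, (isAK_T q u).cyc i h, MulOpposite.op_zero] }

/-- The anti-automorphism of `H` that fixes the generators. -/
def st (x : H r q u) : H r q u := (invol q u x).unop

theorem st_mul (x y : H r q u) : st q u (x * y) = st q u y * st q u x := by simp [st]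

theorem st_add (x y : H r q u) : st q u (x + y) = st q u x + st q u y := by simp [st]

theorem st_smul (c : R) (x : H r q u) : st q u (c • x) = c • st q u x := by simp [st]

theorem st_zero : st q u (0 : H r q u) = 0 := by simp [st]

theorem st_one : st q u (1 : H r q u) = 1 := by simp [st]

theorem st_algebraMap (c : R) : st q u (algebraMap R (H r q u) c) = algebraMap R _ c := by
  rw [Algebra.algebraMap_eq_smul_one, st_smul, st_one]

theorem st_T (i : Fin r) : st q u (T q u i) = T q u i := by
  rw [st, invol, liftH_T]; rfl

theorem st_st (x : H r q u) : st q u (st q u x) = x := by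
  have h : x ∈ Algebra.adjoin R (Set.range (T (r := r) q u)) := by rw [adjoin_T]; trivial
  induction h using Algebra.adjoin_induction with
  | mem y hy => obtain ⟨i, rfl⟩ := hy; rw [st_T, st_T]
  | algebraMap c => rw [st_algebraMap, st_algebraMap]
  | add y z _ _ hy hz => rw [st_add, st_add, hy, hz]
  | mul y z _ _ hy hz => rw [st_mul, st_mul, hy, hz]

theorem st_G (i : Fin (r - 1)) : st q u (G q u i) = G q u i := st_T q u _

theorem st_J (p : Fin r) : st q u (J q u p) = J q u p := by
  induction p using pos_induction with
  | h0 p hp => rw [J_zero q u p hp, st_T]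
  | hs i ih => rw [J_hi, st_smul, st_mul, st_mul, ih, st_G, mul_assoc]

theorem st_ev (f : MvPolynomial (Fin r) R) : st q u (ev q u f) = ev q u f := by
  induction f using MvPolynomial.induction_on with
  | C c => rw [← MvPolynomial.algebraMap_eq, AlgHom.commutes, st_algebraMap]
  | add f g hf hg => rw [map_add, st_add, hf, hg]
  | mul_X f p hf => rw [map_mul, st_mul, hf, ev_X, st_J, ← ev_X, (ev_comm q u _ _).eq]

/-- A subalgebra generated by some of the Hecke generators is stable under the
anti-automorphism. -/
theorem st_mem_adjoin {I : Set (Fin (r - 1))} {x : H r q u}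
    (hx : x ∈ Algebra.adjoin R (G q u '' I)) : st q u x ∈ Algebra.adjoin R (G q u '' I) := by
  induction hx using Algebra.adjoin_induction with
  | mem y hy =>
    obtain ⟨i, hi, rfl⟩ := hy
    rw [st_G]
    exact Algebra.subset_adjoin ⟨i, hi, rfl⟩
  | algebraMap c => rw [st_algebraMap]; exact Subalgebra.algebraMap_mem _ c
  | add y z _ _ hy hz => rw [st_add]; exact Subalgebra.add_mem _ hy hz
  | mul y z _ _ hy hz => rw [st_mul]; exact Subalgebra.mul_mem _ hz hy

theorem st_mem_Hfin {x : H r q u} (hx : x ∈ Hfin r q u) : st q u x ∈ Hfin r q u := by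
  rw [Hfin, ← Set.image_univ] at hx ⊢
  exact st_mem_adjoin q u hx

/-! ### The elements `T_w` -/

theorem Tw_eq_wordT {w : Equiv.Perm (Fin r)} {l : List (Fin (r - 1))} (hl : IsReducedWord w l) :
    Tw q u w = wordT q u l :=
  prod_eq_of_isReducedWord (G_braid q u) (G_comm q u) (exists_isReducedWord w).choose_spec hl

theorem Tw_refl : Tw q u (Equiv.refl (Fin r)) = 1 := by
  exact Tw_eq_wordT q u (l := []) (isReducedWord_iff.mpr ⟨rfl, inv_one.symm⟩)

theorem Tw_s_trans {w : Equiv.Perm (Fin r)} {i : Fin (r - 1)} (h : w (lo i) < w (succIdx i)) :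
    Tw q u ((s i).trans w) = G q u i * Tw q u w := by
  obtain ⟨l, hl⟩ := exists_isReducedWord w
  rw [Tw_eq_wordT q u hl, Tw_eq_wordT q u (l := i :: l)]
  · rfl
  · rw [isReducedWord_iff] at hl ⊢
    exact ⟨by rw [wordPerm, hl.1], by rw [List.length_cons, hl.2, inv_s_trans h]⟩

theorem Tw_trans_s {w : Equiv.Perm (Fin r)} {i : Fin (r - 1)}
    (h : w.symm (lo i) < w.symm (succIdx i)) :
    Tw q u (w.trans (s i)) = Tw q u w * G q u i := by
  obtain ⟨l, hl⟩ := exists_isReducedWord w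
  rw [Tw_eq_wordT q u hl, Tw_eq_wordT q u (l := l ++ [i])]
  · simp [wordT, G]
  · rw [isReducedWord_iff] at hl ⊢
    refine ⟨?_, ?_⟩
    · rw [wordPerm_append, hl.1]; rfl
    · rw [List.length_append, hl.2, ← inv_symm w, ← inv_symm (w.trans (s i))]
      exact (inv_s_trans h).symm

theorem Tw_of_descent {w : Equiv.Perm (Fin r)} {i : Fin (r - 1)} (h : w (succIdx i) < w (lo i)) :
    Tw q u w = G q u i * Tw q u ((s i).trans w) := by
  rw [← Tw_s_trans q u (s_trans_lo h), s_trans_s_trans]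

theorem Hfin_le_span_Tw :
    Subalgebra.toSubmodule (Hfin r q u) ≤ Submodule.span R (Set.range (Tw (r := r) q u)) := by
  set S := Submodule.span R (Set.range (Tw (r := r) q u)) with hS
  have hmem : ∀ w, Tw q u w ∈ S := fun w => Submodule.subset_span ⟨w, rfl⟩
  have hG : ∀ i, ∀ x ∈ S, G q u i * x ∈ S := by
    intro i x hx
    induction hx using Submodule.span_induction with
    | mem x hx =>
      obtain ⟨w, rfl⟩ := hx
      rcases lt_or_gt w i with h | h
      · rw [← Tw_s_trans q u h]; exact hmem _
      · rw [Tw_of_descent q u h, ← mul_assoc, G_sq, add_mul, smul_mul_assoc, smul_mul_assoc,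
          one_mul, ← Tw_of_descent q u h]
        exact S.add_mem (S.smul_mem _ (hmem _)) (S.smul_mem _ (hmem _))
    | zero => rw [mul_zero]; exact S.zero_mem
    | add x y _ _ hx hy => rw [mul_add]; exact S.add_mem hx hy
    | smul c x _ hx => rw [mul_smul_comm]; exact S.smul_mem c hx
  have key : ∀ y ∈ Hfin r q u, ∀ x ∈ S, y * x ∈ S := by
    intro y hy
    induction hy using Algebra.adjoin_induction with
    | mem y hy => obtain ⟨i, rfl⟩ := hy; exact hG i
    | algebraMap c => intro x hx; rw [← Algebra.smul_def]; exact S.smul_mem c hx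
    | add y z _ _ hy hz => intro x hx; rw [add_mul]; exact S.add_mem (hy x hx) (hz x hx)
    | mul y z _ _ hy hz => intro x hx; rw [mul_assoc]; exact hy _ (hz x hx)
  intro y hy
  have := key y hy 1 (Tw_refl q u ▸ hmem _)
  rwa [mul_one] at this

end Relations


section Vanishing

open MvPolynomial

variable {R : Type*} [CommRing R] {m r : ℕ} (q : Rˣ) (u : Fin m → R)

/-! ### Products of linear factors in the elements `L_j` -/

/-- The product over all `p` of the factors `X_p - w_k`, `k ∈ K p`. -/
noncomputable def PK (w : Fin m → R) (K : Fin r → Finset (Fin m)) : MvPolynomial (Fin r) R :=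
  ∏ p, ∏ k ∈ K p, (X p - C (w k))

theorem PK_dvd (w : Fin m → R) {K K' : Fin r → Finset (Fin m)} (h : ∀ p, K p ⊆ K' p) :
    PK w K ∣ PK w K' :=
  Finset.prod_dvd_prod_of_dvd _ _ fun p _ => Finset.prod_dvd_prod_of_subset _ _ _ (h p)

/-- The polynomials in the `L_j` that commute with `T_{i+1}`. -/
noncomputable def commPoly (i : Fin (r - 1)) : Subalgebra R (MvPolynomial (Fin r) R) :=
  (Subalgebra.centralizer R {G q u i}).comap (ev q u)

theorem mem_commPoly {i : Fin (r - 1)} {f : MvPolynomial (Fin r) R} :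
    f ∈ commPoly q u i ↔ Commute (G q u i) (ev q u f) := by
  simp [commPoly, Subalgebra.mem_centralizer_iff, commute_iff_eq]

theorem X_mem_commPoly {i : Fin (r - 1)} {p : Fin r} (h : p ≠ lo i) (h' : p ≠ succIdx i) :
    X p ∈ commPoly q u i := by
  rw [mem_commPoly, ev_X]
  exact (J_comm_G q u h h').symm

theorem mul_mem_commPoly (i : Fin (r - 1)) (x : R) :
    (X (lo i) - C x) * (X (succIdx i) - C x) ∈ commPoly q u i := by
  have h1 : X (lo i) * X (succIdx i) ∈ commPoly q u i := by
    rw [mem_commPoly, map_mul, ev_X, ev_X, commute_iff_eq, (J_comm_J q u _ _).eq, ← mul_assoc,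
      G_mul_J_hi, add_mul, mul_assoc, G_mul_J_lo, smul_mul_assoc, mul_sub, mul_smul_comm,
      ← mul_assoc, (J_comm_J q u (lo i) _).eq]
    abel
  have h2 : X (lo i) + X (succIdx i) ∈ commPoly q u i := by
    rw [mem_commPoly, map_add, ev_X, ev_X, commute_iff_eq, mul_add, G_mul_J_hi, G_mul_J_lo,
      add_mul]
    abel
  have e : (X (lo i) - C x) * (X (succIdx i) - C x) =
      X (lo i) * X (succIdx i) - x • (X (lo i) + X (succIdx i)) +
        algebraMap R (MvPolynomial (Fin r) R) (x * x) := by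
    rw [MvPolynomial.algebraMap_eq, C_mul, MvPolynomial.smul_eq_C_mul]
    ring
  rw [e]
  exact Subalgebra.add_mem _ (Subalgebra.sub_mem _ h1 (Subalgebra.smul_mem _ h2 x))
    (Subalgebra.algebraMap_mem _ _)

theorem G_comm_ev_PK {i : Fin (r - 1)} (w : Fin m → R) {K : Fin r → Finset (Fin m)}
    (h : K (lo i) = K (succIdx i)) : Commute (G q u i) (ev q u (PK w K)) := by
  rw [← mem_commPoly, PK, ← Finset.mul_prod_erase _ _ (Finset.mem_univ (lo i)),
    ← Finset.mul_prod_erase _ _ (Finset.mem_erase.mpr ⟨(lo_ne i).symm, Finset.mem_univ _⟩),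
    ← mul_assoc, ← h, ← Finset.prod_mul_distrib]
  refine Subalgebra.mul_mem _ (Subalgebra.prod_mem _ fun k _ => mul_mem_commPoly q u i (w k)) ?_
  refine Subalgebra.prod_mem _ fun p hp => Subalgebra.prod_mem _ fun k _ => ?_
  rw [Finset.mem_erase, Finset.mem_erase] at hp
  exact Subalgebra.sub_mem _ (X_mem_commPoly q u hp.2.1 hp.1) (Subalgebra.algebraMap_mem _ (w k))

/-! ### The vanishing lemma -/

theorem Tw_comm_J_zero {z : Fin r} (hz : (z : ℕ) = 0) (σ : Equiv.Perm (Fin r)) :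
    σ z = z → Commute (J q u z) (Tw q u σ) := by
  induction σ using perm_induction with
  | h1 => intro _; rw [Tw_refl]; exact Commute.one_right _
  | hs w i h ih =>
    intro hσ
    have h1 : z ≠ lo i := by
      rintro rfl
      rw [Equiv.trans_apply, s_lo] at hσ
      rw [hσ, Fin.lt_def] at h
      omega
    have h2 : z ≠ succIdx i := by
      rintro rfl
      rw [succIdx_val] at hz
      omega
    rw [Equiv.trans_apply, s_of_ne h1 h2] at hσ
    rw [Tw_s_trans q u h]
    exact (J_comm_G q u h1 h2).mul_right (ih hσ)

theorem ev_prod_J_zero {w : Fin m → R} {z : Fin r} (hz : (z : ℕ) = 0)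
    (hw : ∏ k, (Polynomial.X - Polynomial.C (w k)) = ∏ k, (Polynomial.X - Polynomial.C (u k))) :
    ev q u (∏ k, (X z - C (w k))) = 0 := by
  have h1 := (isAK_T (r := r) q u).cyc z hz
  rw [← hw, ← J_zero q u z hz, ← ev_X, Polynomial.aeval_algHom_apply] at h1
  rw [← h1]
  congr 1
  rw [map_prod]
  refine Finset.prod_congr rfl fun k _ => ?_
  simp [MvPolynomial.algebraMap_eq]

theorem s_mem_iff {A : Finset (Fin r)} {i : Fin (r - 1)} (h : lo i ∈ A ↔ succIdx i ∈ A)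
    (p : Fin r) : s i p ∈ A ↔ p ∈ A := by
  by_cases h1 : p = lo i
  · rw [h1, s_lo, h]
  by_cases h2 : p = succIdx i
  · rw [h2, s_hi, h]
  rw [s_of_ne h1 h2]

/-- The index family of the product `∏_{p ∈ A} ∏_{k ∈ K} (L_p - w_k)`. -/
def onSet (A : Finset (Fin r)) (K : Finset (Fin m)) (p : Fin r) : Finset (Fin m) :=
  if p ∈ A then K else ∅

theorem onSet_eq {A : Finset (Fin r)} (K : Finset (Fin m)) {i : Fin (r - 1)}
    (h : lo i ∈ A ↔ succIdx i ∈ A) : onSet A K (lo i) = onSet A K (succIdx i) := by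
  simp only [onSet, h]

theorem PK_onSet_of_mem (w : Fin m → R) {A : Finset (Fin r)} (K : Finset (Fin m)) {z : Fin r}
    (hz : z ∈ A) : ∏ k ∈ K, (X z - C (w k)) ∣ PK w (onSet A K) := by
  have := Finset.dvd_prod_of_mem (fun p => ∏ k ∈ onSet A K p, (X p - C (w k))) (Finset.mem_univ z)
  rwa [show onSet A K z = K from if_pos hz] at this

/-- If a permutation meets no inversion inside the initial segment `A`, then it is smallest
at the first letter. -/
theorem apply_zero_le {z : Fin r} (hz : (z : ℕ) = 0) {A : Finset (Fin r)}
    (hA : IsLowerSet (A : Set (Fin r))) {σ : Equiv.Perm (Fin r)}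
    (h : ∀ i, lo i ∈ A → succIdx i ∈ A → σ (lo i) ≤ σ (succIdx i)) (p : Fin r) :
    p ∈ A → σ z ≤ σ p := by
  induction p using pos_induction with
  | h0 p hp =>
    intro _
    rw [show p = z from Fin.ext (hp.trans hz.symm)]
  | hs i ih =>
    intro hp
    have hl : lo i ∈ A := hA (lo_lt i).le hp
    exact (ih hl).trans (h i hl hp)

/-- Complementary factors on the initial segments `A` and `C` annihilate `T_σ` as soon as `σ` maps
a point of `A` into `C`.  Moving to a shorter `σ` whenever a simple factor of `T_σ` commutes with
one of the products, one is left with a `σ` that fixes the first letter; then `T_σ` commutes with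
`L_1`, and the cyclotomic relation applies. -/
theorem ev_mul_Tw_mul_ev_eq_zero {w : Fin m → R}
    (hw : ∏ k, (Polynomial.X - Polynomial.C (w k)) = ∏ k, (Polynomial.X - Polynomial.C (u k)))
    {A C : Finset (Fin r)} (hA : IsLowerSet (A : Set (Fin r))) (hC : IsLowerSet (C : Set (Fin r)))
    (K : Finset (Fin m)) (σ : Equiv.Perm (Fin r)) (p : Fin r) (hp : p ∈ A) (hσ : σ p ∈ C) :
    ev q u (PK w (onSet A K)) * Tw q u σ * ev q u (PK w (onSet C Kᶜ)) = 0 := by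
  induction hn : inv σ using Nat.strong_induction_on generalizing σ p with
  | _ n ih =>
  by_cases h1 : ∃ i, (lo i ∈ A ↔ succIdx i ∈ A) ∧ σ (succIdx i) < σ (lo i)
  · obtain ⟨i, hi, hd⟩ := h1
    have hl := inv_of_descent hd
    have := ih _ (by omega) ((s i).trans σ) (s i p) ((s_mem_iff hi p).mpr hp)
      (by rwa [Equiv.trans_apply, s_s]) rfl
    rw [Tw_of_descent q u hd, ← mul_assoc, ← (G_comm_ev_PK q u w (onSet_eq K hi)).eq, mul_assoc,
      mul_assoc, ← mul_assoc _ (Tw q u _), this, mul_zero]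
  by_cases h2 : ∃ i, (lo i ∈ C ↔ succIdx i ∈ C) ∧ σ.symm (succIdx i) < σ.symm (lo i)
  · obtain ⟨i, hi, hd⟩ := h2
    have hl := inv_of_descent hd
    have hl' : inv ((s i).trans σ.symm) = inv (σ.trans (s i)) := (inv_symm (σ.trans (s i)))
    rw [inv_symm, hl'] at hl
    have := ih _ (by omega) (σ.trans (s i)) p hp
      (by rwa [Equiv.trans_apply, s_mem_iff hi]) rfl
    have hT : Tw q u σ = Tw q u (σ.trans (s i)) * G q u i := by
      have := Tw_trans_s q u (w := σ.trans (s i)) (i := i) (s_trans_lo hd)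
      rwa [trans_s_trans_s] at this
    rw [hT, mul_assoc, mul_assoc, (G_comm_ev_PK q u w (onSet_eq _ hi)).eq, ← mul_assoc,
      ← mul_assoc, this, zero_mul]
  push Not at h1 h2
  have h0 : 0 < r := p.pos
  set z : Fin r := ⟨0, h0⟩ with hzdef
  have hz : (z : ℕ) = 0 := rfl
  have hzp : ∀ p : Fin r, z ≤ p := fun p => Nat.zero_le _
  have hzA : z ∈ A := hA (hzp p) hp
  have hσz : σ z ∈ C := hC (apply_zero_le hz hA
    (fun i a b => h1 i (iff_of_true a b)) p hp) hσ
  have hzC : z ∈ C := hC (hzp _) hσz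
  have hfix : σ z = z := by
    have := apply_zero_le hz hC (σ := σ.symm) (fun i a b => h2 i (iff_of_true a b)) _ hσz
    rw [Equiv.symm_apply_apply] at this
    have h3 : σ.symm z = z := le_antisymm this (hzp _)
    exact (Equiv.symm_apply_eq _).mp h3 |>.symm
  obtain ⟨f, hf⟩ := PK_onSet_of_mem w K hzA
  obtain ⟨g, hg⟩ := PK_onSet_of_mem w Kᶜ hzC
  have hcomm : ∀ K' : Finset (Fin m),
      Commute (ev q u (∏ k ∈ K', (X z - MvPolynomial.C (w k)))) (Tw q u σ) := by
    intro K'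
    have : ∏ k ∈ K', (X z - MvPolynomial.C (w k)) ∈
        (Subalgebra.centralizer R {Tw q u σ}).comap (ev q u) := by
      refine Subalgebra.prod_mem _ fun k _ => Subalgebra.sub_mem _ ?_
        (Subalgebra.algebraMap_mem _ (w k))
      simp [Subalgebra.mem_centralizer_iff, ev_X, (Tw_comm_J_zero q u hz σ hfix).eq]
    simpa [Subalgebra.mem_centralizer_iff, commute_iff_eq, eq_comm] using this
  have hfull := ev_prod_J_zero q u hz hw
  rw [← Finset.prod_mul_prod_compl K, map_mul] at hfull
  rw [hf, hg, mul_comm _ f, map_mul, map_mul, mul_assoc (ev q u f), (hcomm K).eq,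
    mul_assoc, mul_assoc, ← mul_assoc (ev q u _) (ev q u _) (ev q u g), hfull, zero_mul, mul_zero,
    mul_zero]

theorem ev_mul_mul_ev_eq_zero {w : Fin m → R}
    (hw : ∏ k, (Polynomial.X - Polynomial.C (w k)) = ∏ k, (Polynomial.X - Polynomial.C (u k)))
    {A C : Finset (Fin r)} (hA : IsLowerSet (A : Set (Fin r))) (hC : IsLowerSet (C : Set (Fin r)))
    (hcard : r < A.card + C.card) (K : Finset (Fin m)) (y : H r q u) :
    ev q u (PK w (onSet A K)) * y * ev q u (PK w (onSet C Kᶜ)) = 0 := by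
  have hex : ∀ σ : Equiv.Perm (Fin r), ∃ p ∈ A, σ p ∈ C := by
    intro σ
    by_contra! hcon
    have hdisj : Disjoint (A.map σ.toEmbedding) C := by
      rw [Finset.disjoint_left]
      intro p hp
      rw [Finset.mem_map] at hp
      obtain ⟨p', hp', rfl⟩ := hp
      exact hcon p' hp'
    have := Finset.card_le_univ (A.map σ.toEmbedding ∪ C)
    rw [Finset.card_union_of_disjoint hdisj, Finset.card_map, Fintype.card_fin] at this
    omega
  set φ : H r q u →ₗ[R] H r q u := (LinearMap.mulRight R (ev q u (PK w (onSet C Kᶜ)))).comp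
    (LinearMap.mulLeft R (ev q u (PK w (onSet A K)))) with hφ
  have hφ_apply : ∀ x, φ x = ev q u (PK w (onSet A K)) * x * ev q u (PK w (onSet C Kᶜ)) :=
    fun x => rfl
  have hT : Subalgebra.toSubmodule (Hfin r q u) ≤ LinearMap.ker φ := by
    refine (Hfin_le_span_Tw q u).trans (Submodule.span_le.mpr ?_)
    rintro _ ⟨σ, rfl⟩
    obtain ⟨p, hp, hσ⟩ := hex σ
    exact ev_mul_Tw_mul_ev_eq_zero q u hw hA hC K σ p hp hσ
  have hall : (⊤ : Submodule R (H r q u)) ≤ LinearMap.ker φ := by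
    rw [← span_ev_mul, Submodule.span_le]
    rintro _ ⟨f, h, hh, rfl⟩
    have h0 : φ h = 0 := hT hh
    rw [SetLike.mem_coe, LinearMap.mem_ker, hφ_apply, ← mul_assoc, (ev_comm q u _ f).eq, mul_assoc,
      mul_assoc, ← mul_assoc (ev q u (PK w (onSet A K))), ← hφ_apply, h0, mul_zero]
  exact hall (x := y) trivial

end Vanishing


section Sandwich

open MvPolynomial

variable {R : Type*} [CommRing R] {m r : ℕ}

/-! ### The bimodule `π_a H π̃_{a'}` -/

/-- The combinatorial data behind `v_a`: the functions `κ`, `κ'` send a letter to the index of its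
block in `a` and `a'`, the permutation `w0` is `w_a`, and `w` is a rearrangement of the parameters
`u`.  The situation is symmetric, see `Datum.symm`. -/
structure Datum (u w : Fin m → R) (κ κ' : Fin r → Fin m) (w0 : Equiv.Perm (Fin r)) : Prop where
  hw : ∏ k, (Polynomial.X - Polynomial.C (w k)) = ∏ k, (Polynomial.X - Polynomial.C (u k))
  mono : Monotone κ
  mono' : Monotone κ'
  map_block : ∀ p, κ' (w0 p) = (κ p).rev
  inc : ∀ p p', κ p = κ p' → p < p' → w0 p < w0 p'

/-- The polynomial with value `π_a` at the elements `L_j`, if `κ` describes the blocks of `a` and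
`w = u`. -/
noncomputable def pp (w : Fin m → R) (κ : Fin r → Fin m) : MvPolynomial (Fin r) R :=
  PK w fun p => Finset.Ioi (κ p)

/-- The subalgebra generated by the Hecke generators that preserve the blocks of `κ`. -/
def YA (q : Rˣ) (u : Fin m → R) (κ : Fin r → Fin m) : Subalgebra R (H r q u) :=
  Algebra.adjoin R (G q u '' {i | κ (lo i) = κ (succIdx i)})

variable (q : Rˣ) (u : Fin m → R)

theorem G_mem_YA {κ : Fin r → Fin m} {i : Fin (r - 1)} (h : κ (lo i) = κ (succIdx i)) :
    G q u i ∈ YA q u κ := Algebra.subset_adjoin ⟨i, h, rfl⟩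

theorem YA_le_Hfin (κ : Fin r → Fin m) : YA q u κ ≤ Hfin r q u :=
  Algebra.adjoin_mono (Set.image_subset_range _ _)

theorem commute_pp_of_mem_YA (w : Fin m → R) {κ : Fin r → Fin m} {x : H r q u}
    (hx : x ∈ YA q u κ) : Commute x (ev q u (pp w κ)) := by
  have h : YA q u κ ≤ Subalgebra.centralizer R {ev q u (pp w κ)} := by
    refine Algebra.adjoin_le ?_
    rintro _ ⟨i, hi, rfl⟩
    have := G_comm_ev_PK q u w (K := fun p => Finset.Ioi (κ p)) (i := i) (by simp only [hi.out])
    rw [SetLike.mem_coe, Subalgebra.mem_centralizer_iff]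
    rintro _ rfl
    exact this.eq.symm
  have := h hx
  rw [Subalgebra.mem_centralizer_iff] at this
  exact (this _ rfl).symm

theorem onSet_dvd_pp (w : Fin m → R) {κ : Fin r → Fin m} {A : Finset (Fin r)} {k₀ : Fin m}
    (h : ∀ p ∈ A, κ p < k₀) : PK w (onSet A (Finset.Iio k₀)ᶜ) ∣ pp w κ := by
  refine PK_dvd w fun p k hk => ?_
  by_cases hp : p ∈ A
  · rw [onSet, if_pos hp, Finset.mem_compl, Finset.mem_Iio, not_lt] at hk
    exact Finset.mem_Ioi.mpr ((h p hp).trans_le hk)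
  · rw [onSet, if_neg hp] at hk
    exact absurd hk (Finset.notMem_empty k)

theorem pp_rev (w : Fin m → R) (κ : Fin r → Fin m) :
    pp (w ∘ Fin.rev) κ = PK w fun p => Finset.Iio (κ p).rev := by
  unfold pp PK
  refine Finset.prod_congr rfl fun p _ => ?_
  refine Finset.prod_bij (fun k _ => k.rev) ?_ ?_ ?_ ?_
  · intro k hk
    rw [Finset.mem_Ioi] at hk
    rw [Finset.mem_Iio]
    exact Fin.rev_lt_rev.mpr hk
  · intro k _ k' _ h
    exact Fin.rev_injective h
  · intro k hk
    rw [Finset.mem_Iio] at hk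
    refine ⟨k.rev, ?_, Fin.rev_rev k⟩
    rw [Finset.mem_Ioi]
    exact Fin.lt_rev_iff.mp hk
  · intro k _
    rfl

theorem onSet_dvd_pp_rev (w : Fin m → R) {κ : Fin r → Fin m} {A : Finset (Fin r)} {k₀ : Fin m}
    (h : ∀ p ∈ A, k₀ ≤ (κ p).rev) : PK w (onSet A (Finset.Iio k₀)) ∣ pp (w ∘ Fin.rev) κ := by
  rw [pp_rev]
  refine PK_dvd w fun p k hk => ?_
  by_cases hp : p ∈ A
  · rw [onSet, if_pos hp, Finset.mem_Iio] at hk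
    exact Finset.mem_Iio.mpr (hk.trans_le (h p hp))
  · rw [onSet, if_neg hp] at hk
    exact absurd hk (Finset.notMem_empty k)

variable {q u}
variable {w : Fin m → R} {κ κ' : Fin r → Fin m} {w0 : Equiv.Perm (Fin r)}

namespace Datum

theorem symm (D : Datum u w κ κ' w0) : Datum u (w ∘ Fin.rev) κ' κ w0.symm where
  hw := by
    rw [← D.hw]
    exact Equiv.prod_comp Fin.revPerm fun k => Polynomial.X - Polynomial.C (w k)
  mono := D.mono'
  mono' := D.mono
  map_block p := by
    have := D.map_block (w0.symm p)
    rw [Equiv.apply_symm_apply] at this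
    rw [this, Fin.rev_rev]
  inc p p' h hlt := by
    have h1 := D.map_block (w0.symm p)
    have h2 := D.map_block (w0.symm p')
    rw [Equiv.apply_symm_apply] at h1 h2
    have h3 : κ (w0.symm p) = κ (w0.symm p') := Fin.rev_injective (h1.symm.trans (h.trans h2))
    by_contra hcon
    rcases (not_lt.mp hcon).lt_or_eq with h4 | h4
    · have := D.inc _ _ h3.symm h4
      rw [Equiv.apply_symm_apply, Equiv.apply_symm_apply] at this
      exact lt_asymm this hlt
    · exact hlt.ne' (w0.symm.injective h4)

/-- Adjacent letters of a block stay adjacent under `w_a`. -/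
theorem exists_adjacent (D : Datum u w κ κ' w0) {i : Fin (r - 1)}
    (h : κ (lo i) = κ (succIdx i)) : ∃ j, w0 (lo i) = lo j ∧ w0 (succIdx i) = succIdx j := by
  have h1 := D.inc _ _ h (lo_lt i)
  have h1' : (w0 (lo i) : ℕ) < w0 (succIdx i) := h1
  have hlt := (w0 (succIdx i)).isLt
  have hval : (w0 (succIdx i) : ℕ) = w0 (lo i) + 1 := by
    by_contra hne
    set t : Fin r := ⟨w0 (lo i) + 1, by omega⟩ with ht
    have ht1 : w0 (lo i) < t := by rw [Fin.lt_def, ht]; simp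
    have ht2 : t < w0 (succIdx i) := by rw [Fin.lt_def, ht]; simp only; omega
    have e1 := D.mono' ht1.le
    have e2 := D.mono' ht2.le
    rw [D.map_block] at e1 e2
    rw [← h] at e2
    have e3 := D.map_block (w0.symm t)
    rw [Equiv.apply_symm_apply] at e3
    have e4 : κ (w0.symm t) = κ (lo i) := Fin.rev_injective (e3 ▸ le_antisymm e2 e1)
    rcases lt_trichotomy (w0.symm t) (lo i) with h2 | h2 | h2
    · have := D.inc _ _ e4 h2
      rw [Equiv.apply_symm_apply] at this
      exact lt_asymm this ht1
    · rw [Equiv.symm_apply_eq] at h2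
      exact ht1.ne' h2
    · rcases (show succIdx i ≤ w0.symm t from h2).eq_or_lt with h3 | h3
      · rw [h3, Equiv.apply_symm_apply] at ht2
        exact lt_irrefl _ ht2
      · have := D.inc _ _ (h.symm.trans e4.symm) h3
        rw [Equiv.apply_symm_apply] at this
        exact lt_asymm this ht2
  exact ⟨⟨w0 (lo i), by omega⟩, rfl, Fin.ext hval⟩

theorem exists_G_mul_Tw (D : Datum u w κ κ' w0) {i : Fin (r - 1)}
    (h : κ (lo i) = κ (succIdx i)) : ∃ j, κ' (lo j) = κ' (succIdx j) ∧
      w0 (lo i) = lo j ∧ w0 (succIdx i) = succIdx j ∧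
      G q u i * Tw q u w0 = Tw q u w0 * G q u j := by
  obtain ⟨j, h1, h2⟩ := D.exists_adjacent h
  refine ⟨j, by rw [← h1, ← h2, D.map_block, D.map_block, h], h1, h2, ?_⟩
  rw [← Tw_s_trans q u (D.inc _ _ h (lo_lt i)), ← Tw_trans_s q u]
  · congr 1
    have := Equiv.mul_swap_eq_swap_mul w0 (lo i) (succIdx i)
    rw [h1, h2] at this
    exact this
  · rw [← h1, ← h2, Equiv.symm_apply_apply, Equiv.symm_apply_apply]
    exact lo_lt i

/-- Conjugation by `h_a` maps `ℋ(𝔖_a)` to `ℋ(𝔖_{a'})`, and `h_{a'}` induces the inverse map. -/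
theorem exists_conj (D : Datum u w κ κ' w0) {x : H r q u} (hx : x ∈ YA q u κ) :
    ∃ x' ∈ YA q u κ', x * Tw q u w0 = Tw q u w0 * x' ∧
      x' * Tw q u w0.symm = Tw q u w0.symm * x := by
  induction hx using Algebra.adjoin_induction with
  | mem x hx =>
    obtain ⟨i, hi, rfl⟩ := hx
    obtain ⟨j, hj, h1, h2, h3⟩ := D.exists_G_mul_Tw (q := q) hi
    obtain ⟨i', -, h1', -, h3'⟩ := D.symm.exists_G_mul_Tw (q := q) hj
    rw [← h1, Equiv.symm_apply_apply] at h1'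
    obtain rfl : i = i' := Fin.ext (Fin.ext_iff.mp h1' :)
    exact ⟨G q u j, G_mem_YA q u hj, h3, h3'⟩
  | algebraMap c =>
    exact ⟨algebraMap R _ c, Subalgebra.algebraMap_mem _ c, Algebra.commutes c _,
      Algebra.commutes c _⟩
  | add x y _ _ hx hy =>
    obtain ⟨x', hx', e1, e2⟩ := hx
    obtain ⟨y', hy', f1, f2⟩ := hy
    exact ⟨x' + y', Subalgebra.add_mem _ hx' hy', by rw [add_mul, mul_add, e1, f1],
      by rw [add_mul, mul_add, e2, f2]⟩
  | mul x y _ _ hx hy =>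
    obtain ⟨x', hx', e1, e2⟩ := hx
    obtain ⟨y', hy', f1, f2⟩ := hy
    exact ⟨x' * y', Subalgebra.mul_mem _ hx' hy', by rw [mul_assoc, f1, ← mul_assoc, e1, mul_assoc],
      by rw [mul_assoc, f2, ← mul_assoc, e2, mul_assoc]⟩

/-- `T_x` lies in `ℋ(𝔖_a)` for `x ∈ 𝔖_a`, and `w_a` is a minimal coset representative. -/
theorem Tw_trans (D : Datum u w κ κ' w0) (x : Equiv.Perm (Fin r)) :
    (∀ p, κ (x p) = κ p) →
      Tw q u x ∈ YA q u κ ∧ Tw q u (x.trans w0) = Tw q u x * Tw q u w0 := by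
  induction x using perm_induction with
  | h1 =>
    intro _
    rw [Tw_refl, one_mul]
    exact ⟨Subalgebra.one_mem _, rfl⟩
  | hs x i hlt ih =>
    intro hx
    have e1 : κ (x (succIdx i)) = κ (lo i) := by simpa [s_lo] using hx (lo i)
    have e2 : κ (x (lo i)) = κ (succIdx i) := by simpa [s_hi] using hx (succIdx i)
    have hi : κ (lo i) = κ (succIdx i) :=
      le_antisymm (D.mono (lo_lt i).le) (e2 ▸ e1 ▸ D.mono hlt.le)
    have hx' : ∀ p, κ (x p) = κ p := by
      intro p
      have := hx (s i p)
      rw [Equiv.trans_apply, s_s] at this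
      rw [this]
      by_cases h1 : p = lo i
      · rw [h1, s_lo, hi]
      by_cases h2 : p = succIdx i
      · rw [h2, s_hi, hi]
      rw [s_of_ne h1 h2]
    obtain ⟨h1, h2⟩ := ih hx'
    rw [Tw_s_trans q u hlt]
    refine ⟨Subalgebra.mul_mem _ (G_mem_YA q u hi) h1, ?_⟩
    rw [Equiv.trans_assoc, Tw_s_trans q u, h2, mul_assoc]
    exact D.inc _ _ (by rw [hx', hx', hi]) hlt

/-- `π_a T_σ π̃_{a'}` vanishes unless `σ ∈ 𝔖_a w_a`. -/
theorem pp_mul_Tw_mul_pp (D : Datum u w κ κ' w0) (σ : Equiv.Perm (Fin r))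
    (hσ : ev q u (pp w κ) * Tw q u σ * ev q u (pp (w ∘ Fin.rev) κ') ≠ 0) :
    ∃ x ∈ YA q u κ, Tw q u σ = x * Tw q u w0 := by
  have hle : ∀ p, (κ' (σ p)).rev ≤ κ p := by
    intro p
    by_contra! hlt
    apply hσ
    set k₀ := (κ' (σ p)).rev with hk₀
    obtain ⟨f, hf⟩ := onSet_dvd_pp w (κ := κ) (A := Finset.univ.filter fun p => κ p < k₀)
      (k₀ := k₀) (by simp)
    obtain ⟨g, hg⟩ := onSet_dvd_pp_rev w (κ := κ')
      (A := Finset.univ.filter fun p => k₀ ≤ (κ' p).rev) (k₀ := k₀) (by simp)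
    have h0 := ev_mul_Tw_mul_ev_eq_zero q u D.hw
      (A := Finset.univ.filter fun p => κ p < k₀)
      (C := Finset.univ.filter fun p => k₀ ≤ (κ' p).rev)
      (fun p p' h hp => by
        simp only [Finset.coe_filter, Finset.mem_univ, true_and, Set.mem_ofPred_eq] at hp ⊢
        exact (D.mono h).trans_lt hp)
      (fun p p' h hp => by
        simp only [Finset.coe_filter, Finset.mem_univ, true_and, Set.mem_ofPred_eq] at hp ⊢
        exact hp.trans (Fin.rev_le_rev.mpr (D.mono' h)))
      (Finset.Iio k₀)ᶜ σ p (by simpa using hlt) (by simp [hk₀])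
    rw [compl_compl] at h0
    rw [hf, hg, mul_comm _ f, map_mul, map_mul, mul_assoc (ev q u f), mul_assoc (ev q u f),
      ← mul_assoc (_ * _) _ (ev q u g), h0, zero_mul, mul_zero]
  have hsum : ∑ p, (((κ' (σ p)).rev : Fin m) : ℕ) = ∑ p, ((κ p : Fin m) : ℕ) := by
    rw [Equiv.sum_comp σ fun p => (((κ' p).rev : Fin m) : ℕ),
      ← Equiv.sum_comp w0 fun p => (((κ' p).rev : Fin m) : ℕ)]
    simp only [D.map_block, Fin.rev_rev]
  have heq : ∀ p, (κ' (σ p)).rev = κ p := by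
    have := (Finset.sum_eq_sum_iff_of_le fun p _ => (Fin.le_def.mp (hle p))).mp hsum
    exact fun p => Fin.ext (this p (Finset.mem_univ p))
  set x := σ.trans w0.symm with hx
  have hσx : σ = x.trans w0 := by rw [hx, Equiv.trans_assoc, Equiv.symm_trans_self, Equiv.trans_refl]
  have hκ : ∀ p, κ (x p) = κ p := by
    intro p
    have := D.map_block (x p)
    rw [← Equiv.trans_apply, ← hσx] at this
    rw [← heq p, this, Fin.rev_rev]
  obtain ⟨h1, h2⟩ := D.Tw_trans (q := q) x hκ
  exact ⟨_, h1, by rw [hσx]; exact h2⟩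

/-- On the first letter of a block, `L_j` acts on `π_a H π̃_{a'}` as a scalar. -/
theorem pp_mul_J_first (D : Datum u w κ κ' w0) (p : Fin r) (hp : ∀ p' < p, κ p' < κ p)
    (y : H r q u) : ev q u (pp w κ) * J q u p * y * ev q u (pp (w ∘ Fin.rev) κ') =
      w (κ p) • (ev q u (pp w κ) * y * ev q u (pp (w ∘ Fin.rev) κ')) := by
  -- `π_a (L_p - w_{κ p})` contains all the factors `L_{p'} - w_k` with `p' ≤ p` and `k ≥ κ p`.
  obtain ⟨f, hf⟩ : PK w (onSet (Finset.Iic p) (Finset.Iio (κ p))ᶜ) ∣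
      pp w κ * (X p - C (w (κ p))) := by
    have : pp w κ * (X p - C (w (κ p))) =
        PK w (Function.update (fun p => Finset.Ioi (κ p)) p (Finset.Ici (κ p))) := by
      set K' := Function.update (fun p => Finset.Ioi (κ p)) p (Finset.Ici (κ p)) with hK'
      have e1 : pp w κ = (∏ k ∈ Finset.Ioi (κ p), (X p - C (w k))) *
          ∏ p' ∈ Finset.univ.erase p, ∏ k ∈ Finset.Ioi (κ p'), (X p' - C (w k)) :=
        (Finset.mul_prod_erase _ _ (Finset.mem_univ p)).symm
      have e2 : PK w K' = (∏ k ∈ K' p, (X p - C (w k))) *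
          ∏ p' ∈ Finset.univ.erase p, ∏ k ∈ K' p', (X p' - C (w k)) :=
        (Finset.mul_prod_erase _ _ (Finset.mem_univ p)).symm
      have e3 : ∏ p' ∈ Finset.univ.erase p, ∏ k ∈ K' p', (X p' - C (w k)) =
          ∏ p' ∈ Finset.univ.erase p, ∏ k ∈ Finset.Ioi (κ p'), (X p' - C (w k)) := by
        refine Finset.prod_congr rfl fun p' hp' => ?_
        rw [hK', Function.update_of_ne (Finset.mem_erase.mp hp').1]
      rw [e1, e2, e3, hK', Function.update_self, ← Finset.Ioi_insert,
        Finset.prod_insert (by simp)]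
      ring
    rw [this]
    refine PK_dvd w fun p' k hk => ?_
    by_cases hp' : p' ∈ Finset.Iic p
    · rw [onSet, if_pos hp', Finset.mem_compl, Finset.mem_Iio, not_lt] at hk
      rcases (Finset.mem_Iic.mp hp').eq_or_lt with rfl | hlt
      · rw [Function.update_self]
        exact Finset.mem_Ici.mpr hk
      · rw [Function.update_of_ne hlt.ne]
        exact Finset.mem_Ioi.mpr ((hp p' hlt).trans_le hk)
    · rw [onSet, if_neg hp'] at hk
      exact absurd hk (Finset.notMem_empty k)
  obtain ⟨g, hg⟩ := onSet_dvd_pp_rev w (κ := κ')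
    (A := Finset.univ.filter fun p' => κ p ≤ (κ' p').rev) (k₀ := κ p) (by simp)
  have hcard : r < (Finset.Iic p).card +
      (Finset.univ.filter fun p' => κ p ≤ (κ' p').rev).card := by
    have h1 : (Finset.univ.filter fun p' => κ p ≤ (κ' p').rev).card =
        (Finset.Ici p).card := by
      refine (Finset.card_bij (fun p' _ => w0 p') ?_ ?_ ?_).symm
      · intro p' hp'
        rw [Finset.mem_filter, D.map_block, Fin.rev_rev]
        exact ⟨Finset.mem_univ _, D.mono (Finset.mem_Ici.mp hp')⟩
      · intro p₁ _ p₂ _ h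
        exact w0.injective h
      · intro p' hp'
        refine ⟨w0.symm p', ?_, Equiv.apply_symm_apply _ _⟩
        have h2 := D.symm.map_block p'
        rw [Finset.mem_filter, ← h2] at hp'
        rw [Finset.mem_Ici]
        by_contra hcon
        exact absurd hp'.2 (not_le.mpr (hp _ (not_le.mp hcon)))
    rw [h1, Fin.card_Iic, Fin.card_Ici]
    have := p.isLt
    omega
  have h0 := ev_mul_mul_ev_eq_zero q u D.hw (A := Finset.Iic p)
    (C := Finset.univ.filter fun p' => κ p ≤ (κ' p').rev)
    (fun p₁ p₂ h hp₁ => by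
      simp only [Finset.coe_Iic, Set.mem_Iic] at hp₁ ⊢
      exact h.trans hp₁)
    (fun p₁ p₂ h hp₁ => by
      simp only [Finset.coe_filter, Finset.mem_univ, true_and, Set.mem_ofPred_eq] at hp₁ ⊢
      exact hp₁.trans (Fin.rev_le_rev.mpr (D.mono' h)))
    hcard (Finset.Iio (κ p))ᶜ y
  rw [compl_compl] at h0
  have h1 : ev q u (pp w κ * (X p - C (w (κ p)))) * y * ev q u (pp (w ∘ Fin.rev) κ') = 0 := by
    rw [hf, hg, mul_comm _ f, map_mul, map_mul, mul_assoc (ev q u f), mul_assoc (ev q u f),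
      ← mul_assoc (_ * _) _ (ev q u g), h0, zero_mul, mul_zero]
  rw [map_mul, map_sub, ev_X, ← MvPolynomial.algebraMap_eq, AlgHom.commutes,
    Algebra.algebraMap_eq_smul_one, mul_sub, sub_mul, sub_mul, mul_smul_comm, mul_one,
    smul_mul_assoc, smul_mul_assoc, sub_eq_zero] at h1
  exact h1

/-- Next to `π_a`, every `L_j` can be replaced by an element of `ℋ(𝔖_a)`: a multiple of a
Jucys–Murphy element of the block of `j`. -/
theorem exists_pp_mul_J (D : Datum u w κ κ' w0) (p : Fin r) : ∃ x ∈ YA q u κ, ∀ y : H r q u,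
    ev q u (pp w κ) * J q u p * y * ev q u (pp (w ∘ Fin.rev) κ') =
      x * (ev q u (pp w κ) * y * ev q u (pp (w ∘ Fin.rev) κ')) := by
  have first : ∀ p : Fin r, (∀ p' < p, κ p' < κ p) → ∃ x ∈ YA q u κ, ∀ y : H r q u,
      ev q u (pp w κ) * J q u p * y * ev q u (pp (w ∘ Fin.rev) κ') =
        x * (ev q u (pp w κ) * y * ev q u (pp (w ∘ Fin.rev) κ')) := fun p hp =>
    ⟨algebraMap R _ (w (κ p)), Subalgebra.algebraMap_mem _ _, fun y => by
      rw [D.pp_mul_J_first p hp, Algebra.smul_def]⟩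
  induction p using pos_induction with
  | h0 p hp => exact first p fun p' h => by rw [Fin.lt_def] at h; omega
  | hs i ih =>
    rcases (D.mono (lo_lt i).le).lt_or_eq with h | h
    · refine first _ fun p' hp' => (D.mono (?_ : p' ≤ lo i)).trans_lt h
      rw [Fin.lt_def, succIdx_val] at hp'
      rw [Fin.le_def, lo_val]
      omega
    · obtain ⟨x, hx, hxy⟩ := ih
      have hG := G_mem_YA q u h
      have hc := (commute_pp_of_mem_YA q u w hG).eq
      refine ⟨((q⁻¹ : Rˣ) : R) • (G q u i * x * G q u i), Subalgebra.smul_mem _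
        (Subalgebra.mul_mem _ (Subalgebra.mul_mem _ hG hx) hG) _, fun y => ?_⟩
      have := hxy (G q u i * y)
      rw [J_hi, mul_smul_comm, smul_mul_assoc, smul_mul_assoc, smul_mul_assoc]
      congr 1
      calc ev q u (pp w κ) * (G q u i * J q u (lo i) * G q u i) * y * _
          = (ev q u (pp w κ) * G q u i) * J q u (lo i) * G q u i * y *
              ev q u (pp (w ∘ Fin.rev) κ') := by simp only [mul_assoc]
        _ = G q u i * (ev q u (pp w κ) * J q u (lo i) * (G q u i * y) *
              ev q u (pp (w ∘ Fin.rev) κ')) := by rw [← hc]; simp only [mul_assoc]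
        _ = G q u i * x * (ev q u (pp w κ) * G q u i) * y * ev q u (pp (w ∘ Fin.rev) κ') := by
          rw [this]; simp only [mul_assoc]
        _ = _ := by rw [← hc]; simp only [mul_assoc]

theorem exists_pp_mul_ev (D : Datum u w κ κ' w0) (f : MvPolynomial (Fin r) R) :
    ∃ x ∈ YA q u κ, ∀ y : H r q u,
      ev q u (pp w κ) * ev q u f * y * ev q u (pp (w ∘ Fin.rev) κ') =
        x * (ev q u (pp w κ) * y * ev q u (pp (w ∘ Fin.rev) κ')) := by
  induction f using MvPolynomial.induction_on with
  | C c =>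
    refine ⟨algebraMap R _ c, Subalgebra.algebraMap_mem _ c, fun y => ?_⟩
    rw [← MvPolynomial.algebraMap_eq, AlgHom.commutes, ← Algebra.commutes]
    simp only [mul_assoc]
  | add f g hf hg =>
    obtain ⟨x, hx, e⟩ := hf
    obtain ⟨x', hx', e'⟩ := hg
    refine ⟨x + x', Subalgebra.add_mem _ hx hx', fun y => ?_⟩
    rw [map_add, mul_add, add_mul, add_mul, e, e', add_mul]
  | mul_X f p hf =>
    obtain ⟨x, hx, e⟩ := hf
    obtain ⟨x', hx', e'⟩ := D.exists_pp_mul_J (q := q) p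
    refine ⟨x * x', Subalgebra.mul_mem _ hx hx', fun y => ?_⟩
    have h1 := e (J q u p * y)
    rw [map_mul, ev_X]
    calc ev q u (pp w κ) * (ev q u f * J q u p) * y * ev q u (pp (w ∘ Fin.rev) κ')
        = ev q u (pp w κ) * ev q u f * (J q u p * y) * ev q u (pp (w ∘ Fin.rev) κ') := by
          simp only [mul_assoc]
      _ = x * (ev q u (pp w κ) * J q u p * y * ev q u (pp (w ∘ Fin.rev) κ')) := by
          rw [h1]; simp only [mul_assoc]
      _ = _ := by rw [e', ← mul_assoc]

variable (q w κ κ' w0) in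
/-- The element `v_a = π_a h_a π̃_{a'}`. -/
noncomputable def _root_.ArikiKoike.vD : H r q u :=
  ev q u (pp w κ) * Tw q u w0 * ev q u (pp (w ∘ Fin.rev) κ')

/-- `π_a H π̃_{a'} = ℋ(𝔖_a) v_a`. -/
theorem exists_pp_mul_mul_pp (D : Datum u w κ κ' w0) (y : H r q u) : ∃ x ∈ YA q u κ,
    ev q u (pp w κ) * y * ev q u (pp (w ∘ Fin.rev) κ') = x * vD q w κ κ' w0 := by
  set φ : H r q u →ₗ[R] H r q u := (LinearMap.mulRight R (ev q u (pp (w ∘ Fin.rev) κ'))).comp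
    (LinearMap.mulLeft R (ev q u (pp w κ))) with hφ
  have hφ_apply : ∀ x, φ x = ev q u (pp w κ) * x * ev q u (pp (w ∘ Fin.rev) κ') := fun x => rfl
  set S : Submodule R (H r q u) := (Submodule.map
    (LinearMap.mulRight R (vD q w κ κ' w0)) (Subalgebra.toSubmodule (YA q u κ))) with hS
  have hmem : ∀ x, x ∈ S ↔ ∃ y ∈ YA q u κ, x = y * vD q w κ κ' w0 := by
    intro x
    rw [hS, Submodule.mem_map]
    exact ⟨fun ⟨y, hy, e⟩ => ⟨y, hy, e.symm⟩, fun ⟨y, hy, e⟩ => ⟨y, hy, e.symm⟩⟩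
  have hT : Subalgebra.toSubmodule (Hfin r q u) ≤ S.comap φ := by
    refine (Hfin_le_span_Tw q u).trans (Submodule.span_le.mpr ?_)
    rintro _ ⟨σ, rfl⟩
    rw [SetLike.mem_coe, Submodule.mem_comap, hφ_apply]
    by_cases h0 : ev q u (pp w κ) * Tw q u σ * ev q u (pp (w ∘ Fin.rev) κ') = 0
    · rw [h0]; exact S.zero_mem
    · obtain ⟨x, hx, e⟩ := D.pp_mul_Tw_mul_pp σ h0
      rw [hmem]
      refine ⟨x, hx, ?_⟩
      rw [e, ← mul_assoc, ← (commute_pp_of_mem_YA q u w hx).eq, vD]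
      simp only [mul_assoc]
  have hall : (⊤ : Submodule R (H r q u)) ≤ S.comap φ := by
    rw [← span_ev_mul, Submodule.span_le]
    rintro _ ⟨f, h, hh, rfl⟩
    obtain ⟨x, hx, e⟩ := D.exists_pp_mul_ev (q := q) f
    have h1 := hT hh
    rw [Submodule.mem_comap, hφ_apply, hmem] at h1
    obtain ⟨x', hx', e'⟩ := h1
    rw [SetLike.mem_coe, Submodule.mem_comap, hφ_apply, ← mul_assoc, e, e', hmem]
    exact ⟨x * x', Subalgebra.mul_mem _ hx hx', (mul_assoc _ _ _).symm⟩
  have := hall (x := y) trivial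
  rwa [Submodule.mem_comap, hφ_apply, hmem] at this

theorem exists_mul_vD (D : Datum u w κ κ' w0) {x : H r q u} (hx : x ∈ YA q u κ) :
    ∃ x' ∈ YA q u κ', x * Tw q u w0 = Tw q u w0 * x' ∧
      x' * Tw q u w0.symm = Tw q u w0.symm * x ∧
      x * vD q w κ κ' w0 = vD q w κ κ' w0 * x' := by
  obtain ⟨x', hx', e1, e2⟩ := D.exists_conj hx
  refine ⟨x', hx', e1, e2, ?_⟩
  have c1 := (commute_pp_of_mem_YA q u w hx).eq
  have c2 := (commute_pp_of_mem_YA q u (w ∘ Fin.rev) hx').eq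
  calc x * vD q w κ κ' w0
      = x * ev q u (pp w κ) * Tw q u w0 * ev q u (pp (w ∘ Fin.rev) κ') := by
        simp only [vD, mul_assoc]
    _ = ev q u (pp w κ) * (x * Tw q u w0) * ev q u (pp (w ∘ Fin.rev) κ') := by
        rw [c1]; simp only [mul_assoc]
    _ = ev q u (pp w κ) * Tw q u w0 * (x' * ev q u (pp (w ∘ Fin.rev) κ')) := by
        rw [e1]; simp only [mul_assoc]
    _ = _ := by rw [c2]; simp only [vD, mul_assoc]

/-- `v_a H = v_a ℋ(𝔖_r)`. -/
theorem exists_vD_mul (D : Datum u w κ κ' w0) (x : H r q u) :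
    ∃ h ∈ Hfin r q u, vD q w κ κ' w0 * x = vD q w κ κ' w0 * h := by
  set V := vD q w κ κ' w0 with hV
  set S : Submodule R (H r q u) := Submodule.comap (LinearMap.mulLeft R V)
    (Submodule.map (LinearMap.mulLeft R V) (Subalgebra.toSubmodule (Hfin r q u))) with hS
  have hmem : ∀ x, x ∈ S ↔ ∃ h ∈ Hfin r q u, V * x = V * h := by
    intro x
    rw [hS, Submodule.mem_comap, Submodule.mem_map]
    exact ⟨fun ⟨y, hy, e⟩ => ⟨y, hy, e.symm⟩, fun ⟨y, hy, e⟩ => ⟨y, hy, e.symm⟩⟩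
  rw [← hmem]
  have hall : (⊤ : Submodule R (H r q u)) ≤ S := by
    rw [← span_ev_mul, Submodule.span_le]
    rintro _ ⟨f, h, hh, rfl⟩
    rw [SetLike.mem_coe, hmem]
    obtain ⟨x', hx', e⟩ := D.symm.exists_pp_mul_ev (q := q) f
    have e' := congrArg (st q u) (e (st q u (Tw q u w0)))
    have hrev : (w ∘ Fin.rev) ∘ Fin.rev = w := by ext k; simp
    simp only [st_mul, st_ev, st_st, hrev] at e'
    refine ⟨st q u x' * h, Subalgebra.mul_mem _ (st_mem_Hfin q u (YA_le_Hfin q u _ hx')) hh, ?_⟩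
    rw [← mul_assoc, ← mul_assoc]
    congr 1
    rw [hV, vD, mul_assoc, mul_assoc, (ev_comm q u _ f).eq]
    simp only [mul_assoc] at e' ⊢
    exact e'
  exact hall trivial

end Datum

end Sandwich


/-! ### Demazure–Lusztig operators -/

section Operators

variable {R : Type*} [CommRing R] {ι : Type*} [DecidableEq ι]
  {E : Type*} [Ring E] [Algebra R E]

/-- Polynomials in variables indexed by `ι` with coefficients in the noncommutative algebra `E`;
`Finsupp.single c h` is the monomial `X^c h`. -/
abbrev Poly (ι E : Type*) [Ring E] := (ι → ℕ) →₀ E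

variable (R E) in
/-- Multiplication by the variable `X_k`. -/
noncomputable def mulX (k : ι) : Module.End R (Poly ι E) :=
  Finsupp.lmapDomain E R fun c => c + Pi.single k 1

@[simp] theorem mulX_single (k : ι) (c : ι → ℕ) (h : E) :
    mulX R E k (Finsupp.single c h) = Finsupp.single (c + Pi.single k 1) h :=
  Finsupp.mapDomain_single

/-- The exponent `c` with the entries at `p`, `p'` replaced by `a`, `b`. -/
def setTwo (c : ι → ℕ) (p p' : ι) (a b : ℕ) : ι → ℕ :=
  Function.update (Function.update c p a) p' b

theorem setTwo_hi (c : ι → ℕ) (p p' : ι) (a b : ℕ) : setTwo c p p' a b p' = b :=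
  Function.update_self _ _ _

theorem setTwo_lo (c : ι → ℕ) {p p' : ι} (hp : p ≠ p') (a b : ℕ) : setTwo c p p' a b p = a := by
  rw [setTwo, Function.update_of_ne hp, Function.update_self]

theorem setTwo_of_ne (c : ι → ℕ) {p p' k : ι} (h : k ≠ p) (h' : k ≠ p') (a b : ℕ) :
    setTwo c p p' a b k = c k := by
  rw [setTwo, Function.update_of_ne h', Function.update_of_ne h]

theorem eq_setTwo {c d : ι → ℕ} {p p' : ι} {a b : ℕ} (h1 : d p = a) (h2 : d p' = b)
    (h3 : ∀ k, k ≠ p → k ≠ p' → d k = c k) : d = setTwo c p p' a b := by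
  ext k
  by_cases hk' : k = p'
  · rw [hk', setTwo_hi, h2]
  by_cases hk : k = p
  · rw [hk, setTwo_lo c (hk ▸ hk'), h1]
  rw [setTwo_of_ne c hk hk', h3 k hk hk']

theorem comp_swap_eq (c : ι → ℕ) (p p' : ι) :
    c ∘ Equiv.swap p p' = setTwo c p p' (c p') (c p) :=
  eq_setTwo (by simp) (by simp) fun k h h' => by simp [Equiv.swap_apply_of_ne_of_ne h h']

theorem setTwo_self (c : ι → ℕ) (p p' : ι) : setTwo c p p' (c p) (c p') = c :=
  (eq_setTwo rfl rfl fun _ _ _ => rfl).symm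

/-- The divided difference `X_{p'} (f - s f) / (X_{p'} - X_p)` of the monomial `f = X^c h`, where
`s` exchanges `X_p` and `X_{p'}`.  At most one of the two sums is not empty. -/
noncomputable def dd (p p' : ι) (c : ι → ℕ) (h : E) : Poly ι E :=
  ∑ k ∈ Finset.range (c p' - c p), Finsupp.single (setTwo c p p' (c p + k) (c p' - k)) h -
    ∑ k ∈ Finset.range (c p - c p'), Finsupp.single (setTwo c p p' (c p' + k) (c p - k)) h

/-- The Demazure–Lusztig operator `f ↦ t · s f + (q - 1) X_{p'} (f - s f) / (X_{p'} - X_p)`. -/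
noncomputable def op (q : R) (p p' : ι) (t : E) : Module.End R (Poly ι E) :=
  Finsupp.lsum R fun c =>
    (Finsupp.lsingle (c ∘ Equiv.swap p p')).comp (LinearMap.mulLeft R t) + (q - 1) •
      (∑ k ∈ Finset.range (c p' - c p), Finsupp.lsingle (setTwo c p p' (c p + k) (c p' - k)) -
        ∑ k ∈ Finset.range (c p - c p'), Finsupp.lsingle (setTwo c p p' (c p' + k) (c p - k)))

theorem op_single (q : R) (p p' : ι) (t : E) (c : ι → ℕ) (h : E) :
    op q p p' t (Finsupp.single c h) =
      Finsupp.single (c ∘ Equiv.swap p p') (t * h) + (q - 1) • dd p p' c h := by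
  simp [op, dd, LinearMap.sum_apply]

omit [DecidableEq ι] in
theorem end_ext {Z Z' : Module.End R (Poly ι E)}
    (h : ∀ c e, Z (Finsupp.single c e) = Z' (Finsupp.single c e)) : Z = Z' :=
  Finsupp.lhom_ext h

theorem dd_add_lo {p p' : ι} (hp : p ≠ p') (c : ι → ℕ) (h : E) :
    dd p p' (c + Pi.single p 1) h = mulX R E p' (dd p p' c h) -
      mulX R E p' (Finsupp.single c h) := by
  have hc : ∀ a b, setTwo (c + Pi.single p 1) p p' a b = setTwo c p p' a b := fun a b =>
    eq_setTwo (setTwo_lo _ hp _ _) (setTwo_hi _ _ _ _ _) fun k h1 h2 => by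
      rw [setTwo_of_ne _ h1 h2]; simp [h1]
  have hX : ∀ a b, setTwo c p p' a b + Pi.single p' 1 = setTwo c p p' a (b + 1) := fun a b =>
    eq_setTwo (by simp [setTwo_lo _ hp, hp]) (by simp [setTwo_hi]) fun k h1 h2 => by
      simp [setTwo_of_ne _ h1 h2, h2]
  have hX0 := hX (c p) (c p')
  rw [setTwo_self] at hX0
  have e1 : (c + Pi.single p 1 : ι → ℕ) p = c p + 1 := by simp
  have e2 : (c + Pi.single p 1 : ι → ℕ) p' = c p' := by simp [hp.symm]
  simp only [dd, e1, e2, hc, map_sub, map_sum, mulX_single, hX, hX0]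
  rcases Nat.lt_or_ge (c p) (c p') with hlt | hge
  · obtain ⟨n, hn⟩ : ∃ n, c p' = c p + n + 1 := ⟨c p' - c p - 1, by omega⟩
    rw [show c p' - (c p + 1) = n by omega, show c p' - c p = n + 1 by omega,
      show c p + 1 - c p' = 0 by omega, show c p - c p' = 0 by omega, Finset.sum_range_succ']
    simp only [Finset.range_zero, Finset.sum_empty, sub_zero, add_zero, Nat.sub_zero,
      add_sub_cancel_right]
    refine Finset.sum_congr rfl fun k hk => ?_
    rw [Finset.mem_range] at hk
    congr 2 <;> omega
  · obtain ⟨n, hn⟩ : ∃ n, c p = c p' + n := ⟨c p - c p', by omega⟩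
    rw [show c p' - (c p + 1) = 0 by omega, show c p' - c p = 0 by omega,
      show c p + 1 - c p' = n + 1 by omega, show c p - c p' = n by omega, Finset.sum_range_succ]
    simp only [Finset.range_zero, Finset.sum_empty, zero_sub]
    rw [neg_add, ← sub_eq_add_neg]
    congr 1
    · congr 1
      refine Finset.sum_congr rfl fun k hk => ?_
      rw [Finset.mem_range] at hk
      congr 2; omega
    · congr 2 <;> omega

theorem dd_add_hi {p p' : ι} (hp : p ≠ p') (c : ι → ℕ) (h : E) :
    dd p p' (c + Pi.single p' 1) h = mulX R E p (dd p p' c h) +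
      mulX R E p' (Finsupp.single c h) := by
  have hc : ∀ a b, setTwo (c + Pi.single p' 1) p p' a b = setTwo c p p' a b := fun a b =>
    eq_setTwo (setTwo_lo _ hp _ _) (setTwo_hi _ _ _ _ _) fun k h1 h2 => by
      rw [setTwo_of_ne _ h1 h2]; simp [h2]
  have hX : ∀ a b, setTwo c p p' a b + Pi.single p 1 = setTwo c p p' (a + 1) b := fun a b =>
    eq_setTwo (by simp [setTwo_lo _ hp]) (by simp [setTwo_hi, hp.symm]) fun k h1 h2 => by
      simp [setTwo_of_ne _ h1 h2, h1]
  have hX0 : c + Pi.single p' 1 = setTwo c p p' (c p) (c p' + 1) :=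
    eq_setTwo (by simp [hp]) (by simp) fun k h1 h2 => by simp [h2]
  have e1 : (c + Pi.single p' 1 : ι → ℕ) p = c p := by simp [hp]
  have e2 : (c + Pi.single p' 1 : ι → ℕ) p' = c p' + 1 := by simp
  simp only [dd, e1, e2, hc, map_sub, map_sum, mulX_single, hX]
  rw [hX0]
  rcases Nat.lt_or_ge (c p') (c p) with hlt | hge
  · obtain ⟨n, hn⟩ : ∃ n, c p = c p' + n + 1 := ⟨c p - c p' - 1, by omega⟩
    rw [show c p - (c p' + 1) = n by omega, show c p - c p' = n + 1 by omega,
      show c p' + 1 - c p = 0 by omega, show c p' - c p = 0 by omega, Finset.sum_range_succ]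
    simp only [Finset.range_zero, Finset.sum_empty, zero_sub]
    rw [neg_add, add_assoc]
    rw [show c p' + n + 1 = c p by omega, show c p - n = c p' + 1 by omega, neg_add_cancel,
      add_zero]
    congr 1
    refine Finset.sum_congr rfl fun k hk => ?_
    congr 2; omega
  · obtain ⟨n, hn⟩ : ∃ n, c p' = c p + n := ⟨c p' - c p, by omega⟩
    rw [show c p - (c p' + 1) = 0 by omega, show c p - c p' = 0 by omega,
      show c p' + 1 - c p = n + 1 by omega, show c p' - c p = n by omega, Finset.sum_range_succ']
    simp only [Finset.range_zero, Finset.sum_empty, sub_zero, add_zero]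
    congr 1
    refine Finset.sum_congr rfl fun k hk => ?_
    congr 2; omega

theorem dd_add_ne {p p' k : ι} (hk : k ≠ p) (hk' : k ≠ p') (c : ι → ℕ) (h : E) :
    dd p p' (c + Pi.single k 1) h = mulX R E k (dd p p' c h) := by
  have hX : ∀ a b, setTwo (c + Pi.single k 1) p p' a b = setTwo c p p' a b + Pi.single k 1 := by
    intro a b
    ext j
    simp only [setTwo, Function.update_apply, Pi.add_apply, Pi.single_apply]
    split_ifs <;> simp_all
  have e1 : (c + Pi.single k 1 : ι → ℕ) p = c p := by simp [hk.symm]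
  have e2 : (c + Pi.single k 1 : ι → ℕ) p' = c p' := by simp [hk'.symm]
  simp only [dd, e1, e2, hX, map_sub, map_sum, mulX_single]

theorem single_comp_swap (p p' k : ι) (c : ι → ℕ) :
    (c + Pi.single k 1) ∘ Equiv.swap p p' =
      c ∘ Equiv.swap p p' + Pi.single (Equiv.swap p p' k) 1 := by
  ext j
  simp only [Function.comp_apply, Pi.add_apply, Pi.single_apply]
  congr 2
  rw [eq_iff_iff]
  exact Equiv.swap_apply_eq_iff

theorem op_mulX_lo (q : R) {p p' : ι} (hp : p ≠ p') (t : E) (v : Poly ι E) :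
    op q p p' t (mulX R E p v) = mulX R E p' (op q p p' t v) - (q - 1) • mulX R E p' v := by
  have : op q p p' t * mulX R E p = mulX R E p' * op q p p' t - (q - 1) • mulX R E p' := by
    refine end_ext fun c h => ?_
    rw [Module.End.mul_apply, LinearMap.sub_apply, Module.End.mul_apply, LinearMap.smul_apply,
      mulX_single p, op_single, op_single, dd_add_lo (R := R) hp, single_comp_swap, map_add,
      Equiv.swap_apply_left, mulX_single p' (_ ∘ _), map_smul, smul_sub]
    abel
  exact LinearMap.congr_fun this v

theorem op_mulX_hi (q : R) {p p' : ι} (hp : p ≠ p') (t : E) (v : Poly ι E) :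
    op q p p' t (mulX R E p' v) = mulX R E p (op q p p' t v) + (q - 1) • mulX R E p' v := by
  have : op q p p' t * mulX R E p' = mulX R E p * op q p p' t + (q - 1) • mulX R E p' := by
    refine end_ext fun c h => ?_
    rw [Module.End.mul_apply, LinearMap.add_apply, Module.End.mul_apply, LinearMap.smul_apply,
      mulX_single p' c, op_single, op_single, dd_add_hi (R := R) hp, single_comp_swap, map_add,
      Equiv.swap_apply_right, mulX_single p (_ ∘ _), map_smul, smul_add, mulX_single]
    abel
  exact LinearMap.congr_fun this v

theorem op_mulX_ne (q : R) {p p' k : ι} (hk : k ≠ p) (hk' : k ≠ p') (t : E) (v : Poly ι E) :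
    op q p p' t (mulX R E k v) = mulX R E k (op q p p' t v) := by
  have : op q p p' t * mulX R E k = mulX R E k * op q p p' t := by
    refine end_ext fun c h => ?_
    rw [Module.End.mul_apply, Module.End.mul_apply, mulX_single k c, op_single, op_single,
      dd_add_ne (R := R) hk hk', single_comp_swap, map_add, Equiv.swap_apply_of_ne_of_ne hk hk',
      mulX_single k (_ ∘ _), map_smul]
  exact LinearMap.congr_fun this v

theorem mulX_comm (k k' : ι) (v : Poly ι E) :
    mulX R E k (mulX R E k' v) = mulX R E k' (mulX R E k v) := by
  have : mulX R E k * mulX R E k' = mulX R E k' * mulX R E k := by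
    refine end_ext fun c h => ?_
    simp only [Module.End.mul_apply, mulX_single, add_right_comm]
  exact LinearMap.congr_fun this v

theorem dd_of_eq {p p' : ι} {c : ι → ℕ} (hc : c p = c p') (h : E) : dd p p' c h = 0 := by
  simp [dd, hc]

theorem op_single_of_eq (q : R) {p p' : ι} {c : ι → ℕ} (hc : c p = c p') (t h : E) :
    op q p p' t (Finsupp.single c h) = Finsupp.single c (t * h) := by
  have h1 : c ∘ Equiv.swap p p' = c := by
    rw [comp_swap_eq, ← hc]
    conv_lhs => rw [show setTwo c p p' (c p) (c p) = setTwo c p p' (c p) (c p') by rw [← hc]]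
    exact setTwo_self c p p'
  rw [op_single, dd_of_eq hc, smul_zero, add_zero, h1]

/-- A linear map that kills the constants and intertwines every multiplication by a variable with
some operator is zero. -/
theorem eq_zero_of_mulX [Fintype ι] {M : Type*} [AddCommGroup M] [Module R M]
    {Z : Poly ι E →ₗ[R] M} (hX : ∀ k, ∃ Y : Module.End R M, ∀ v, Z (mulX R E k v) = Y (Z v))
    (h0 : ∀ h, Z (Finsupp.single 0 h) = 0) : Z = 0 := by
  refine Finsupp.lhom_ext fun c h => ?_
  induction hn : ∑ k, c k generalizing c with
  | zero =>
    have : c = 0 := by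
      ext k
      exact (Finset.sum_eq_zero_iff.mp hn) k (Finset.mem_univ k)
    rw [this, h0, LinearMap.zero_apply]
  | succ n ih =>
    obtain ⟨k, hk⟩ : ∃ k, c k ≠ 0 := by
      by_contra! hcon
      simp [hcon] at hn
    have hc : c = (c - Pi.single k 1 : ι → ℕ) + Pi.single k 1 := by
      ext j
      by_cases hj : j = k
      · subst hj; simp; omega
      · simp [hj]
    have hn' : ∑ j, (c - Pi.single k 1 : ι → ℕ) j = n := by
      rw [hc] at hn
      simp only [Pi.add_apply, Finset.sum_add_distrib] at hn
      simp at hn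
      simpa using hn
    obtain ⟨Y, hY⟩ := hX k
    rw [hc, ← mulX_single (R := R), hY, ih _ hn', LinearMap.zero_apply, map_zero,
      LinearMap.zero_apply]

variable [Fintype ι]

theorem op_sq (q : R) {p p' : ι} (hp : p ≠ p') {t : E} (ht : t * t = (q - 1) • t + q • 1)
    (v : Poly ι E) : op q p p' t (op q p p' t v) = (q - 1) • op q p p' t v + q • v := by
  set A := op q p p' t with hA
  have : A * A - (q - 1) • A - q • 1 = 0 := by
    refine eq_zero_of_mulX (fun k => ?_) fun h => ?_
    · by_cases h1 : k = p
      · refine ⟨mulX R E k, fun v => ?_⟩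
        subst h1
        simp only [LinearMap.sub_apply, Module.End.mul_apply, LinearMap.smul_apply,
          Module.End.one_apply, hA, map_sub, map_smul, op_mulX_lo q hp, op_mulX_hi q hp]
        module
      by_cases h2 : k = p'
      · refine ⟨mulX R E k, fun v => ?_⟩
        subst h2
        simp only [LinearMap.sub_apply, Module.End.mul_apply, LinearMap.smul_apply,
          Module.End.one_apply, hA, map_sub, map_add, map_smul, op_mulX_lo q hp, op_mulX_hi q hp]
        module
      · refine ⟨mulX R E k, fun v => ?_⟩
        simp only [LinearMap.sub_apply, Module.End.mul_apply, LinearMap.smul_apply,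
          Module.End.one_apply, hA, map_sub, map_smul, op_mulX_ne q h1 h2]
    · simp only [LinearMap.sub_apply, Module.End.mul_apply, LinearMap.smul_apply,
        Module.End.one_apply, hA, op_single_of_eq q (p := p) (p' := p') (c := 0) rfl,
        ← mul_assoc, ht, Finsupp.smul_single, ← Finsupp.single_sub]
      rw [← Finsupp.single_zero (0 : ι → ℕ)]
      congr 1
      rw [add_mul, smul_mul_assoc, smul_mul_assoc, one_mul]
      abel
  have h := LinearMap.congr_fun this v
  simp only [LinearMap.sub_apply, Module.End.mul_apply, LinearMap.smul_apply,
    Module.End.one_apply, LinearMap.zero_apply] at h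
  rw [sub_sub, sub_eq_zero] at h
  exact h

theorem op_braid (q : R) {p p' p'' : ι} (h1 : p ≠ p') (h2 : p' ≠ p'') (h3 : p ≠ p'') {t t' : E}
    (hq : t * t = (q - 1) • t + q • 1) (hq' : t' * t' = (q - 1) • t' + q • 1)
    (ht : t * t' * t = t' * t * t') :
    op q p p' t * op q p' p'' t' * op q p p' t =
      op q p' p'' t' * op q p p' t * op q p' p'' t' := by
  set A := op q p p' t with hA
  set B := op q p' p'' t' with hB
  rw [← sub_eq_zero]
  refine eq_zero_of_mulX (fun k => ?_) fun h => ?_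
  · by_cases k1 : k = p
    · refine ⟨mulX R E p'', fun v => ?_⟩
      subst k1
      simp only [LinearMap.sub_apply, Module.End.mul_apply, hA, hB, map_sub, map_add, map_smul,
        op_mulX_lo q h1, op_mulX_lo q h2, 
        op_mulX_ne q h1 h3, op_mulX_ne q h3.symm h2.symm, op_sq q h1 hq, op_sq q h2 hq']
      module
    by_cases k2 : k = p'
    · refine ⟨mulX R E p', fun v => ?_⟩
      subst k2
      simp only [LinearMap.sub_apply, Module.End.mul_apply, hA, hB, map_sub, map_add, map_smul,
        op_mulX_lo q h1, op_mulX_hi q h1, op_mulX_lo q h2, op_mulX_hi q h2,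
        op_mulX_ne q h1 h3, op_mulX_ne q h3.symm h2.symm]
      module
    by_cases k3 : k = p''
    · refine ⟨mulX R E p, fun v => ?_⟩
      subst k3
      simp only [LinearMap.sub_apply, Module.End.mul_apply, hA, hB, map_sub, map_add, map_smul,
        op_mulX_hi q h1, op_mulX_lo q h2, op_mulX_hi q h2,
        op_mulX_ne q h1 h3, op_mulX_ne q h3.symm h2.symm, op_sq q h1 hq, op_sq q h2 hq']
      module
    · refine ⟨mulX R E k, fun v => ?_⟩
      simp only [LinearMap.sub_apply, Module.End.mul_apply, hA, hB, map_sub,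
        op_mulX_ne q k1 k2, op_mulX_ne q k2 k3]
  · simp only [LinearMap.sub_apply, Module.End.mul_apply, hA, hB,
      op_single_of_eq q (p := p) (p' := p') (c := 0) rfl,
      op_single_of_eq q (p := p') (p' := p'') (c := 0) rfl, ← mul_assoc, ht, sub_self]

theorem op_comm (q : R) {p p' k k' : ι} (hp : p ≠ p') (hk : k ≠ k') (h1 : p ≠ k) (h2 : p ≠ k')
    (h3 : p' ≠ k) (h4 : p' ≠ k') {t t' : E} (ht : t * t' = t' * t) :
    op q p p' t * op q k k' t' = op q k k' t' * op q p p' t := by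
  set A := op q p p' t with hA
  set B := op q k k' t' with hB
  rw [← sub_eq_zero]
  refine eq_zero_of_mulX (fun j => ?_) fun h => ?_
  · by_cases j1 : j = p
    · refine ⟨mulX R E p', fun v => ?_⟩
      subst j1
      simp only [LinearMap.sub_apply, Module.End.mul_apply, hA, hB, map_sub, map_smul,
        op_mulX_lo q hp, op_mulX_ne q h1 h2, op_mulX_ne q h3 h4]
      module
    by_cases j2 : j = p'
    · refine ⟨mulX R E p, fun v => ?_⟩
      subst j2
      simp only [LinearMap.sub_apply, Module.End.mul_apply, hA, hB, map_sub, map_add, map_smul,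
        op_mulX_hi q hp, op_mulX_ne q h1 h2, op_mulX_ne q h3 h4]
      module
    by_cases j3 : j = k
    · refine ⟨mulX R E k', fun v => ?_⟩
      subst j3
      simp only [LinearMap.sub_apply, Module.End.mul_apply, hA, hB, map_sub, map_smul,
        op_mulX_lo q hk, op_mulX_ne q h1.symm h3.symm, op_mulX_ne q h2.symm h4.symm]
      module
    by_cases j4 : j = k'
    · refine ⟨mulX R E k, fun v => ?_⟩
      subst j4
      simp only [LinearMap.sub_apply, Module.End.mul_apply, hA, hB, map_sub, map_add, map_smul,
        op_mulX_hi q hk, op_mulX_ne q h1.symm h3.symm, op_mulX_ne q h2.symm h4.symm]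
      module
    · refine ⟨mulX R E j, fun v => ?_⟩
      simp only [LinearMap.sub_apply, Module.End.mul_apply, hA, hB, map_sub,
        op_mulX_ne q j1 j2, op_mulX_ne q j3 j4]
  · simp only [LinearMap.sub_apply, Module.End.mul_apply, hA, hB,
      op_single_of_eq q (p := p) (p' := p') (c := 0) rfl,
      op_single_of_eq q (p := k) (p' := k') (c := 0) rfl, ← mul_assoc, ht, sub_self]

theorem op_mulX_op (q : R) {p p' : ι} (hp : p ≠ p') {t : E} (ht : t * t = (q - 1) • t + q • 1)
    (v : Poly ι E) : op q p p' t (mulX R E p (op q p p' t v)) = q • mulX R E p' v := by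
  rw [op_mulX_lo q hp, op_sq q hp ht, map_add, map_smul, map_smul]
  abel

end Operators


/-! ### The truncated polynomial module -/

section Truncation

variable {R : Type*} [CommRing R] {ι : Type*} [DecidableEq ι]
  {E : Type*} [Ring E] [Algebra R E]

omit [DecidableEq ι] in
theorem map_mem_of_single {M : Type*} [AddCommGroup M] [Module R M] {S : Set (ι → ℕ)}
    {A : Poly ι E →ₗ[R] M} {W : Submodule R M}
    (h : ∀ c ∈ S, ∀ e, A (Finsupp.single c e) ∈ W) {v : Poly ι E}
    (hv : v ∈ Finsupp.supported E R S) : A v ∈ W := by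
  rw [← Finsupp.sum_single v, Finsupp.sum, map_sum]
  exact W.sum_mem fun c hc => h c (hv hc) _

omit [DecidableEq ι] in
theorem eqOn_of_single {M : Type*} [AddCommGroup M] [Module R M] {S : Set (ι → ℕ)}
    {A B : Poly ι E →ₗ[R] M}
    (h : ∀ c ∈ S, ∀ e, A (Finsupp.single c e) = B (Finsupp.single c e)) {v : Poly ι E}
    (hv : v ∈ Finsupp.supported E R S) : A v = B v := by
  have := map_mem_of_single (A := A - B) (W := ⊥) (fun c hc e => by
    rw [LinearMap.sub_apply, h c hc e, sub_self]; exact Submodule.zero_mem _) hv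
  rwa [LinearMap.sub_apply, Submodule.mem_bot, sub_eq_zero] at this

theorem aeval_intertwine {M M' : Type*} [AddCommGroup M] [Module R M] [AddCommGroup M']
    [Module R M'] (Z : M →ₗ[R] M') {X : Module.End R M} {X' : Module.End R M'}
    (h : ∀ v, Z (X v) = X' (Z v)) (f : Polynomial R) (v : M) :
    Z (Polynomial.aeval X f v) = Polynomial.aeval X' f (Z v) := by
  induction f using Polynomial.induction_on generalizing v with
  | C c => simp
  | add f g hf hg => simp [hf, hg]
  | monomial n c ih =>
    rw [pow_succ, ← mul_assoc, map_mul _ _ Polynomial.X, map_mul _ _ Polynomial.X,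
      Module.End.mul_apply, ih, Module.End.mul_apply, Polynomial.aeval_X, Polynomial.aeval_X, h]

variable (R) in
/-- Monomials all of whose exponents are less than `m`. -/
def trunc (ι E : Type*) [Ring E] [Algebra R E] (m : ℕ) : Submodule R (Poly ι E) :=
  Finsupp.supported E R {c | ∀ k, c k < m}

variable (R) in
/-- The variables `X_p` and `X_{p'}` are exchanged. -/
noncomputable def swp (p p' : ι) : Module.End R (Poly ι E) :=
  Finsupp.lmapDomain E R fun c => c ∘ Equiv.swap p p'

@[simp] theorem swp_single (p p' : ι) (c : ι → ℕ) (h : E) :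
    swp R p p' (Finsupp.single c h) = Finsupp.single (c ∘ Equiv.swap p p') h :=
  Finsupp.mapDomain_single

variable (R) in
/-- The coefficients are multiplied by `t` from the left. -/
noncomputable def lmul (t : E) : Module.End R (Poly ι E) :=
  Finsupp.mapRange.linearMap (LinearMap.mulLeft R t)

omit [DecidableEq ι] in
@[simp] theorem lmul_single (t : E) (c : ι → ℕ) (h : E) :
    lmul R t (Finsupp.single c h) = Finsupp.single c (t * h) := by
  simp [lmul]

variable (R) in
/-- The coefficients are multiplied by `t` from the right. -/
noncomputable def rmul (t : E) : Module.End R (Poly ι E) :=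
  Finsupp.mapRange.linearMap (LinearMap.mulRight R t)

omit [DecidableEq ι] in
@[simp] theorem rmul_single (t : E) (c : ι → ℕ) (h : E) :
    rmul R t (Finsupp.single c h) = Finsupp.single c (h * t) := by
  simp [rmul]

variable (R) in
/-- The coefficient of `X_p^n`, a polynomial in the other variables. -/
noncomputable def tk (p : ι) (n : ℕ) : Module.End R (Poly ι E) :=
  Finsupp.lsum R fun c => if c p = n then Finsupp.lsingle (Function.update c p 0) else 0

theorem tk_single (p : ι) (n : ℕ) (c : ι → ℕ) (h : E) :
    tk R p n (Finsupp.single c h) =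
      if c p = n then Finsupp.single (Function.update c p 0) h else 0 := by
  rw [tk, Finsupp.lsum_single]
  split_ifs <;> simp

theorem tk_single_of_ne {p : ι} {n : ℕ} {c : ι → ℕ} (hc : c p ≠ n) (h : E) :
    tk R p n (Finsupp.single c h) = 0 := by
  rw [tk_single, if_neg hc]

theorem tk_mulX {p p' : ι} (hp : p ≠ p') (n : ℕ) (v : Poly ι E) :
    tk R p n (mulX R E p' v) = mulX R E p' (tk R p n v) := by
  refine LinearMap.congr_fun (f := tk R p n * mulX R E p') (g := mulX R E p' * tk R p n)
    (end_ext fun c h => ?_) v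
  have e : (c + Pi.single p' 1 : ι → ℕ) p = c p := by simp [hp]
  simp only [Module.End.mul_apply, mulX_single, tk_single, e]
  split_ifs
  · rw [mulX_single]
    congr 1
    ext k
    simp only [Function.update_apply, Pi.add_apply, Pi.single_apply]
    split_ifs <;> simp_all
  · rw [map_zero]

theorem tk_lmul (p : ι) (n : ℕ) (t : E) (v : Poly ι E) :
    tk R p n (lmul R t v) = lmul R t (tk R p n v) := by
  refine LinearMap.congr_fun (f := tk R p n * lmul R t) (g := lmul R t * tk R p n)
    (end_ext fun c h => ?_) v
  simp only [Module.End.mul_apply, lmul_single, tk_single]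
  split_ifs <;> simp

theorem mulX_lmul (p : ι) (t : E) (v : Poly ι E) :
    mulX R E p (lmul R t v) = lmul R t (mulX R E p v) :=
  LinearMap.congr_fun (f := mulX R E p * lmul R t) (g := lmul R t * mulX R E p)
    (end_ext fun c h => by simp only [Module.End.mul_apply, lmul_single, mulX_single
      ]) v

theorem swp_lmul (p p' : ι) (t : E) (v : Poly ι E) :
    swp R p p' (lmul R t v) = lmul R t (swp R p p' v) :=
  LinearMap.congr_fun (f := swp R p p' * lmul R t) (g := lmul R t * swp R p p')
    (end_ext fun c h => by simp only [Module.End.mul_apply, lmul_single, 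
      swp_single]) v

omit [DecidableEq ι] in
theorem lmul_lmul (t t' : E) (v : Poly ι E) :
    lmul R t (lmul R t' v) = lmul R (t * t') v :=
  LinearMap.congr_fun (f := lmul R t * lmul R t') (g := lmul R (t * t'))
    (end_ext fun c h => by simp only [Module.End.mul_apply, lmul_single, mul_assoc]) v

theorem swp_mulX (p p' : ι) (v : Poly ι E) :
    swp R p p' (mulX R E p v) = mulX R E p' (swp R p p' v) :=
  LinearMap.congr_fun (f := swp R p p' * mulX R E p) (g := mulX R E p' * swp R p p')
    (end_ext fun c h => by simp [single_comp_swap]) v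

theorem tk_swp_tk (p p' : ι) (hp : p ≠ p') (n : ℕ) (c : ι → ℕ) (h : E) :
    tk R p n (swp R p p' (tk R p n (Finsupp.single c h))) =
      if c p = n ∧ c p' = n then Finsupp.single (setTwo c p p' 0 0) h else 0 := by
  rw [tk_single]
  by_cases h1 : c p = n
  · rw [if_pos h1, swp_single, tk_single]
    have e : (Function.update c p 0 ∘ Equiv.swap p p') p = c p' := by simp [hp.symm]
    rw [e]
    by_cases h2 : c p' = n
    · rw [if_pos h2, if_pos ⟨h1, h2⟩]
      congr 1
      refine eq_setTwo (by simp) (by simp [hp.symm]) fun k k1 k2 => ?_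
      simp [Equiv.swap_apply_of_ne_of_ne k1 k2, k1]
    · rw [if_neg h2, if_neg fun h => h2 h.2]
  · rw [if_neg h1, if_neg fun h => h1 h.1, map_zero, map_zero]

theorem tk_swp_tk_swp (p p' : ι) (hp : p ≠ p') (n : ℕ) (v : Poly ι E) :
    tk R p n (swp R p p' (tk R p n (swp R p p' v))) = tk R p n (swp R p p' (tk R p n v)) := by
  refine LinearMap.congr_fun (f := tk R p n * swp R p p' * tk R p n * swp R p p')
    (g := tk R p n * swp R p p' * tk R p n) (end_ext fun c h => ?_) v
  simp only [Module.End.mul_apply]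
  rw [swp_single, tk_swp_tk p p' hp, tk_swp_tk p p' hp]
  have e : setTwo (c ∘ Equiv.swap p p') p p' 0 0 = setTwo c p p' 0 0 :=
    eq_setTwo (setTwo_lo _ hp _ _) (setTwo_hi _ _ _ _ _) fun k k1 k2 => by
      rw [setTwo_of_ne _ k1 k2]; simp [Equiv.swap_apply_of_ne_of_ne k1 k2]
  simp only [Function.comp_apply, Equiv.swap_apply_left, Equiv.swap_apply_right, e]
  simp only [and_comm]

theorem op_tk_swp_tk (q : R) {p p' : ι} (hp : p ≠ p') (t : E) (n : ℕ) (v : Poly ι E) :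
    op q p p' t (tk R p n (swp R p p' (tk R p n v))) =
      lmul R t (tk R p n (swp R p p' (tk R p n v))) := by
  refine LinearMap.congr_fun (f := op q p p' t * tk R p n * swp R p p' * tk R p n)
    (g := lmul R t * tk R p n * swp R p p' * tk R p n) (end_ext fun c h => ?_) v
  simp only [Module.End.mul_apply]
  rw [tk_swp_tk p p' hp]
  split_ifs
  · rw [op_single_of_eq, lmul_single]
    rw [setTwo_lo c hp, setTwo_hi]
  · rw [map_zero, map_zero]

theorem op_lmul_of_comm (q : R) {p p' : ι} {t t' : E} (ht : t * t' = t' * t) (v : Poly ι E) :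
    op q p p' t (lmul R t' v) = lmul R t' (op q p p' t v) := by
  refine LinearMap.congr_fun (f := op q p p' t * lmul R t') (g := lmul R t' * op q p p' t)
    (end_ext fun c h => ?_) v
  simp only [Module.End.mul_apply, lmul_single, op_single, map_add, map_smul, dd, map_sub, map_sum,
    ← mul_assoc, ht]

theorem op_rmul (q : R) (p p' : ι) (t t' : E) (v : Poly ι E) :
    op q p p' t (rmul R t' v) = rmul R t' (op q p p' t v) := by
  refine LinearMap.congr_fun (f := op q p p' t * rmul R t') (g := rmul R t' * op q p p' t)
    (end_ext fun c h => ?_) v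
  simp only [Module.End.mul_apply, rmul_single, op_single, map_add, map_smul, dd, map_sub, map_sum,
    ← mul_assoc]

theorem setTwo_comp_swap (c : ι → ℕ) {p p' : ι} (hp : p ≠ p') (a b : ℕ) :
    setTwo c p p' a b ∘ Equiv.swap p p' = setTwo c p p' b a :=
  eq_setTwo (by simp [setTwo_hi]) (by simp [setTwo_lo c hp]) fun k k1 k2 => by
    simp [Equiv.swap_apply_of_ne_of_ne k1 k2, setTwo_of_ne c k1 k2]

/-- On truncated polynomials the divided difference does not contribute to the coefficient of
the top power of `X_p`. -/
theorem tk_op (q : R) {p p' : ι} (hp : p ≠ p') (t : E) {n : ℕ} {v : Poly ι E}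
    (hv : v ∈ trunc R ι E (n + 1)) :
    tk R p n (op q p p' t v) = lmul R t (tk R p n (swp R p p' v)) := by
  refine eqOn_of_single (A := tk R p n * op q p p' t) (B := lmul R t * tk R p n * swp R p p')
    (fun c hc h => ?_) hv
  have h1 : c p < n + 1 := hc p
  have h2 : c p' < n + 1 := hc p'
  have hd : tk R p n (dd p p' c h) = 0 := by
    rw [dd, map_sub, map_sum, map_sum, Finset.sum_eq_zero, Finset.sum_eq_zero, sub_zero]
    · intro k hk
      rw [Finset.mem_range] at hk
      exact tk_single_of_ne (by rw [setTwo_lo c hp]; omega) h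
    · intro k hk
      rw [Finset.mem_range] at hk
      exact tk_single_of_ne (by rw [setTwo_lo c hp]; omega) h
  simp only [Module.End.mul_apply, op_single, map_add, map_smul, hd, smul_zero, add_zero,
    swp_single, ← tk_lmul, lmul_single]

theorem tk_swp_op (q : R) {p p' : ι} (hp : p ≠ p') (t : E) {n : ℕ} {v : Poly ι E}
    (hv : v ∈ trunc R ι E (n + 1)) :
    tk R p n (swp R p p' (op q p p' t v)) = lmul R t (tk R p n v) +
      (q - 1) • (tk R p n (swp R p p' v) - tk R p n v) := by
  refine eqOn_of_single (A := tk R p n * swp R p p' * op q p p' t)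
    (B := lmul R t * tk R p n + (q - 1) • (tk R p n * swp R p p' - tk R p n)) (fun c hc h => ?_) hv
  have h1 : c p < n + 1 := hc p
  have h2 : c p' < n + 1 := hc p'
  have hs : (c ∘ Equiv.swap p p') ∘ Equiv.swap p p' = c := by
    ext k; simp
  have hd : tk R p n (swp R p p' (dd p p' c h)) =
      tk R p n (swp R p p' (Finsupp.single c h)) - tk R p n (Finsupp.single c h) := by
    rw [dd, map_sub, map_sub, map_sum, map_sum, map_sum, map_sum]
    simp only [swp_single, setTwo_comp_swap c hp]
    rcases lt_trichotomy (c p) (c p') with hlt | heq | hgt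
    · rw [show c p - c p' = 0 by omega, Finset.sum_range_zero, sub_zero,
        tk_single_of_ne (c := c) (by omega), sub_zero, Finset.sum_eq_single 0]
      · rw [comp_swap_eq]; rfl
      · intro k _ hk
        refine tk_single_of_ne (by rw [setTwo_lo c hp]; omega) h
      · intro hk
        simp only [Finset.mem_range, not_lt] at hk
        omega
    · have : c ∘ Equiv.swap p p' = c := by
        rw [comp_swap_eq]
        conv_rhs => rw [← setTwo_self c p p']
        rw [heq]
      rw [this, heq]
      simp
    · rw [show c p' - c p = 0 by omega, Finset.sum_range_zero, zero_sub,
        tk_single_of_ne (c := c ∘ _) (by simp; omega), zero_sub, Finset.sum_eq_single 0]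
      · congr 3
        exact setTwo_self c p p'
      · intro k _ hk
        refine tk_single_of_ne (by rw [setTwo_lo c hp]; omega) h
      · intro hk
        simp only [Finset.mem_range, not_lt] at hk
        omega
  simp only [Module.End.mul_apply, op_single, map_add, map_smul, hd, swp_single, hs,
    LinearMap.add_apply, LinearMap.smul_apply, LinearMap.sub_apply, ← tk_lmul, lmul_single]

theorem op_mem_supported (q : R) (p p' : ι) (t : E) {S : Set (ι → ℕ)}
    (hS : ∀ c ∈ S, ∀ a b, a + b = c p + c p' → a ≤ max (c p) (c p') → b ≤ max (c p) (c p') →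
      setTwo c p p' a b ∈ S) {v : Poly ι E} (hv : v ∈ Finsupp.supported E R S) :
    op q p p' t v ∈ Finsupp.supported E R S := by
  refine map_mem_of_single (fun c hc h => ?_) hv
  rw [op_single, comp_swap_eq]
  refine Submodule.add_mem _ (Finsupp.single_mem_supported R _
    (hS c hc _ _ (add_comm _ _) (le_max_right _ _) (le_max_left _ _))) (Submodule.smul_mem _ _ ?_)
  refine Submodule.sub_mem _ (Submodule.sum_mem _ fun k hk => ?_)
    (Submodule.sum_mem _ fun k hk => ?_)
  all_goals
    rw [Finset.mem_range] at hk
    exact Finsupp.single_mem_supported R _ (hS c hc _ _ (by omega) (by omega) (by omega))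

theorem op_mem_trunc (q : R) (p p' : ι) (t : E) {m : ℕ} {v : Poly ι E}
    (hv : v ∈ trunc R ι E m) : op q p p' t v ∈ trunc R ι E m := by
  refine op_mem_supported q p p' t (S := {c | ∀ k, c k < m}) (fun c hc a b _ ha hb k => ?_) hv
  by_cases hk' : k = p'
  · rw [hk', setTwo_hi]; exact hb.trans_lt (max_lt (hc _) (hc _))
  by_cases hk : k = p
  · subst hk
    rw [setTwo_lo c hk']; exact ha.trans_lt (max_lt (hc _) (hc _))
  · rw [setTwo_of_ne c hk hk']; exact hc k

/-- The value at `X_p` of a polynomial with coefficients in `R`. -/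
noncomputable def evX (R : Type*) [CommRing R] {ι : Type*} [DecidableEq ι] {E : Type*} [Ring E]
    [Algebra R E] (p : ι) (f : Polynomial R) : Module.End R (Poly ι E) :=
  Polynomial.aeval (mulX R E p) f

/-- The operator of `T_0`: multiplication by `X_p` followed by division by the monic polynomial
`f(X_p)` of degree `n + 1`. -/
noncomputable def op0 (p : ι) (n : ℕ) (f : Polynomial R) : Module.End R (Poly ι E) :=
  mulX R E p - evX R p f * tk R p n

theorem op0_apply (p : ι) (n : ℕ) (f : Polynomial R) (v : Poly ι E) :
    op0 p n f v = mulX R E p v - evX R p f (tk R p n v) := rfl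

theorem op_evX_mul_evX (q : R) {p p' : ι} (hp : p ≠ p') (t : E) {κ : Type*} [DecidableEq κ]
    (s : Finset κ) (u : κ → R) (v : Poly ι E) :
    op q p p' t (evX R p (∏ k ∈ s, (Polynomial.X - Polynomial.C (u k)))
      (evX R p' (∏ k ∈ s, (Polynomial.X - Polynomial.C (u k))) v)) =
    evX R p (∏ k ∈ s, (Polynomial.X - Polynomial.C (u k)))
      (evX R p' (∏ k ∈ s, (Polynomial.X - Polynomial.C (u k))) (op q p p' t v)) := by
  induction s using Finset.induction_on generalizing v with
  | empty => simp [evX]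
  | insert k s hk ih =>
    have h1 : ∀ (p : ι) (v : Poly ι E), evX R p (Polynomial.X - Polynomial.C (u k)) v =
        mulX R E p v - u k • v := by
      intro p v
      simp [evX, Algebra.algebraMap_eq_smul_one]
    have h2 : ∀ (v : Poly ι E), op q p p' t (mulX R E p (mulX R E p' v) -
        u k • mulX R E p v - u k • mulX R E p' v + (u k * u k) • v) =
        mulX R E p (mulX R E p' (op q p p' t v)) -
        u k • mulX R E p (op q p p' t v) - u k • mulX R E p' (op q p p' t v) +
          (u k * u k) • (op q p p' t v) := by
      intro v
      simp only [map_sub, map_add, map_smul, op_mulX_lo q hp, op_mulX_hi q hp,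
        mulX_comm p' p]
      module
    have h3 : ∀ (v : Poly ι E), evX R p (∏ k ∈ insert k s, (Polynomial.X - Polynomial.C (u k)))
        (evX R p' (∏ k ∈ insert k s, (Polynomial.X - Polynomial.C (u k))) v) =
        mulX R E p (mulX R E p' (evX R p (∏ k ∈ s, (Polynomial.X - Polynomial.C (u k)))
          (evX R p' (∏ k ∈ s, (Polynomial.X - Polynomial.C (u k))) v))) -
        u k • mulX R E p (evX R p (∏ k ∈ s, (Polynomial.X - Polynomial.C (u k)))
          (evX R p' (∏ k ∈ s, (Polynomial.X - Polynomial.C (u k))) v)) -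
        u k • mulX R E p' (evX R p (∏ k ∈ s, (Polynomial.X - Polynomial.C (u k)))
          (evX R p' (∏ k ∈ s, (Polynomial.X - Polynomial.C (u k))) v)) +
        (u k * u k) • (evX R p (∏ k ∈ s, (Polynomial.X - Polynomial.C (u k)))
          (evX R p' (∏ k ∈ s, (Polynomial.X - Polynomial.C (u k))) v)) := by
      intro v
      have h4 : ∀ w : Poly ι E, evX R p (∏ k ∈ s, (Polynomial.X - Polynomial.C (u k)))
          (mulX R E p' w) =
          mulX R E p' (evX R p (∏ k ∈ s, (Polynomial.X - Polynomial.C (u k))) w) := fun w =>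
        (aeval_intertwine (mulX R E p') (fun v => mulX_comm p' p v) _ w).symm
      rw [Finset.prod_insert hk]
      conv_lhs => rw [evX, map_mul, Module.End.mul_apply, ← evX, ← evX, h1]
      conv_lhs => rw [evX, evX, map_mul, Module.End.mul_apply, ← evX, ← evX, ← evX, h1]
      simp only [map_sub, map_smul, h4]
      module
    rw [h3, h3, h2, ih]

/-- The braid relation of length four on truncated polynomials: both sides are compared by
computing the terms that the division by `f(X_p)` removes; their difference is
`f(X_p) f(X_{p'}) t² c - T (f(X_p) f(X_{p'}) t c)`, where `c` is the coefficient of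
`X_p^n X_{p'}^n`, and it vanishes because `T` commutes with symmetric polynomials. -/
theorem op0_braid (q : R) {p p' : ι} (hp : p ≠ p') {t : E} (ht : t * t = (q - 1) • t + q • 1)
    {n : ℕ} {κ : Type*} [DecidableEq κ] [Fintype ι] (s : Finset κ) (u : κ → R) {v : Poly ι E}
    (hv : v ∈ trunc R ι E (n + 1))
    (h0 : ∀ w ∈ trunc R ι E (n + 1),
      op0 p n (∏ k ∈ s, (Polynomial.X - Polynomial.C (u k))) w ∈ trunc R ι E (n + 1)) :
    let f := ∏ k ∈ s, (Polynomial.X - Polynomial.C (u k))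
    op0 p n f (op q p p' t (op0 p n f (op q p p' t v))) =
      op q p p' t (op0 p n f (op q p p' t (op0 p n f v))) := by
  intro f
  set A := op q p p' t with hA
  set X := mulX R E p with hX
  set Y := mulX R E p' with hY
  set θ := tk R (E := E) p n with hθ
  set S := swp R (E := E) p p' with hS
  set F := evX R (E := E) p f with hF
  set F' := evX R (E := E) p' f with hF'
  set τ := lmul R (ι := ι) t with hτ
  have T0 : ∀ w, op0 p n f w = X w - F (θ w) := fun w => rfl
  have θY : ∀ w, θ (Y w) = Y (θ w) := tk_mulX hp n
  have SX : ∀ w, S (X w) = Y (S w) := swp_mulX p p'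
  have XY : ∀ w, X (Y w) = Y (X w) := mulX_comm p p'
  have θτ : ∀ w, θ (τ w) = τ (θ w) := tk_lmul p n t
  have Sτ : ∀ w, S (τ w) = τ (S w) := swp_lmul p p' t
  have Yτ : ∀ w, Y (τ w) = τ (Y w) := mulX_lmul p' t
  have Xτ : ∀ w, X (τ w) = τ (X w) := mulX_lmul p t
  have SF : ∀ w, S (F w) = F' (S w) := fun w => aeval_intertwine S SX f w
  have θF' : ∀ w, θ (F' w) = F' (θ w) := fun w => aeval_intertwine θ θY f w
  have YF : ∀ w, Y (F w) = F (Y w) := fun w => aeval_intertwine Y (fun w => (XY w).symm) f w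
  have XF : ∀ w, X (F w) = F (X w) := fun w => aeval_intertwine X (fun w => rfl) f w
  have τF : ∀ w, τ (F w) = F (τ w) := fun w => aeval_intertwine τ (fun w => (Xτ w).symm) f w
  have τF' : ∀ w, τ (F' w) = F' (τ w) := fun w => aeval_intertwine τ (fun w => (Yτ w).symm) f w
  have θA : ∀ w ∈ trunc R ι E (n + 1), θ (A w) = τ (θ (S w)) := fun w hw => tk_op q hp t hw
  have θSA : ∀ w ∈ trunc R ι E (n + 1), θ (S (A w)) = τ (θ w) + (q - 1) • (θ (S w) - θ w) :=
    fun w hw => tk_swp_op q hp t hw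
  have γS : ∀ w, θ (S (θ (S w))) = θ (S (θ w)) := tk_swp_tk_swp p p' hp n
  have Aγ : ∀ w, A (θ (S (θ w))) = τ (θ (S (θ w))) := op_tk_swp_tk q hp t n
  have Aτ : ∀ w, A (τ w) = τ (A w) := op_lmul_of_comm q rfl
  have AX : ∀ w, A (X w) = Y (A w) - (q - 1) • Y w := op_mulX_lo q hp t
  have AY : ∀ w, A (Y w) = X (A w) + (q - 1) • Y w := op_mulX_hi q hp t
  have AXA : ∀ w, A (X (A w)) = q • Y w := op_mulX_op q hp ht
  have AFF : ∀ w, A (F (F' w)) = F (F' (A w)) := op_evX_mul_evX q hp t s u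
  have ττ : ∀ w, τ (τ w) = (q - 1) • τ w + q • w := by
    intro w
    rw [hτ, lmul_lmul, ht]
    refine LinearMap.congr_fun (f := lmul R ((q - 1) • t + q • 1)) (g := (q - 1) • lmul R t + q • 1)
      (end_ext fun c h => ?_) w
    simp only [LinearMap.add_apply, LinearMap.smul_apply, Module.End.one_apply, lmul_single,
      add_mul, smul_mul_assoc, one_mul, Finsupp.single_add, Finsupp.smul_single]
  have hAv : A v ∈ trunc R ι E (n + 1) := op_mem_trunc q p p' t hv
  have e1 : θ (S (op0 p n f v)) = Y (θ (S v)) - F' (θ (S (θ v))) := by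
    rw [T0, map_sub, map_sub, SX, θY, SF, θF']
  have e2 : θ (S (op0 p n f (A v))) =
      Y (τ (θ v) + (q - 1) • (θ (S v) - θ v)) - F' (τ (θ (S (θ v)))) := by
    rw [T0, map_sub, map_sub, SX, θY, SF, θF', θSA v hv, θA v hv, Sτ, θτ, γS]
  have e3 : θ (A (op0 p n f (A v))) = τ (θ (S (op0 p n f (A v)))) := θA _ (h0 _ hAv)
  have e4 : θ (A (op0 p n f v)) = τ (θ (S (op0 p n f v))) := θA _ (h0 _ hv)
  have e5 : ∀ w, A (op0 p n f (A w)) = q • Y w - A (F (θ (A w))) := by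
    intro w
    rw [T0, map_sub, AXA]
  have XA : ∀ w, X (A w) = A (Y w) - (q - 1) • Y w := fun w => by rw [AY]; abel
  rw [e5 (op0 p n f v), e4, e1, T0 (A (op0 p n f (A v))), e3, e2, e5, θA v hv, T0 v]
  simp only [map_sub, map_add, map_smul, XA, Yτ, τF', AFF, Aτ, Aγ, YF, XY, ττ, 
    smul_sub]
  module

end Truncation


section TruncatedShift

variable {R : Type*} [CommRing R] {ι : Type*} [DecidableEq ι]
  {E : Type*} [Ring E] [Algebra R E]

theorem mulX_pow_single (p : ι) (i : ℕ) (c : ι → ℕ) (h : E) :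
    (mulX R E p ^ i) (Finsupp.single c h) = Finsupp.single (c + Pi.single p i) h := by
  induction i with
  | zero => simp
  | succ i ih =>
    rw [pow_succ', Module.End.mul_apply, ih, mulX_single, add_assoc, ← Pi.single_add]

theorem op0_single_of_ne {p : ι} {n : ℕ} (f : Polynomial R) {c : ι → ℕ} (hc : c p ≠ n) (h : E) :
    op0 p n f (Finsupp.single c h) = Finsupp.single (c + Pi.single p 1) h := by
  rw [op0_apply, tk_single_of_ne hc, map_zero, sub_zero, mulX_single]

theorem _root_.Polynomial.Monic.aeval_end_apply {M : Type*} [AddCommGroup M] [Module R M]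
    {f : Polynomial R} (hf : f.Monic) (X : Module.End R M) (v : M) :
    Polynomial.aeval X f v = (X ^ f.natDegree) v +
      ∑ i ∈ Finset.range f.natDegree, f.coeff i • (X ^ i) v := by
  conv_lhs => rw [hf.as_sum]
  simp only [map_add, map_sum, map_mul, map_pow, Polynomial.aeval_X, Polynomial.aeval_C,
    LinearMap.add_apply, LinearMap.sum_apply, Module.End.mul_apply, Module.algebraMap_end_apply]

theorem evX_single (p : ι) {f : Polynomial R} {n : ℕ} (hf : f.Monic) (hn : f.natDegree = n)
    (c : ι → ℕ) (h : E) : evX R p f (Finsupp.single c h) = Finsupp.single (c + Pi.single p n) h +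
      ∑ i ∈ Finset.range n, f.coeff i • Finsupp.single (c + Pi.single p i) h := by
  rw [evX, hf.aeval_end_apply, hn]
  simp only [mulX_pow_single]

theorem op0_single_top {p : ι} {n : ℕ} {f : Polynomial R} (hf : f.Monic)
    (hn : f.natDegree = n + 1) {d : ι → ℕ} (hd : d p = 0) (h : E) :
    op0 p n f (Finsupp.single (d + Pi.single p n) h) =
      -∑ i ∈ Finset.range (n + 1), f.coeff i • Finsupp.single (d + Pi.single p i) h := by
  have e : Function.update (d + Pi.single p n) p 0 = d := by
    ext k
    by_cases hk : k = p
    · subst hk; simp [hd]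
    · simp [hk]
  rw [op0_apply, tk_single, if_pos (by simp [hd]), e, evX_single p hf hn, mulX_single, add_assoc,
    ← Pi.single_add]
  abel

theorem eq_add_single (c : ι → ℕ) (p : ι) :
    c = Function.update c p 0 + Pi.single p (c p) := by
  ext k
  by_cases hk : k = p
  · subst hk; simp
  · simp [hk]

theorem op0_mem_trunc (p : ι) {n : ℕ} {f : Polynomial R} (hf : f.Monic)
    (hn : f.natDegree = n + 1) {v : Poly ι E} (hv : v ∈ trunc R ι E (n + 1)) :
    op0 p n f v ∈ trunc R ι E (n + 1) := by
  refine map_mem_of_single (S := {c | ∀ k, c k < n + 1}) (fun c hc h => ?_) hv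
  by_cases hcp : c p = n
  · rw [eq_add_single c p, hcp, op0_single_top hf hn (Function.update_self _ _ _)]
    refine Submodule.neg_mem _ (Submodule.sum_mem _ fun i hi => Submodule.smul_mem _ _
      (Finsupp.single_mem_supported R _ fun k => ?_))
    rw [Finset.mem_range] at hi
    by_cases hk : k = p
    · subst hk; simpa using hi
    · simpa [hk] using hc k
  · rw [op0_single_of_ne f hcp]
    refine Finsupp.single_mem_supported R _ fun k => ?_
    have := hc k
    by_cases hk : k = p
    · subst hk; simp; omega
    · simpa [hk] using this

theorem op0_pow_single {p : ι} {n : ℕ} (f : Polynomial R) {d : ι → ℕ} (hd : d p = 0) (h : E)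
    {i : ℕ} (hi : i ≤ n) :
    (op0 p n f ^ i) (Finsupp.single d h) = Finsupp.single (d + Pi.single p i) h := by
  induction i with
  | zero => simp
  | succ i ih =>
    rw [pow_succ', Module.End.mul_apply, ih (by omega), op0_single_of_ne f (by simp [hd]; omega),
      add_assoc, ← Pi.single_add]

/-- The truncated multiplication by `X_p` satisfies the cyclotomic relation. -/
theorem aeval_op0 {p : ι} {n : ℕ} {f : Polynomial R} (hf : f.Monic)
    (hn : f.natDegree = n + 1) {v : Poly ι E} (hv : v ∈ trunc R ι E (n + 1)) :
    Polynomial.aeval (op0 (E := E) p n f) f v = 0 := by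
  refine eqOn_of_single (A := Polynomial.aeval (op0 (E := E) p n f) f) (B := 0) (fun c hc h => ?_) hv
  have hcp : c p < n + 1 := hc p
  have h1 : ∀ d : ι → ℕ, d p = 0 →
      Polynomial.aeval (op0 (E := E) p n f) f (Finsupp.single d h) = 0 := by
    intro d hd
    rw [hf.aeval_end_apply, hn, pow_succ', Module.End.mul_apply, op0_pow_single f hd h le_rfl, op0_single_top hf hn hd,
      neg_add_eq_zero]
    refine Finset.sum_congr rfl fun i hi => ?_
    rw [Finset.mem_range] at hi
    rw [op0_pow_single f hd h (by omega)]
  rw [eq_add_single c p, ← op0_pow_single f (Function.update_self _ _ _) h (Nat.lt_succ_iff.mp hcp),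
    LinearMap.zero_apply]
  have h2 := aeval_intertwine (op0 (E := E) p n f ^ c p) (X := op0 p n f) (X' := op0 p n f)
    (fun v => by rw [← Module.End.mul_apply, ← Module.End.mul_apply, ← pow_succ, ← pow_succ']) f
    (Finsupp.single (Function.update c p 0) h)
  rw [← h2, h1 _ (Function.update_self _ _ _), map_zero]

theorem tk_op_of_ne (q : R) {p k k' : ι} (hk : p ≠ k) (hk' : p ≠ k') (n : ℕ) (t : E)
    (v : Poly ι E) : op q k k' t (tk R p n v) = tk R p n (op q k k' t v) := by
  refine LinearMap.congr_fun (f := op q k k' t * tk R p n) (g := tk R p n * op q k k' t)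
    (end_ext fun c h => ?_) v
  have e1 : (c ∘ Equiv.swap k k') p = c p := by
    simp [Equiv.swap_apply_of_ne_of_ne hk hk']
  have e2 : ∀ a b, setTwo c k k' a b p = c p := setTwo_of_ne c hk hk'
  have e3 : Function.update c p 0 ∘ Equiv.swap k k' =
      Function.update (c ∘ Equiv.swap k k') p 0 := by
    ext j
    simp only [Function.comp_apply, Function.update_apply,
      Equiv.swap_apply_eq_iff, Equiv.swap_apply_of_ne_of_ne hk hk']
  have e4 : ∀ a b, setTwo (Function.update c p 0) k k' a b =
      Function.update (setTwo c k k' a b) p 0 := by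
    intro a b
    ext j
    simp only [setTwo, Function.update_apply]
    split_ifs <;> simp_all
  simp only [Module.End.mul_apply, op_single, dd, map_add, map_smul, map_sub, map_sum,
    tk_single, e1, e2]
  split_ifs
  · simp only [op_single, dd, Function.update_of_ne hk.symm, Function.update_of_ne hk'.symm, e3, e4]
  · simp

theorem op_op0 (q : R) {p k k' : ι} (hk : p ≠ k) (hk' : p ≠ k') (n : ℕ) (f : Polynomial R) (t : E)
    (v : Poly ι E) : op q k k' t (op0 p n f v) = op0 p n f (op q k k' t v) := by
  rw [op0_apply, op0_apply, map_sub, op_mulX_ne q hk hk', ← tk_op_of_ne q hk hk']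
  congr 1
  exact aeval_intertwine _ (fun v => op_mulX_ne q hk hk' t v) f _

theorem op0_rmul (p : ι) (n : ℕ) (f : Polynomial R) (t : E) (v : Poly ι E) :
    op0 p n f (rmul R t v) = rmul R t (op0 p n f v) := by
  have h1 : ∀ v : Poly ι E, mulX R E p (rmul R t v) = rmul R t (mulX R E p v) :=
    LinearMap.congr_fun (f := mulX R E p * rmul R t) (g := rmul R t * mulX R E p)
      (end_ext fun c h => by simp only [Module.End.mul_apply, rmul_single, mulX_single])
  have h2 : ∀ v : Poly ι E, tk R p n (rmul R t v) = rmul R t (tk R p n v) :=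
    LinearMap.congr_fun (f := tk R p n * rmul R t) (g := rmul R t * tk R p n)
      (end_ext fun c h => by
        simp only [Module.End.mul_apply, rmul_single, tk_single]
        split_ifs <;> simp only [rmul_single, map_zero])
  rw [op0_apply, op0_apply, map_sub, h1, h2]
  congr 1
  exact (aeval_intertwine _ (fun v => (h1 v).symm) f _).symm

end TruncatedShift


/-! ### The regular representation on truncated polynomials -/

section TruncType

variable (R : Type*) [CommRing R] (ι E : Type*) [Ring E] [Algebra R E] (m : ℕ)

/-- The type of polynomials all of whose exponents are less than `m`. It is kept apart from the
coercion of the submodule `trunc R ι E m`, whose endomorphism ring is not found by instance search. -/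
def Trunc : Type _ := trunc R ι E m

noncomputable instance : AddCommGroup (Trunc R ι E m) :=
  inferInstanceAs (AddCommGroup (trunc R ι E m))

noncomputable instance : Module R (Trunc R ι E m) := inferInstanceAs (Module R (trunc R ι E m))

variable {R ι E m}

/-- The inclusion of the truncated polynomials into all polynomials. -/
noncomputable def toPoly : Trunc R ι E m →ₗ[R] Poly ι E := (trunc R ι E m).subtype

theorem toPoly_injective : Function.Injective (toPoly : Trunc R ι E m →ₗ[R] Poly ι E) :=
  Subtype.val_injective

theorem toPoly_mem (v : Trunc R ι E m) : toPoly v ∈ trunc R ι E m := v.2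

theorem single_mem_trunc {c : ι → ℕ} (hc : ∀ k, c k < m) (h : E) :
    Finsupp.single c h ∈ trunc R ι E m :=
  Finsupp.single_mem_supported R h hc

/-- An element of the submodule `trunc R ι E m`, as an element of the type. -/
def toTrunc (v : Poly ι E) (hv : v ∈ trunc R ι E m) : Trunc R ι E m := ⟨v, hv⟩

theorem toPoly_toTrunc (v : Poly ι E) (hv : v ∈ trunc R ι E m) : toPoly (toTrunc v hv) = v := rfl

/-- The endomorphism of the truncated polynomials induced by one of all polynomials. -/
noncomputable def restr (A : Module.End R (Poly ι E))
    (hA : ∀ v ∈ trunc R ι E m, A v ∈ trunc R ι E m) : Module.End R (Trunc R ι E m) :=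
  A.restrict hA

variable (R m)

/-- The monomial `X^c h`, or `0` if some exponent is not less than `m`. -/
noncomputable def ns (c : ι → ℕ) (h : E) : Trunc R ι E m :=
  open Classical in
  if hc : ∀ k, c k < m then toTrunc _ (single_mem_trunc hc h) else 0

variable {m}

theorem toPoly_ns {c : ι → ℕ} (hc : ∀ k, c k < m) (h : E) :
    toPoly (ns R m c h) = Finsupp.single c h := by
  rw [ns, dif_pos hc, toPoly_toTrunc]

theorem toPoly_ns_zero [NeZero m] (h : E) :
    toPoly (ns R m (0 : ι → ℕ) h) = Finsupp.single 0 h :=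
  toPoly_ns R (fun _ => Nat.pos_of_ne_zero (NeZero.ne m)) h

end TruncType

section Representation

open MvPolynomial

variable {R : Type*} [CommRing R] {m r : ℕ} {q : Rˣ} {u : Fin m → R}
  {E : Type*} [Ring E] [Algebra R E]

variable (r q u E) in
/-- A copy `E` of the subalgebra `ℋ(𝔖_r)` of `H`, generated by the elements `t i`. The Hecke
relations of the `t i` follow from the injectivity of `j`. -/
structure HeckeModel where
  /-- The generators. -/
  t : Fin (r - 1) → E
  /-- The inclusion. -/
  j : E →ₐ[R] H r q u
  inj : Function.Injective j
  j_t : ∀ i, j (t i) = G q u i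
  adjoin_t : Algebra.adjoin R (Set.range t) = ⊤

variable (D : HeckeModel r q u E)

theorem HeckeModel.t_sq (i : Fin (r - 1)) :
    D.t i * D.t i = ((q : R) - 1) • D.t i + (q : R) • 1 := by
  apply D.inj
  simp only [map_mul, map_add, map_smul, map_one, D.j_t, G_sq]

theorem HeckeModel.t_braid (i i' : Fin (r - 1)) (h : (i' : ℕ) = i + 1) :
    D.t i * D.t i' * D.t i = D.t i' * D.t i * D.t i' := by
  apply D.inj
  simp only [map_mul, D.j_t, G_braid q u i i' h]

theorem HeckeModel.t_comm (i i' : Fin (r - 1)) (h : (i : ℕ) + 2 ≤ i') :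
    D.t i * D.t i' = D.t i' * D.t i := by
  apply D.inj
  simp only [map_mul, D.j_t, G_comm q u i i' h]

/-- The operator by which the generator `T_p` acts on truncated polynomials. -/
noncomputable def opF (p : Fin r) : Module.End R (Poly (Fin r) E) :=
  if h : (p : ℕ) = 0 then op0 p (m - 1) (∏ k, (Polynomial.X - Polynomial.C (u k)))
  else op (q : R) (lo ⟨p - 1, by omega⟩) (succIdx ⟨p - 1, by omega⟩) (D.t ⟨p - 1, by omega⟩)

theorem opF_zero {p : Fin r} (h : (p : ℕ) = 0) :
    opF D p = op0 p (m - 1) (∏ k, (Polynomial.X - Polynomial.C (u k))) := dif_pos h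

theorem opF_hi (i : Fin (r - 1)) :
    opF D (succIdx i) = op (q : R) (lo i) (succIdx i) (D.t i) :=
  dif_neg (by rw [succIdx_val]; omega)

variable (m) in
/-- The largest truncated exponent. -/
def topExp (r : ℕ) : Fin r → ℕ := fun _ => m - 1

theorem op_top (i : Fin (r - 1)) {v : Poly (Fin r) E} (hv : v ∈ trunc R (Fin r) E m) :
    (op (q : R) (lo i) (succIdx i) (D.t i) v) (topExp m r) = D.t i * v (topExp m r) := by
  refine eqOn_of_single (A := Finsupp.lapply (topExp m r) ∘ₗ
      op (q : R) (lo i) (succIdx i) (D.t i)) (B := (LinearMap.mulLeft R (D.t i)) ∘ₗ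
        Finsupp.lapply (R := R) (topExp m r)) (fun c hc h => ?_) hv
  have h1 : c (lo i) < m := hc _
  have h2 : c (succIdx i) < m := hc _
  have hd : dd (lo i) (succIdx i) c h (topExp m r) = 0 := by
    rw [dd, Finsupp.sub_apply, Finsupp.finsetSum_apply, Finsupp.finsetSum_apply,
      Finset.sum_eq_zero, Finset.sum_eq_zero, sub_zero]
    all_goals
      intro k hk
      rw [Finset.mem_range] at hk
      refine Finsupp.single_eq_of_ne' fun heq => ?_
      have := congrFun heq (lo i)
      rw [setTwo_lo _ (lo_ne i), topExp] at this
      omega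
  simp only [LinearMap.comp_apply, Finsupp.lapply_apply, LinearMap.mulLeft_apply, op_single,
    Finsupp.add_apply, Finsupp.smul_apply, hd, smul_zero, add_zero]
  have hs : (c ∘ Equiv.swap (lo i) (succIdx i) = topExp m r) ↔ c = topExp m r := by
    constructor
    · intro h
      ext p
      have := congrFun h (Equiv.swap (lo i) (succIdx i) p)
      simpa [topExp] using this
    · rintro rfl
      rfl
  simp only [Finsupp.single_apply, hs]
  split_ifs <;> simp

theorem prod_monic (u : Fin m → R) : (∏ k, (Polynomial.X - Polynomial.C (u k))).Monic :=
  Polynomial.monic_prod_of_monic _ _ fun k _ => Polynomial.monic_X_sub_C (u k)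

variable [NeZero m]

theorem sub_one_add_one : m - 1 + 1 = m := Nat.succ_pred_eq_of_ne_zero (NeZero.ne m)

theorem prod_natDegree [Nontrivial R] (u : Fin m → R) :
    (∏ k, (Polynomial.X - Polynomial.C (u k))).natDegree = m - 1 + 1 := by
  rw [sub_one_add_one, Polynomial.natDegree_prod_of_monic _ _ fun k _ =>
    Polynomial.monic_X_sub_C (u k)]
  simp

theorem trunc_pred : trunc R (Fin r) E (m - 1 + 1) = trunc R (Fin r) E m := by
  rw [sub_one_add_one]

theorem exists_lo_succIdx {p : Fin r} (h : (p : ℕ) ≠ 0) : ∃ i, succIdx i = p :=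
  ⟨⟨p - 1, by omega⟩, by rw [Fin.ext_iff, succIdx_val]; simp only; omega⟩

variable [Nontrivial R]

theorem opF_mem (p : Fin r) : ∀ v ∈ trunc R (Fin r) E m, opF D p v ∈ trunc R (Fin r) E m := by
  intro v hv
  by_cases h : (p : ℕ) = 0
  · rw [opF_zero D h]
    have h1 := op0_mem_trunc p (prod_monic u) (prod_natDegree u) (v := v)
    rw [sub_one_add_one] at h1
    exact h1 hv
  · obtain ⟨i, rfl⟩ := exists_lo_succIdx h
    rw [opF_hi]
    exact op_mem_trunc _ _ _ _ hv

/-- The action of the generators on the truncated module. -/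
noncomputable def opN (p : Fin r) : Module.End R (Trunc R (Fin r) E m) :=
  restr (opF D p) (opF_mem D p)

theorem toPoly_opN (p : Fin r) (v : Trunc R (Fin r) E m) :
    toPoly (opN D p v) = opF D p (toPoly v) := rfl

theorem isAK_opN : IsAK q u (opN D) where
  braid4 i j hi hj := by
    refine LinearMap.ext fun v => toPoly_injective ?_
    obtain ⟨k, rfl⟩ := exists_lo_succIdx (p := j) (by omega)
    obtain rfl : i = lo k := by
      rw [succIdx_val] at hj
      rw [Fin.ext_iff, lo_val]; omega
    simp only [Module.End.mul_apply, toPoly_opN, opF_zero D hi, opF_hi]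
    have h0 := opF_mem D (lo k)
    rw [opF_zero D hi, ← trunc_pred] at h0
    exact op0_braid (q : R) (lo_ne k) (D.t_sq k) Finset.univ u
      (trunc_pred.ge (toPoly_mem v)) h0
  braid3 i j hi hj := by
    refine LinearMap.ext fun v => toPoly_injective ?_
    obtain ⟨k, rfl⟩ := exists_lo_succIdx (p := i) (by omega)
    obtain ⟨l, rfl⟩ := exists_lo_succIdx (p := j) (by omega)
    have hl : succIdx k = lo l := by
      rw [succIdx_val, succIdx_val] at hj
      rw [Fin.ext_iff, succIdx_val, lo_val]; omega
    have hkl : (l : ℕ) = k + 1 := (Fin.ext_iff.mp hl).symm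
    simp only [Module.End.mul_apply, toPoly_opN, opF_hi]
    have := op_braid (q : R) (lo_ne k) (hl ▸ lo_ne l)
      ((lo_lt k).trans (hl ▸ lo_lt l)).ne (D.t_sq k) (D.t_sq l)
      (D.t_braid k l hkl)
    rw [← hl]
    exact LinearMap.congr_fun this (toPoly v)
  comm i j h := by
    refine LinearMap.ext fun v => toPoly_injective ?_
    obtain ⟨l, rfl⟩ := exists_lo_succIdx (p := j) (by omega)
    by_cases hi : (i : ℕ) = 0
    · simp only [Module.End.mul_apply, toPoly_opN, opF_zero D hi, opF_hi]
      rw [succIdx_val] at h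
      refine (op_op0 (q : R) ?_ ?_ _ _ _ _).symm <;>
        rw [Ne, Fin.ext_iff] <;> simp only [lo_val, succIdx_val] <;> omega
    · obtain ⟨k, rfl⟩ := exists_lo_succIdx hi
      simp only [Module.End.mul_apply, toPoly_opN, opF_hi]
      rw [succIdx_val, succIdx_val] at h
      refine LinearMap.congr_fun (op_comm (q : R) (lo_ne k) (lo_ne l) ?_ ?_ ?_ ?_
        (D.t_comm k l (by omega))) (toPoly v) <;>
        rw [Ne, Fin.ext_iff] <;> simp only [lo_val, succIdx_val] <;> omega
  quad i hi := by
    refine LinearMap.ext fun v => toPoly_injective ?_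
    obtain ⟨k, rfl⟩ := exists_lo_succIdx hi
    have := op_sq (q : R) (lo_ne k) (D.t_sq k) (toPoly v)
    simp only [Module.End.mul_apply, LinearMap.add_apply, LinearMap.smul_apply,
      Module.End.one_apply, map_add, map_smul, toPoly_opN, opF_hi]
    exact this
  cyc i hi := by
    refine LinearMap.ext fun v => toPoly_injective ?_
    have h1 := aeval_intertwine toPoly (X := opN D i) (X' := opF D i)
      (toPoly_opN D i) (∏ k, (Polynomial.X - Polynomial.C (u k))) v
    rw [h1, opF_zero D hi, aeval_op0 (prod_monic u) (prod_natDegree u)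
      (trunc_pred.ge (toPoly_mem v)), LinearMap.zero_apply, map_zero]

/-- The representation of `H` on truncated polynomials; it will turn out to be the regular one. -/
noncomputable def rep : H r q u →ₐ[R] Module.End R (Trunc R (Fin r) E m) := liftH (isAK_opN D)

theorem rep_T (p : Fin r) (v : Trunc R (Fin r) E m) :
    toPoly (rep D (T q u p) v) = opF D p (toPoly v) := by
  rw [rep, liftH_T, toPoly_opN]

theorem rep_G (i : Fin (r - 1)) (v : Trunc R (Fin r) E m) :
    toPoly (rep D (G q u i) v) =
      op (q : R) (lo i) (succIdx i) (D.t i) (toPoly v) := by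
  rw [G, rep_T, opF_hi]

theorem rep_j (e e' : E) : rep D (D.j e) (ns R m 0 e') = ns R m 0 (e * e') := by
  have he : e ∈ Algebra.adjoin R (Set.range D.t) := by rw [D.adjoin_t]; trivial
  induction he using Algebra.adjoin_induction generalizing e' with
  | mem x hx =>
    obtain ⟨i, rfl⟩ := hx
    refine toPoly_injective ?_
    rw [D.j_t, rep_G, toPoly_ns_zero, toPoly_ns_zero,
      op_single_of_eq (q : R) (p := lo i) (p' := succIdx i) (c := 0) rfl]
  | algebraMap c =>
    rw [AlgHom.commutes, AlgHom.commutes, Module.algebraMap_end_apply]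
    refine toPoly_injective ?_
    rw [map_smul, toPoly_ns_zero, toPoly_ns_zero, Finsupp.smul_single, Algebra.smul_def]
  | add x y hx hy ihx ihy =>
    rw [map_add, map_add, LinearMap.add_apply, ihx, ihy]
    refine toPoly_injective ?_
    rw [map_add, toPoly_ns_zero, toPoly_ns_zero, toPoly_ns_zero, ← Finsupp.single_add, add_mul]
  | mul x y hx hy ihx ihy =>
    rw [map_mul, map_mul, Module.End.mul_apply, ihy, ihx, ← mul_assoc]

theorem rep_rmul (x : H r q u) (e : E) {v v' : Trunc R (Fin r) E m} (hv : toPoly v' = rmul R e (toPoly v)) :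
    toPoly (rep D x v') = rmul R e (toPoly (rep D x v)) := by
  have hx : x ∈ Algebra.adjoin R (Set.range (T (r := r) q u)) := by rw [adjoin_T]; trivial
  induction hx using Algebra.adjoin_induction generalizing v v' with
  | mem x hx =>
    obtain ⟨p, rfl⟩ := hx
    rw [rep_T, rep_T, hv]
    by_cases h : (p : ℕ) = 0
    · rw [opF_zero D h, op0_rmul]
    · obtain ⟨i, rfl⟩ := exists_lo_succIdx h
      rw [opF_hi, op_rmul]
  | algebraMap c =>
    rw [AlgHom.commutes, Module.algebraMap_end_apply, Module.algebraMap_end_apply,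
      map_smul, map_smul, map_smul, hv]
  | add x y _ _ ihx ihy =>
    rw [map_add, LinearMap.add_apply, LinearMap.add_apply, map_add, map_add,
      map_add, ihx hv, ihy hv]
  | mul x y _ _ ihx ihy =>
    rw [map_mul, Module.End.mul_apply, Module.End.mul_apply]
    exact ihx (ihy hv)

/-- The coefficient of `(L_1 ⋯ L_r)^{m-1}`; a Frobenius homomorphism `H → ℋ(𝔖_r)`. -/
noncomputable def Phi : H r q u →ₗ[R] E :=
  Finsupp.lapply (topExp m r) ∘ₗ toPoly ∘ₗ
    LinearMap.applyₗ (ns R m (0 : Fin r → ℕ) (1 : E)) ∘ₗ (rep D).toLinearMap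

theorem Phi_apply (x : H r q u) :
    Phi D x = toPoly (rep D x (ns R m 0 1)) (topExp m r) := rfl

theorem Phi_mul_j (x : H r q u) (h : E) : Phi D (x * D.j h) = Phi D x * h := by
  have e : toPoly (ns R m (0 : Fin r → ℕ) (h * 1)) =
      rmul R h (toPoly (ns R m (0 : Fin r → ℕ) (1 : E))) := by
    rw [toPoly_ns_zero, toPoly_ns_zero, rmul_single, one_mul, mul_one]
  rw [Phi_apply, map_mul, Module.End.mul_apply, rep_j, Phi_apply,
    rep_rmul D x h (v := ns R m 0 1) e]
  simp [rmul]

theorem Phi_j_mul (h : E) (x : H r q u) : Phi D (D.j h * x) = h * Phi D x := by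
  have hh : h ∈ Algebra.adjoin R (Set.range D.t) := by rw [D.adjoin_t]; trivial
  induction hh using Algebra.adjoin_induction generalizing x with
  | mem y hy =>
    obtain ⟨i, rfl⟩ := hy
    rw [Phi_apply, map_mul, Module.End.mul_apply, D.j_t, rep_G, op_top D i (toPoly_mem (rep D x _)),
      Phi_apply]
  | algebraMap c => rw [AlgHom.commutes, ← Algebra.smul_def, map_smul, Algebra.smul_def]
  | add y z hy hz ihy ihz => rw [map_add D.j, add_mul, map_add, ihy, ihz, ← add_mul]
  | mul y z hy hz ihy ihz => rw [map_mul D.j, mul_assoc, ihy, ihz, ← mul_assoc]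

end Representation


/-! ### The action of the Jucys–Murphy elements -/

section Exponents

variable {R : Type*} [CommRing R] {ι : Type*} [DecidableEq ι]
  {E : Type*} [Ring E] [Algebra R E]

theorem exponent_induction [Fintype ι] {P : (ι → ℕ) → Prop} (h0 : P 0)
    (hs : ∀ c k, P c → P (c + Pi.single k 1)) (c : ι → ℕ) : P c := by
  have key : ∀ s : Finset ι, P fun k => if k ∈ s then c k else 0 := by
    intro s
    induction s using Finset.induction_on with
    | empty => exact h0
    | insert p s hp ih =>
      have h1 : ∀ n, P ((fun k => if k ∈ s then c k else 0) + Pi.single p n) := by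
        intro n
        induction n with
        | zero => simpa using ih
        | succ n ihn => rw [Pi.single_add, ← add_assoc]; exact hs _ _ ihn
      convert h1 (c p) using 1
      ext k
      by_cases hk : k = p
      · subst hk; simp [hp]
      · simp [hk]
  simpa using key Finset.univ

theorem op_single_mem {q : R} {p p' : ι} {t : E} {W : Submodule R (Poly ι E)} {c : ι → ℕ} {h : E}
    (h0 : Finsupp.single (setTwo c p p' (c p') (c p)) (t * h) ∈ W)
    (h1 : ∀ k < c p' - c p, Finsupp.single (setTwo c p p' (c p + k) (c p' - k)) h ∈ W)
    (h2 : ∀ k < c p - c p', Finsupp.single (setTwo c p p' (c p' + k) (c p - k)) h ∈ W) :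
    op q p p' t (Finsupp.single c h) ∈ W := by
  rw [op_single, comp_swap_eq]
  exact W.add_mem h0 (W.smul_mem _ (W.sub_mem
    (W.sum_mem fun k hk => h1 k (Finset.mem_range.mp hk))
    (W.sum_mem fun k hk => h2 k (Finset.mem_range.mp hk))))

theorem op0_mem_supported {p k : ι} (hk : k ≠ p) (n l : ℕ) (f : Polynomial R) {v : Poly ι E}
    (hv : v ∈ Finsupp.supported E R {c | c k < l}) :
    op0 p n f v ∈ Finsupp.supported E R {c | c k < l} := by
  have hX : ∀ v ∈ Finsupp.supported E R {c : ι → ℕ | c k < l},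
      mulX R E p v ∈ Finsupp.supported E R {c | c k < l} := fun v hv =>
    map_mem_of_single (fun c hc h => by
      rw [mulX_single]
      refine Finsupp.single_mem_supported R h ?_
      simpa [hk] using hc) hv
  rw [op0_apply]
  refine Submodule.sub_mem _ (hX v hv) ?_
  have ht : tk R p n v ∈ Finsupp.supported E R {c | c k < l} :=
    map_mem_of_single (fun c hc h => by
      rw [tk_single]
      split_ifs
      · refine Finsupp.single_mem_supported R h ?_
        simpa [hk] using hc
      · exact Submodule.zero_mem _) hv
  rw [evX, Polynomial.aeval_eq_sum_range, LinearMap.sum_apply]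
  refine Submodule.sum_mem _ fun i hi => Submodule.smul_mem _ _ ?_
  clear hi
  induction i with
  | zero => exact ht
  | succ i ih => rw [pow_succ', Module.End.mul_apply]; exact hX _ ih

end Exponents

section Monomials

open MvPolynomial

variable {R : Type*} [CommRing R] {r : ℕ}

variable (R) in
/-- The monomial with exponent `c`. -/
noncomputable def mon (c : Fin r → ℕ) : MvPolynomial (Fin r) R := ∏ p, X p ^ c p

theorem mon_zero : mon R (0 : Fin r → ℕ) = 1 := by simp [mon]

theorem mon_add (c d : Fin r → ℕ) : mon R (c + d) = mon R c * mon R d := by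
  simp [mon, pow_add, Finset.prod_mul_distrib]

theorem mon_single (p : Fin r) (n : ℕ) : mon R (Pi.single p n) = X p ^ n := by
  rw [mon, Finset.prod_eq_single p]
  · simp
  · intro b _ hb; simp [hb]
  · simp

theorem mon_add_single (c : Fin r → ℕ) (p : Fin r) :
    mon R (c + Pi.single p 1) = X p * mon R c := by
  rw [mon_add, mon_single, pow_one, mul_comm]

end Monomials

section OfPoly

open MvPolynomial

variable {R : Type*} [CommRing R] {m r : ℕ} {q : Rˣ} {u : Fin m → R}
  {E : Type*} [Ring E] [Algebra R E] (D : HeckeModel r q u E)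

/-- The value of a polynomial with coefficients in `ℋ(𝔖_r)` at the elements `L_1, …, L_r`. -/
noncomputable def ofPoly : Poly (Fin r) E →ₗ[R] H r q u :=
  Finsupp.lsum R fun c => LinearMap.mulLeft R (ev q u (mon R c)) ∘ₗ D.j.toLinearMap

theorem ofPoly_single (c : Fin r → ℕ) (h : E) :
    ofPoly D (Finsupp.single c h) = ev q u (mon R c) * D.j h := by
  simp [ofPoly]

theorem ofPoly_mulX (p : Fin r) (v : Poly (Fin r) E) :
    ofPoly D (mulX R E p v) = J q u p * ofPoly D v := by
  refine LinearMap.congr_fun (f := ofPoly D ∘ₗ mulX R E p)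
    (g := LinearMap.mulLeft R (J q u p) ∘ₗ ofPoly D) (Finsupp.lhom_ext fun c h => ?_) v
  simp only [LinearMap.comp_apply, mulX_single, ofPoly_single, LinearMap.mulLeft_apply,
    mon_add_single, map_mul, ev_X, mul_assoc]

theorem ofPoly_op (i : Fin (r - 1)) (v : Poly (Fin r) E) :
    ofPoly D (op (q : R) (lo i) (succIdx i) (D.t i) v) = G q u i * ofPoly D v := by
  have : ofPoly D ∘ₗ op (q : R) (lo i) (succIdx i) (D.t i) -
      LinearMap.mulLeft R (G q u i) ∘ₗ ofPoly D = 0 := by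
    refine eq_zero_of_mulX (fun k => ?_) fun h => ?_
    · by_cases h1 : k = lo i
      · subst h1
        refine ⟨LinearMap.mulLeft R (J q u (succIdx i)), fun v => ?_⟩
        simp only [LinearMap.sub_apply, LinearMap.comp_apply, LinearMap.mulLeft_apply,
          op_mulX_lo (q : R) (lo_ne i), map_sub, map_smul, ofPoly_mulX, ← mul_assoc, G_mul_J_lo,
          sub_mul, smul_mul_assoc]
        abel
      by_cases h2 : k = succIdx i
      · subst h2
        refine ⟨LinearMap.mulLeft R (J q u (lo i)), fun v => ?_⟩
        simp only [LinearMap.sub_apply, LinearMap.comp_apply, LinearMap.mulLeft_apply,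
          op_mulX_hi (q : R) (lo_ne i), map_add, map_smul, ofPoly_mulX, ← mul_assoc, G_mul_J_hi,
          add_mul, mul_sub, smul_mul_assoc]
        abel
      · refine ⟨LinearMap.mulLeft R (J q u k), fun v => ?_⟩
        simp only [LinearMap.sub_apply, LinearMap.comp_apply, LinearMap.mulLeft_apply,
          op_mulX_ne (q : R) h1 h2, ofPoly_mulX, ← mul_assoc, ← (J_comm_G q u h1 h2).eq, mul_sub]
    · simp only [LinearMap.sub_apply, LinearMap.comp_apply, LinearMap.mulLeft_apply,
        op_single_of_eq (q : R) (p := lo i) (p' := succIdx i) (c := 0) rfl, ofPoly_single,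
        mon_zero, map_one, one_mul, map_mul, D.j_t, sub_self]
  exact sub_eq_zero.mp (LinearMap.congr_fun this v)

theorem ofPoly_op0 {p : Fin r} (hp : (p : ℕ) = 0) (n : ℕ) (v : Poly (Fin r) E) :
    ofPoly D (op0 p n (∏ k, (Polynomial.X - Polynomial.C (u k))) v) = J q u p * ofPoly D v := by
  have h1 := aeval_intertwine (ofPoly D) (X := mulX R E p)
    (X' := Algebra.lmul R (H r q u) (J q u p)) (ofPoly_mulX D p)
    (∏ k, (Polynomial.X - Polynomial.C (u k))) (tk R p n v)
  rw [Polynomial.aeval_algHom_apply, J_zero q u p hp, (isAK_T q u).cyc p hp, map_zero,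
    LinearMap.zero_apply] at h1
  rw [op0_apply, map_sub, ofPoly_mulX, evX, h1, sub_zero]

variable [NeZero m] [Nontrivial R]

theorem ofPoly_rep (x : H r q u) (v : Trunc R (Fin r) E m) :
    ofPoly D (toPoly (rep D x v)) = x * ofPoly D (toPoly v) := by
  have hx : x ∈ Algebra.adjoin R (Set.range (T (r := r) q u)) := by rw [adjoin_T]; trivial
  induction hx using Algebra.adjoin_induction generalizing v with
  | mem x hx =>
    obtain ⟨p, rfl⟩ := hx
    rw [rep_T]
    by_cases h : (p : ℕ) = 0
    · rw [opF_zero D h, ofPoly_op0 D h, J_zero q u p h]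
    · obtain ⟨i, rfl⟩ := exists_lo_succIdx h
      rw [opF_hi, ofPoly_op, G]
  | algebraMap c =>
    rw [AlgHom.commutes, Module.algebraMap_end_apply, map_smul, map_smul, Algebra.smul_def]
  | add x y _ _ ihx ihy =>
    rw [map_add, LinearMap.add_apply, map_add, map_add, ihx, ihy, add_mul]
  | mul x y _ _ ihx ihy => rw [map_mul, Module.End.mul_apply, ihx, ihy, mul_assoc]

/-- The vector `1` is cyclic with trivial annihilator. -/
theorem ofPoly_rep_one (x : H r q u) : ofPoly D (toPoly (rep D x (ns R m 0 1))) = x := by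
  rw [ofPoly_rep, toPoly_ns_zero, ofPoly_single, mon_zero]
  simp

/-- As long as no exponent gets too large, `L_p` acts by multiplication with `X_p`. -/
theorem rep_J (p : Fin r) (v : Trunc R (Fin r) E m)
    (hv : toPoly v ∈ Finsupp.supported E R {c | c p + 1 < m}) :
    toPoly (rep D (J q u p) v) = mulX R E p (toPoly v) := by
  induction p using pos_induction generalizing v with
  | h0 p hp =>
    rw [J_zero q u p hp, rep_T, opF_zero D hp]
    refine eqOn_of_single (fun c hc h => ?_) hv
    have hc' : c p + 1 < m := hc
    rw [op0_single_of_ne _ (by omega), mulX_single]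
  | hs i ih =>
    have h1 : toPoly (rep D (G q u i) v) ∈ Finsupp.supported E R {c | c (lo i) + 1 < m} := by
      have hv' : toPoly v ∈ Finsupp.supported E R
          ({c | ∀ k, c k < m} ∩ {c | c (succIdx i) + 1 < m}) := by
        rw [Finsupp.supported_inter]
        exact ⟨toPoly_mem v, hv⟩
      rw [rep_G]
      refine map_mem_of_single (fun c hc h => op_single_mem ?_ (fun k hk => ?_) fun k hk => ?_) hv'
      all_goals
        have hc1 := hc.1 (lo i)
        have hc2 : c (succIdx i) + 1 < m := hc.2
        refine Finsupp.single_mem_supported R _ ?_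
        rw [Set.mem_ofPred_eq, setTwo_lo c (lo_ne i)]
        omega
    rw [J_hi, map_smul, LinearMap.smul_apply, map_smul, map_mul, map_mul, Module.End.mul_apply,
      Module.End.mul_apply, rep_G, ih _ h1, rep_G, op_mulX_op (q : R) (lo_ne i) (D.t_sq i),
      smul_smul, Units.inv_mul, one_smul]

theorem rep_G_mem {k : Fin r} {i : Fin (r - 1)} (h1 : k ≠ lo i) (h2 : k ≠ succIdx i) (l : ℕ)
    {v : Trunc R (Fin r) E m} (hv : toPoly v ∈ Finsupp.supported E R {c | c k < l}) :
    toPoly (rep D (G q u i) v) ∈ Finsupp.supported E R {c | c k < l} := by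
  rw [rep_G]
  refine op_mem_supported _ _ _ _ (fun c hc a b _ _ _ => ?_) hv
  rw [Set.mem_ofPred_eq, setTwo_of_ne c h1 h2]
  exact hc

/-- The action of `L_p` does not involve the exponents of the later variables. -/
theorem rep_J_mem {p k : Fin r} (hk : p < k) (l : ℕ) {v : Trunc R (Fin r) E m}
    (hv : toPoly v ∈ Finsupp.supported E R {c | c k < l}) :
    toPoly (rep D (J q u p) v) ∈ Finsupp.supported E R {c | c k < l} := by
  induction p using pos_induction generalizing v with
  | h0 p hp =>
    rw [J_zero q u p hp, rep_T, opF_zero D hp]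
    exact op0_mem_supported hk.ne' _ _ _ hv
  | hs i ih =>
    have h1 : k ≠ lo i := ((lo_lt i).trans hk).ne'
    rw [J_hi, map_smul, LinearMap.smul_apply, map_smul, map_mul, map_mul, Module.End.mul_apply,
      Module.End.mul_apply]
    exact Submodule.smul_mem _ _ (rep_G_mem D h1 hk.ne' l
      (ih ((lo_lt i).trans hk) (rep_G_mem D h1 hk.ne' l hv)))

theorem rep_mon_single (c d : Fin r → ℕ) (h : E) (hcd : ∀ k, d k + c k < m) :
    rep D (ev q u (mon R d)) (ns R m c h) = ns R m (d + c) h := by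
  induction d using exponent_induction with
  | h0 => rw [mon_zero, map_one, map_one, zero_add]; rfl
  | hs d k ih =>
    have h1 : ∀ j, d j + c j < m := fun j => by
      have := hcd j
      rw [Pi.add_apply] at this
      omega
    have h2 : (d + c) k + 1 < m := by simpa [add_right_comm] using hcd k
    rw [mon_add_single, map_mul, map_mul, Module.End.mul_apply, ih h1, ev_X]
    refine toPoly_injective ?_
    rw [rep_J, toPoly_ns R (c := d + c) h1,
      toPoly_ns R (c := d + Pi.single k 1 + c) hcd, mulX_single, add_right_comm]
    rw [toPoly_ns R (c := d + c) h1]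
    exact Finsupp.single_mem_supported R h h2

theorem rep_mon_mem {d : Fin r → ℕ} {k : Fin r} (hd : ∀ j, k ≤ j → d j = 0) (l : ℕ)
    {v : Trunc R (Fin r) E m} (hv : toPoly v ∈ Finsupp.supported E R {c | c k < l}) :
    toPoly (rep D (ev q u (mon R d)) v) ∈ Finsupp.supported E R {c | c k < l} := by
  induction d using exponent_induction with
  | h0 => rw [mon_zero, map_one, map_one]; exact hv
  | hs d p ih =>
    have hp : p < k := by
      by_contra hcon
      have := hd p (not_lt.mp hcon)
      simp at this
    rw [mon_add_single, map_mul, map_mul, Module.End.mul_apply, ev_X]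
    refine rep_J_mem D hp l (ih fun j hj => ?_)
    have := hd j hj
    rw [Pi.add_apply] at this
    omega

/-- Triangularity of the pairing of monomials: the variables from `k` on act by shifting the
exponents, and the earlier ones do not raise the exponent at `k`. -/
theorem rep_mon_top_eq_zero {c d : Fin r → ℕ} (h : E) {k : Fin r} (hk : d k + c k + 1 < m)
    (hj : ∀ j, k < j → d j + c j < m) :
    toPoly (rep D (ev q u (mon R d)) (ns R m c h)) (topExp m r) = 0 := by
  classical
  by_cases hc : ∀ j, c j < m
  · set d1 : Fin r → ℕ := fun j => if j < k then d j else 0 with hd1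
    set d2 : Fin r → ℕ := fun j => if j < k then 0 else d j with hd2
    have hd : d = d1 + d2 := by
      ext j
      simp only [hd1, hd2, Pi.add_apply]
      split_ifs <;> simp
    have h2 : ∀ j, d2 j + c j < m := fun j => by
      simp only [hd2]
      split_ifs with hjk
      · simpa using hc j
      · rcases (not_lt.mp hjk).eq_or_lt with rfl | h'
        · omega
        · exact hj j h'
    have h3 := rep_mon_mem D (d := d1) (k := k) (fun j hj => if_neg (not_lt.mpr hj)) (m - 1)
      (v := ns R m (d2 + c) h) (by
        rw [toPoly_ns R (c := d2 + c) h2]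
        refine Finsupp.single_mem_supported R h ?_
        have : d2 k = d k := if_neg (lt_irrefl k)
        rw [Set.mem_ofPred_eq, Pi.add_apply, this]
        omega)
    rw [hd, mon_add, map_mul, map_mul, Module.End.mul_apply, rep_mon_single D c d2 h h2]
    by_contra hcon
    have := h3 (Finsupp.mem_support_iff.mpr hcon)
    simp [topExp] at this
  · rw [ns, dif_neg hc]
    simp

end OfPoly


/-! ### Nondegeneracy of the Frobenius form -/

section Nondegenerate

open MvPolynomial

variable {R : Type*} [CommRing R] {m r : ℕ} {q : Rˣ} {u : Fin m → R}
  {E : Type*} [Ring E] [Algebra R E] (D : HeckeModel r q u E)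

theorem eq_sum_ns (v : Trunc R (Fin r) E m) :
    v = ∑ c ∈ (toPoly v).support, ns R m c (toPoly v c) := by
  refine toPoly_injective ?_
  rw [map_sum]
  conv_lhs => rw [← Finsupp.sum_single (toPoly v), Finsupp.sum]
  refine Finset.sum_congr rfl fun c hc => ?_
  rw [toPoly_ns]
  exact toPoly_mem v hc

theorem range_j : D.j.range = Hfin r q u := by
  rw [← Algebra.map_top, ← D.adjoin_t, AlgHom.map_adjoin, Hfin, ← Set.range_comp]
  congr 2
  ext i
  exact D.j_t i

theorem exists_j_eq {x : H r q u} (hx : x ∈ Hfin r q u) : ∃ h, D.j h = x := by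
  rw [← range_j D] at hx
  exact hx

variable [NeZero m] [Nontrivial R]

theorem Phi_apply_mul (x y : H r q u) :
    Phi D (x * y) = toPoly (rep D x (rep D y (ns R m 0 1))) (topExp m r) := by
  rw [Phi_apply, map_mul, Module.End.mul_apply]

theorem topExp_lt (k : Fin r) : topExp m r k < m := Nat.pred_lt (NeZero.ne m)

/-- If the last exponent in which two truncated monomials differ is smaller in `d` than in `c`, then
multiplication by the monomial complementary to `c` kills the top coefficient of `X^d`. -/
theorem eq_zero_of_Phi_mul_left {x : H r q u} (hx : ∀ y, Phi D (y * x) = 0) : x = 0 := by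
  set v := rep D x (ns R m 0 1) with hv
  have hv0 : toPoly v = 0 := by
    by_contra hne
    have hS : (toPoly v).support.Nonempty := Finsupp.support_nonempty_iff.mpr hne
    -- a monomial of `v` that is maximal for the comparison of the last different exponent
    obtain ⟨c, hc, hmax⟩ := Finset.exists_max_image (toPoly v).support
      (fun c => toLex (fun i : Fin r => c i.rev)) hS
    have hcm : ∀ k, c k < m := toPoly_mem v hc
    have h1 := hx (ev q u (mon R (topExp m r - c)))
    rw [Phi_apply_mul, ← hv, eq_sum_ns v, map_sum, map_sum, Finsupp.finsetSum_apply,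
      Finset.sum_eq_single_of_mem c hc, rep_mon_single, tsub_add_cancel_of_le, toPoly_ns,
      Finsupp.single_eq_same] at h1
    · exact Finsupp.mem_support_iff.mp hc h1
    · exact topExp_lt
    · exact fun k => Nat.le_pred_of_lt (hcm k)
    · intro k
      have := hcm k
      simp only [topExp, Pi.sub_apply]
      omega
    · intro d hd hdc
      have hlt : toLex (fun i : Fin r => d i.rev) < toLex (fun i : Fin r => c i.rev) := by
        refine lt_of_le_of_ne (hmax d hd) fun heq => hdc ?_
        have := toLex.injective heq
        ext i
        simpa using congrFun this i.rev
      obtain ⟨i, hi1, hi2⟩ := hlt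
      refine rep_mon_top_eq_zero D _ (k := i.rev) ?_ fun j hj => ?_
      · have h2 : d i.rev < c i.rev := hi2
        have h3 := hcm i.rev
        simp only [topExp, Pi.sub_apply]
        omega
      · have h2 := hi1 j.rev (show j.rev < i by rwa [← Fin.rev_lt_rev, Fin.rev_rev])
        have h2' : d j = c j := by simpa using h2
        have h3 := hcm j
        simp only [topExp, Pi.sub_apply]
        omega
  rw [← ofPoly_rep_one D x, ← hv, hv0, map_zero]

theorem Phi_j_mul_mon {c : Fin r → ℕ} (hc : ∀ k, c k < m) (h : E) :
    Phi D (D.j h * ev q u (mon R c)) = h * (Finsupp.single c (1 : E) (topExp m r)) := by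
  rw [Phi_j_mul, Phi_apply, rep_mon_single D 0 c 1 (by simpa using hc), add_zero, toPoly_ns R hc]

/-- The kernel of the Frobenius homomorphism is stable under the anti-automorphism that fixes the
generators. -/
theorem Phi_st_eq_zero {x : H r q u} (hx : Phi D x = 0) : Phi D (st q u x) = 0 := by
  set v := toPoly (rep D x (ns R m 0 1)) with hv
  have hvx : ofPoly D v = x := ofPoly_rep_one D x
  have hvt : v (topExp m r) = 0 := hx
  have hstx : st q u x = ∑ c ∈ v.support, st q u (ev q u (mon R c) * D.j (v c)) := by
    have hst : ∀ s : Finset (Fin r → ℕ), st q u (∑ c ∈ s, ev q u (mon R c) * D.j (v c)) =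
        ∑ c ∈ s, st q u (ev q u (mon R c) * D.j (v c)) := by
      intro s
      induction s using Finset.induction_on with
      | empty => simp [st_zero]
      | insert c s hc ih => rw [Finset.sum_insert hc, Finset.sum_insert hc, st_add, ih]
    rw [← hst, ← hvx]
    rfl
  rw [hstx, map_sum]
  refine Finset.sum_eq_zero fun c hc => ?_
  have hcm : ∀ k, c k < m := toPoly_mem (rep D x (ns R m 0 1)) hc
  obtain ⟨h', hh'⟩ := exists_j_eq D (st_mem_Hfin q u (x := D.j (v c)) (by
    rw [← range_j D]; exact ⟨_, rfl⟩))
  rw [st_mul, st_ev, ← hh', Phi_j_mul_mon D hcm, Finsupp.single_apply, if_neg, mul_zero]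
  rintro rfl
  exact Finsupp.mem_support_iff.mp hc hvt

theorem eq_zero_of_Phi_mul_right {y : H r q u} (hy : ∀ x, Phi D (y * x) = 0) : y = 0 := by
  have h1 : st q u y = 0 := eq_zero_of_Phi_mul_left D fun x => by
    rw [← st_st q u x, ← st_mul]
    exact Phi_st_eq_zero D (hy _)
  rw [← st_st q u y, h1, st_zero]

end Nondegenerate

/-! ### The value of the Frobenius homomorphism at `v_a` -/

section Majorization

variable {R : Type*} [CommRing R] {ι : Type*} [DecidableEq ι] [Fintype ι]
  {E : Type*} [Ring E] [Algebra R E]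

/-- Exponents that are strictly majorized by a rearrangement of `γ`: for every `t` the total excess
`∑ max (c_j - t) 0` is at most that of `γ`, and the sum of squares is smaller. The latter excludes
the rearrangements of `γ`. -/
def below (γ : ι → ℕ) : Set (ι → ℕ) :=
  {c | (∀ t, ∑ j, (c j - t) ≤ ∑ j, (γ j - t)) ∧ ∑ j, c j ^ 2 < ∑ j, γ j ^ 2}

theorem sum_setTwo (φ : ℕ → ℕ) (c : ι → ℕ) {p p' : ι} (hp : p ≠ p') (a b : ℕ) :
    ∑ j, φ (setTwo c p p' a b j) + (φ (c p) + φ (c p')) = ∑ j, φ (c j) + (φ a + φ b) := by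
  have h : ∀ g : ι → ℕ, ∑ j, g j = g p + (g p' + ∑ j ∈ (Finset.univ.erase p).erase p', g j) := by
    intro g
    rw [← Finset.add_sum_erase Finset.univ g (Finset.mem_univ p), ← Finset.add_sum_erase
      (Finset.univ.erase p) g (Finset.mem_erase.mpr ⟨hp.symm, Finset.mem_univ p'⟩)]
  rw [h, h fun j => φ (c j), setTwo_lo c hp, setTwo_hi]
  have : ∑ j ∈ (Finset.univ.erase p).erase p', φ (setTwo c p p' a b j) =
      ∑ j ∈ (Finset.univ.erase p).erase p', φ (c j) := by
    refine Finset.sum_congr rfl fun j hj => ?_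
    rw [Finset.mem_erase, Finset.mem_erase] at hj
    rw [setTwo_of_ne c hj.2.1 hj.1]
  rw [this]
  ring

theorem sum_setTwo_sub_le (c : ι → ℕ) {p p' : ι} (hp : p ≠ p') {a b : ℕ}
    (hab : a + b = c p + c p') (ha : a ≤ max (c p) (c p')) (hb : b ≤ max (c p) (c p')) (t : ℕ) :
    ∑ j, (setTwo c p p' a b j - t) ≤ ∑ j, (c j - t) := by
  have := sum_setTwo (fun x => x - t) c hp a b
  omega

theorem sum_setTwo_sq_le (c : ι → ℕ) {p p' : ι} (hp : p ≠ p') {a b : ℕ}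
    (hab : a + b = c p + c p') (ha : a ≤ max (c p) (c p')) (hb : b ≤ max (c p) (c p')) :
    ∑ j, setTwo c p p' a b j ^ 2 ≤ ∑ j, c j ^ 2 := by
  have h1 := sum_setTwo (fun x => x ^ 2) c hp a b
  have h2 : a ^ 2 + b ^ 2 ≤ c p ^ 2 + c p' ^ 2 := by
    rcases le_total (c p) (c p') with h | h
    · rw [max_eq_right h] at ha hb
      obtain ⟨k, hk⟩ := Nat.exists_eq_add_of_le ha
      obtain rfl : b = c p + k := by omega
      rw [hk]; rw [hk] at hb
      nlinarith
    · rw [max_eq_left h] at ha hb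
      obtain ⟨k, hk⟩ := Nat.exists_eq_add_of_le ha
      obtain rfl : b = c p' + k := by omega
      rw [hk]; rw [hk] at hb
      nlinarith
  omega

theorem sum_setTwo_sq_lt (c : ι → ℕ) {p p' : ι} (hp : p ≠ p') {a b : ℕ}
    (hab : a + b = c p + c p') (ha : a < max (c p) (c p')) (hb : b < max (c p) (c p')) :
    ∑ j, setTwo c p p' a b j ^ 2 < ∑ j, c j ^ 2 := by
  have h1 := sum_setTwo (fun x => x ^ 2) c hp a b
  have h2 : a ^ 2 + b ^ 2 < c p ^ 2 + c p' ^ 2 := by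
    rcases le_total (c p) (c p') with h | h
    · rw [max_eq_right h] at ha hb
      obtain ⟨k, hk⟩ := Nat.exists_eq_add_of_lt ha
      obtain rfl : b = c p + k + 1 := by omega
      rw [hk]; rw [hk] at hb
      nlinarith
    · rw [max_eq_left h] at ha hb
      obtain ⟨k, hk⟩ := Nat.exists_eq_add_of_lt ha
      obtain rfl : b = c p' + k + 1 := by omega
      rw [hk]; rw [hk] at hb
      nlinarith
  omega

theorem op_mem_below (q : R) {p p' : ι} (hp : p ≠ p') (t : E) (γ : ι → ℕ) {v : Poly ι E}
    (hv : v ∈ Finsupp.supported E R (below γ)) :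
    op q p p' t v ∈ Finsupp.supported E R (below γ) :=
  op_mem_supported q p p' t (S := below γ) (fun c hc _ _ hab ha hb =>
    ⟨fun s => (sum_setTwo_sub_le c hp hab ha hb s).trans (hc.1 s),
      (sum_setTwo_sq_le c hp hab ha hb).trans_lt hc.2⟩) hv

omit [DecidableEq ι] in
theorem mem_below_of_le {c γ : ι → ℕ} (h : c ≤ γ) (hne : c ≠ γ) : c ∈ below γ := by
  refine ⟨fun t => Finset.sum_le_sum fun j _ => Nat.sub_le_sub_right (h j) t, ?_⟩
  obtain ⟨k, hk⟩ : ∃ k, c k < γ k := by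
    by_contra! hcon
    exact hne (le_antisymm h hcon)
  exact Finset.sum_lt_sum (fun j _ => Nat.pow_le_pow_left (h j) 2)
    ⟨k, Finset.mem_univ k, Nat.pow_lt_pow_left hk two_ne_zero⟩

omit [DecidableEq ι] in
theorem below_comp (γ : ι → ℕ) (e : Equiv.Perm ι) : below (γ ∘ e) = below γ := by
  ext c
  simp only [below, Function.comp_apply, Set.mem_ofPred_eq]
  have h1 : ∀ φ : ℕ → ℕ, ∑ j, φ (γ (e j)) = ∑ j, φ (γ j) := fun φ =>
    Equiv.sum_comp e fun j => φ (γ j)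
  have h2 := h1 fun x => x ^ 2
  have h3 : ∀ t, ∑ j, (γ (e j) - t) = ∑ j, (γ j - t) := fun t => h1 fun x => x - t
  simp only [h2, h3]

/-- Moving a larger exponent past a smaller one. -/
theorem op_single_sub_mem_below (q : R) {p p' : ι} (hp : p ≠ p') (t : E) {c : ι → ℕ}
    (hc : c p' ≤ c p) (h : E) : op q p p' t (Finsupp.single c h) -
      Finsupp.single (c ∘ Equiv.swap p p') ((if c p' = c p then t else t - algebraMap R E (q - 1)) * h)
        ∈ Finsupp.supported E R (below c) := by
  split_ifs with heq
  · have h1 : c ∘ Equiv.swap p p' = c := by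
      rw [comp_swap_eq, heq]
      nth_rw 2 [← heq]
      exact setTwo_self c p p'
    rw [op_single_of_eq q heq.symm, h1, sub_self]
    exact Submodule.zero_mem _
  · obtain ⟨n, hn⟩ : ∃ n, c p - c p' = n + 1 := ⟨c p - c p' - 1, by omega⟩
    have h0 : c p' - c p = 0 := by omega
    have h1 : op q p p' t (Finsupp.single c h) - Finsupp.single (c ∘ Equiv.swap p p')
        ((t - algebraMap R E (q - 1)) * h) = -((q - 1) •
          ∑ k ∈ Finset.range n, Finsupp.single (setTwo c p p' (c p' + (k + 1)) (c p - (k + 1))) h) := by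
      rw [op_single, dd, h0, hn, Finset.sum_range_succ', sub_mul, Finsupp.single_sub,
        ← Algebra.smul_def, ← Finsupp.smul_single, Finset.range_zero, Finset.sum_empty, zero_sub,
        comp_swap_eq, add_zero, Nat.sub_zero, smul_neg, smul_add]
      abel
    rw [h1]
    refine Submodule.neg_mem _ (Submodule.smul_mem _ _ (Submodule.sum_mem _ fun k hk => ?_))
    rw [Finset.mem_range] at hk
    exact Finsupp.single_mem_supported R h
      ⟨fun s => sum_setTwo_sub_le c hp (by omega) (by omega) (by omega) s,
        sum_setTwo_sq_lt c hp (by omega) (by omega) (by omega)⟩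

end Majorization


section Leading

open MvPolynomial

variable {R : Type*} [CommRing R] {m r : ℕ}

variable (R) in
/-- The span of the monomials that properly divide `X^α`. -/
noncomputable def lowSpan (α : Fin r → ℕ) : Submodule R (MvPolynomial (Fin r) R) :=
  Submodule.span R (mon R '' {δ | δ ≤ α ∧ δ ≠ α})

theorem mon_mem_lowSpan {δ α : Fin r → ℕ} (h : δ ≤ α) (hne : δ ≠ α) : mon R δ ∈ lowSpan R α :=
  Submodule.subset_span ⟨δ, ⟨h, hne⟩, rfl⟩

theorem le_add_single (α : Fin r → ℕ) (p : Fin r) : α ≤ α + Pi.single p 1 :=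
  fun _ => Nat.le_add_right _ _

theorem add_single_ne (α : Fin r → ℕ) (p : Fin r) {δ : Fin r → ℕ} (h : δ ≤ α) :
    δ ≠ α + Pi.single p 1 := by
  rintro rfl
  have := h p
  simp at this

theorem sub_mon_mem_lowSpan_mul {α : Fin r → ℕ} {f : MvPolynomial (Fin r) R}
    (hf : f - mon R α ∈ lowSpan R α) (p : Fin r) (a : R) :
    f * (X p - C a) - mon R (α + Pi.single p 1) ∈ lowSpan R (α + Pi.single p 1) := by
  have h1 : lowSpan R α ≤ lowSpan R (α + Pi.single p 1) := by
    refine Submodule.span_le.mpr ?_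
    rintro _ ⟨δ, ⟨hδ, -⟩, rfl⟩
    exact mon_mem_lowSpan (hδ.trans (le_add_single α p)) (add_single_ne α p hδ)
  have h2 : lowSpan R α ≤
      (lowSpan R (α + Pi.single p 1)).comap (LinearMap.mulLeft R (X p)) := by
    refine Submodule.span_le.mpr ?_
    rintro _ ⟨δ, ⟨hδ, hne⟩, rfl⟩
    have h : LinearMap.mulLeft R (X p) (mon R δ) = mon R (δ + Pi.single p 1) := by
      rw [LinearMap.mulLeft_apply, mon_add_single]
    rw [SetLike.mem_coe, Submodule.mem_comap, h]
    exact mon_mem_lowSpan (fun k => Nat.add_le_add_right (hδ k) _)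
      fun h => hne (add_right_cancel h)
  have h3 : f * (X p - C a) - mon R (α + Pi.single p 1) =
      X p * (f - mon R α) - a • (f - mon R α) - a • mon R α := by
    rw [mon_add_single]
    simp only [smul_eq_C_mul]
    ring
  rw [h3]
  exact Submodule.sub_mem _ (Submodule.sub_mem _ (h2 hf) (Submodule.smul_mem _ _ (h1 hf)))
    (Submodule.smul_mem _ _ (mon_mem_lowSpan (le_add_single α p) (add_single_ne α p le_rfl)))

theorem sub_mon_mem_lowSpan_mul_prod {α : Fin r → ℕ} {f : MvPolynomial (Fin r) R}
    (hf : f - mon R α ∈ lowSpan R α) (p : Fin r) (w : Fin m → R) (s : Finset (Fin m)) :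
    f * (∏ k ∈ s, (X p - C (w k))) - mon R (α + Pi.single p s.card) ∈
      lowSpan R (α + Pi.single p s.card) := by
  induction s using Finset.induction_on with
  | empty => simpa using hf
  | insert k s hk ih =>
    rw [Finset.prod_insert hk, Finset.card_insert_of_notMem hk, mul_comm (X p - C (w k)),
      ← mul_assoc, Pi.single_add, ← add_assoc]
    exact sub_mon_mem_lowSpan_mul ih p _

theorem PK_sub_mon_mem (w : Fin m → R) (K : Fin r → Finset (Fin m)) :
    PK w K - mon R (fun p => (K p).card) ∈ lowSpan R fun p => (K p).card := by
  have key : ∀ s : Finset (Fin r), (∏ p ∈ s, ∏ k ∈ K p, (X p - C (w k))) -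
      mon R (fun p => if p ∈ s then (K p).card else 0) ∈
        lowSpan R fun p => if p ∈ s then (K p).card else 0 := by
    intro s
    induction s using Finset.induction_on with
    | empty =>
      have : (fun p : Fin r => if p ∈ (∅ : Finset (Fin r)) then (K p).card else 0) = 0 := by
        ext; simp
      rw [this, mon_zero, Finset.prod_empty, sub_self]
      exact Submodule.zero_mem _
    | insert p s hp ih =>
      have : (fun p' => if p' ∈ insert p s then (K p').card else 0) =
          (fun p' => if p' ∈ s then (K p').card else 0) + Pi.single p (K p).card := by
        ext k
        by_cases hk : k = p
        · subst hk; simp [hp]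
        · simp [hk]
      rw [this, Finset.prod_insert hp, mul_comm]
      exact sub_mon_mem_lowSpan_mul_prod ih p w (K p)
  have h := key Finset.univ
  simp only [Finset.mem_univ, if_true] at h
  exact h

end Leading

section LeadingTerm

open MvPolynomial

variable {R : Type*} [CommRing R] {m r : ℕ} {q : Rˣ} {u : Fin m → R}
  {E : Type*} [Ring E] [Algebra R E] (D : HeckeModel r q u E)

theorem HeckeModel.t_mul (i : Fin (r - 1)) :
    D.t i * (D.t i - algebraMap R E ((q : R) - 1)) = algebraMap R E q ∧
      (D.t i - algebraMap R E ((q : R) - 1)) * D.t i = algebraMap R E q := by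
  constructor
  · rw [mul_sub, D.t_sq, ← Algebra.commutes, ← Algebra.smul_def, add_sub_cancel_left,
      Algebra.algebraMap_eq_smul_one]
  · rw [sub_mul, D.t_sq, ← Algebra.smul_def, add_sub_cancel_left, Algebra.algebraMap_eq_smul_one]

theorem HeckeModel.isUnit_t (i : Fin (r - 1)) : IsUnit (D.t i) := by
  have hq : IsUnit (algebraMap R E q) := q.isUnit.map _
  obtain ⟨h1, h2⟩ := D.t_mul i
  obtain ⟨b, hb⟩ := isUnit_iff_exists.mp hq
  refine isUnit_iff_exists_and_exists.mpr
    ⟨⟨(D.t i - algebraMap R E ((q : R) - 1)) * b, ?_⟩,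
      ⟨b * (D.t i - algebraMap R E ((q : R) - 1)), ?_⟩⟩
  · rw [← mul_assoc, h1, hb.1]
  · rw [mul_assoc, h2, hb.2]

theorem HeckeModel.isUnit_t_sub (i : Fin (r - 1)) :
    IsUnit (D.t i - algebraMap R E ((q : R) - 1)) := by
  have hq : IsUnit (algebraMap R E q) := q.isUnit.map _
  obtain ⟨h1, h2⟩ := D.t_mul i
  obtain ⟨b, hb⟩ := isUnit_iff_exists.mp hq
  refine isUnit_iff_exists_and_exists.mpr ⟨⟨D.t i * b, ?_⟩, ⟨b * D.t i, ?_⟩⟩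
  · rw [← mul_assoc, h2, hb.1]
  · rw [mul_assoc, h1, hb.2]

theorem exists_lt_of_mem_below {γ c : Fin r → ℕ} (hγ : Monotone γ) (hc : c ∈ below γ) :
    ∃ k, c k < γ k ∧ ∀ j, k < j → c j = γ j := by
  have hne : ∃ k, c k ≠ γ k := by
    by_contra! hcon
    have h2 := hc.2
    simp [hcon] at h2
  obtain ⟨k, hk, hmax⟩ := Finset.exists_max_image (Finset.univ.filter fun k => c k ≠ γ k) id
    (by obtain ⟨k, hk⟩ := hne; exact ⟨k, by simpa using hk⟩)
  rw [Finset.mem_filter] at hk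
  have hj : ∀ j, k < j → c j = γ j := by
    intro j hj
    by_contra hcon
    exact absurd (hmax j (by simpa using hcon)) (not_le.mpr hj)
  refine ⟨k, lt_of_le_of_ne (not_lt.mp fun hlt => ?_) hk.2, hj⟩
  -- otherwise the total excess over `γ k` would be larger for `c` than for `γ`
  refine absurd (hc.1 (γ k)) (not_le.mpr (Finset.sum_lt_sum (fun j _ => ?_)
    ⟨k, Finset.mem_univ k, by omega⟩))
  rcases lt_or_ge k j with h | h
  · rw [hj j h]
  · have := hγ h
    omega

variable [NeZero m] [Nontrivial R]

theorem rep_Tw_mem_below (w : Equiv.Perm (Fin r)) (γ : Fin r → ℕ) (v : Trunc R (Fin r) E m)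
    (hv : toPoly v ∈ Finsupp.supported E R (below γ)) :
    toPoly (rep D (Tw q u w) v) ∈ Finsupp.supported E R (below γ) := by
  induction w using perm_induction with
  | h1 => rw [Tw_refl, map_one]; exact hv
  | hs w i h ih =>
    rw [Tw_s_trans q u h, map_mul, Module.End.mul_apply, rep_G]
    exact op_mem_below _ (lo_ne i) _ _ ih

/-- The leading term of `T_w X^β` for antitone `β`: in a length-increasing factorization of `T_w`
every factor meets an exponent whose entry at `lo i` is at least the one at `succIdx i`, so that it
moves the larger entry to the right and contributes `T_i` or `T_i - (q - 1) = q T_i⁻¹`. -/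
theorem exists_rep_Tw_single {β : Fin r → ℕ} (hβ : Antitone β) (hβm : ∀ k, β k < m)
    (w : Equiv.Perm (Fin r)) : ∃ a : E, IsUnit a ∧ ∀ h,
      toPoly (rep D (Tw q u w) (ns R m β h)) - Finsupp.single (β ∘ w) (a * h) ∈
        Finsupp.supported E R (below β) := by
  induction w using perm_induction with
  | h1 =>
    refine ⟨1, isUnit_one, fun h => ?_⟩
    rw [Tw_refl, map_one, Module.End.one_apply, toPoly_ns R hβm, one_mul, Equiv.coe_refl,
      Function.comp_id, sub_self]
    exact Submodule.zero_mem _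
  | hs w i hw ih =>
    obtain ⟨a, ha, ih⟩ := ih
    refine ⟨(if (β ∘ w) (succIdx i) = (β ∘ w) (lo i) then D.t i
      else D.t i - algebraMap R E ((q : R) - 1)) * a, ?_, fun h => ?_⟩
    · split_ifs
      · exact (D.isUnit_t i).mul ha
      · exact (D.isUnit_t_sub i).mul ha
    · have h1 := op_single_sub_mem_below (q : R) (lo_ne i) (D.t i) (c := β ∘ w) (hβ hw.le) (a * h)
      rw [below_comp, ← mul_assoc] at h1
      have h2 := op_mem_below (q : R) (lo_ne i) (D.t i) β (ih h)
      have h3 := Submodule.add_mem _ h2 h1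
      rw [map_sub, sub_add_sub_cancel] at h3
      rw [Tw_s_trans q u hw, map_mul, Module.End.mul_apply, rep_G]
      exact h3

theorem rep_ev_sub_mem_below {β : Fin r → ℕ} (hβm : ∀ k, β k < m) {f : MvPolynomial (Fin r) R}
    (hf : f - mon R β ∈ lowSpan R β) :
    toPoly (rep D (ev q u f) (ns R m 0 1)) - Finsupp.single β 1 ∈
      Finsupp.supported E R (below β) := by
  have h1 : ∀ g ∈ lowSpan R β, toPoly (rep D (ev q u g) (ns R m 0 1)) ∈
      Finsupp.supported E R (below β) := by
    intro g hg
    refine Submodule.span_induction (p := fun g _ => toPoly (rep D (ev q u g) (ns R m 0 1)) ∈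
      Finsupp.supported E R (below β)) ?_ ?_ ?_ ?_ hg
    · rintro _ ⟨δ, ⟨hδ, hne⟩, rfl⟩
      have hδm : ∀ k, δ k < m := fun k => (hδ k).trans_lt (hβm k)
      rw [rep_mon_single D 0 δ 1 (by simpa using hδm), add_zero, toPoly_ns R hδm]
      exact Finsupp.single_mem_supported R _ (mem_below_of_le hδ hne)
    · simp
    · intro x y _ _ hx hy
      rw [map_add, map_add, LinearMap.add_apply, map_add]
      exact Submodule.add_mem _ hx hy
    · intro c x _ hx
      rw [map_smul, map_smul, LinearMap.smul_apply, map_smul]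
      exact Submodule.smul_mem _ _ hx
  have h2 := h1 _ hf
  rwa [map_sub, map_sub, LinearMap.sub_apply, map_sub,
    rep_mon_single D 0 β 1 (by simpa using hβm), add_zero, toPoly_ns R hβm] at h2

theorem rep_mon_below_eq_zero {α γ δ : Fin r → ℕ} (hγ : Monotone γ)
    (hαγ : ∀ k, α k + γ k + 1 = m) (hδ : δ ≤ α) {v : Trunc R (Fin r) E m}
    (hv : toPoly v ∈ Finsupp.supported E R (below γ)) :
    toPoly (rep D (ev q u (mon R δ)) v) (topExp m r) = 0 := by
  rw [eq_sum_ns v, map_sum, map_sum, Finsupp.finsetSum_apply]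
  refine Finset.sum_eq_zero fun c hc => ?_
  obtain ⟨k, hk, hj⟩ := exists_lt_of_mem_below hγ (hv hc)
  refine rep_mon_top_eq_zero D _ (k := k) ?_ fun j hkj => ?_
  · have h1 : δ k ≤ α k := hδ k
    have h2 := hαγ k
    omega
  · have h1 : δ j ≤ α j := hδ j
    have h2 := hαγ j
    have h3 := hj j hkj
    omega

theorem rep_ev_top {α γ : Fin r → ℕ} (hγ : Monotone γ) (hαγ : ∀ k, α k + γ k + 1 = m)
    {f : MvPolynomial (Fin r) R} (hf : f - mon R α ∈ lowSpan R α) {v : Trunc R (Fin r) E m}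
    {h : E} (hv : toPoly v - Finsupp.single γ h ∈ Finsupp.supported E R (below γ)) :
    toPoly (rep D (ev q u f) v) (topExp m r) = h := by
  have hγm : ∀ k, γ k < m := fun k => by have := hαγ k; omega
  set v' := v - ns R m γ h with hv'
  have hvv : v = ns R m γ h + v' := by rw [hv']; abel
  have hv2 : toPoly v' ∈ Finsupp.supported E R (below γ) := by
    rw [hv', map_sub, toPoly_ns R hγm]; exact hv
  have h0 : toPoly (rep D (ev q u (mon R α)) v) (topExp m r) = h := by
    have hle : ∀ k, (α + γ) k < m := fun k => by have := hαγ k; rw [Pi.add_apply]; omega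
    rw [hvv, map_add, map_add, Finsupp.add_apply, rep_mon_below_eq_zero D hγ hαγ le_rfl hv2,
      add_zero, rep_mon_single D γ α h hle, toPoly_ns R hle]
    have : α + γ = topExp m r := by
      ext k
      have := hαγ k
      simp only [topExp, Pi.add_apply]
      omega
    rw [this, Finsupp.single_eq_same]
  have h1 : ∀ g ∈ lowSpan R α, toPoly (rep D (ev q u g) v) (topExp m r) = 0 := by
    intro g hg
    refine Submodule.span_induction
      (p := fun g _ => toPoly (rep D (ev q u g) v) (topExp m r) = 0) ?_ ?_ ?_ ?_ hg
    · rintro _ ⟨δ, ⟨hδ, hne⟩, rfl⟩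
      rw [hvv, map_add, map_add, Finsupp.add_apply, rep_mon_below_eq_zero D hγ hαγ hδ hv2, add_zero]
      obtain ⟨k, hk⟩ : ∃ k, δ k < α k := by
        by_contra! hcon
        exact hne (le_antisymm hδ hcon)
      refine rep_mon_top_eq_zero D h (k := k) ?_ fun j _ => ?_
      · have := hαγ k; omega
      · have h1 := hαγ j
        have h2 : δ j ≤ α j := hδ j
        omega
    · simp
    · intro x y _ _ hx hy
      rw [map_add, map_add, LinearMap.add_apply, map_add, Finsupp.add_apply, hx, hy, add_zero]
    · intro c x _ hx
      rw [map_smul, map_smul, LinearMap.smul_apply, map_smul, Finsupp.smul_apply, hx, smul_zero]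
  have h2 := h1 _ hf
  rwa [map_sub, map_sub, LinearMap.sub_apply, map_sub, Finsupp.sub_apply, h0, sub_eq_zero] at h2

theorem Datum.isUnit_Phi_vD {w : Fin m → R} {κ κ' : Fin r → Fin m} {w0 : Equiv.Perm (Fin r)}
    (hD : Datum u w κ κ' w0) : IsUnit (Phi D (vD q w κ κ' w0 : H r q u)) := by
  set α : Fin r → ℕ := fun p => (Finset.Ioi (κ p)).card with hα
  set β : Fin r → ℕ := fun p => (Finset.Ioi (κ' p)).card with hβ
  have hβv : ∀ p, β p = m - 1 - κ' p := fun p => Fin.card_Ioi _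
  have hαv : ∀ p, α p = m - 1 - κ p := fun p => Fin.card_Ioi _
  have hγv : ∀ p, (β ∘ w0) p = κ p := fun p => by
    rw [Function.comp_apply, hβv, hD.map_block, Fin.val_rev]
    have := (κ p).isLt
    omega
  have hβa : Antitone β := fun p p' h => by
    rw [hβv, hβv]
    have : (κ' p : ℕ) ≤ κ' p' := hD.mono' h
    omega
  have hm : 0 < m := Nat.pos_of_ne_zero (NeZero.ne m)
  have hβm : ∀ k, β k < m := fun k => by rw [hβv]; omega
  have hγ : Monotone (β ∘ w0) := fun p p' h => by
    rw [hγv, hγv]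
    exact hD.mono h
  have hαγ : ∀ k, α k + (β ∘ w0) k + 1 = m := fun k => by
    rw [hγv, hαv]
    have := (κ k).isLt
    omega
  obtain ⟨a, ha, hTw⟩ := exists_rep_Tw_single D hβa hβm w0
  have h1 := rep_ev_sub_mem_below D hβm (PK_sub_mon_mem (w ∘ Fin.rev) fun p => Finset.Ioi (κ' p))
  set v1 := rep D (ev q u (pp (w ∘ Fin.rev) κ')) (ns R m 0 (1 : E)) with hv1
  have h2 : toPoly (v1 - ns R m β 1) ∈ Finsupp.supported E R (below β) := by
    rw [map_sub, toPoly_ns R hβm]; exact h1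
  have h3 := Submodule.add_mem _ (rep_Tw_mem_below D w0 β _ h2) (hTw 1)
  rw [map_sub, map_sub, sub_add_sub_cancel, ← below_comp β w0, mul_one] at h3
  have h4 := rep_ev_top D hγ hαγ (PK_sub_mon_mem w fun p => Finset.Ioi (κ p)) h3
  rw [vD, mul_assoc, Phi_apply_mul, map_mul, Module.End.mul_apply, ← hv1]
  exact h4.symm ▸ ha

end LeadingTerm


/-! ### Projectivity of principal right ideals -/

section Projective

variable {A : Type*} [Ring A]

/-- The regular right module is free. -/
def opEquiv (A : Type*) [Ring A] : Aᵐᵒᵖ ≃ₗ[Aᵐᵒᵖ] A where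
  toFun := MulOpposite.unop
  invFun := MulOpposite.op
  map_add' _ _ := rfl
  map_smul' _ _ := rfl
  left_inv _ := rfl
  right_inv _ := rfl

theorem projective_span_of_mul_eq {v y : A} (h : v * y * v = v) :
    Module.Projective Aᵐᵒᵖ (Submodule.span Aᵐᵒᵖ {v}) := by
  have : Module.Projective Aᵐᵒᵖ A := Module.Projective.of_equiv (opEquiv A)
  have hmem : ∀ x : A, v * x ∈ Submodule.span Aᵐᵒᵖ {v} := fun x =>
    Submodule.mem_span_singleton.mpr ⟨MulOpposite.op x, rfl⟩
  let f : A →ₗ[Aᵐᵒᵖ] Submodule.span Aᵐᵒᵖ {v} :=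
    { toFun := fun x => ⟨v * (y * x), hmem _⟩
      map_add' := fun a b => Subtype.ext (by simp only [mul_add, Submodule.coe_add])
      map_smul' := fun c a => Subtype.ext (by
        simp only [MulOpposite.smul_eq_mul_unop, RingHom.id_apply, Submodule.coe_smul, mul_assoc]) }
  refine Module.Projective.of_split (Submodule.subtype _) f (LinearMap.ext fun x => ?_)
  obtain ⟨x, hx⟩ := x
  obtain ⟨c, rfl⟩ := Submodule.mem_span_singleton.mp hx
  refine Subtype.ext ?_
  change v * (y * (v * c.unop)) = v * c.unop
  rw [← mul_assoc, ← mul_assoc, h]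

theorem exists_mul_eq_of_projective_span {v : A}
    (h : Module.Projective Aᵐᵒᵖ (Submodule.span Aᵐᵒᵖ {v})) :
    ∃ e, v * e = v ∧ ∀ x, v * x = 0 → e * x = 0 := by
  have hmem : ∀ x : A, v * x ∈ Submodule.span Aᵐᵒᵖ {v} := fun x =>
    Submodule.mem_span_singleton.mpr ⟨MulOpposite.op x, rfl⟩
  let f : A →ₗ[Aᵐᵒᵖ] Submodule.span Aᵐᵒᵖ {v} :=
    { toFun := fun x => ⟨v * x, hmem x⟩
      map_add' := fun a b => Subtype.ext (by simp only [mul_add, Submodule.coe_add])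
      map_smul' := fun c a => Subtype.ext (by
        simp only [MulOpposite.smul_eq_mul_unop, RingHom.id_apply, Submodule.coe_smul, mul_assoc]) }
  have hf : Function.Surjective f := by
    rintro ⟨x, hx⟩
    obtain ⟨c, rfl⟩ := Submodule.mem_span_singleton.mp hx
    exact ⟨c.unop, rfl⟩
  obtain ⟨g, hg⟩ := Module.projective_lifting_property f LinearMap.id hf
  have hv : v ∈ Submodule.span Aᵐᵒᵖ {v} := Submodule.mem_span_singleton_self v
  refine ⟨g ⟨v, hv⟩, congrArg Subtype.val (LinearMap.congr_fun hg ⟨v, hv⟩), fun x hx => ?_⟩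
  have h1 : g (MulOpposite.op x • ⟨v, hv⟩) = MulOpposite.op x • g ⟨v, hv⟩ := map_smul g _ _
  have h2 : (MulOpposite.op x • (⟨v, hv⟩ : Submodule.span Aᵐᵒᵖ {v})) = 0 := Subtype.ext hx
  rw [h2, map_zero] at h1
  exact h1.symm

end Projective

/-! ### The element `z` and its invertibility -/

section Final

variable {R : Type*} [CommRing R] {m r : ℕ} {q : Rˣ} {u : Fin m → R}
  {w : Fin m → R} {κ κ' : Fin r → Fin m} {w0 : Equiv.Perm (Fin r)}

namespace Datum

theorem exists_z (hD : Datum u w κ κ' w0) : ∃ z ∈ YA q u κ, vD q w κ κ' w0 * Tw q u w0.symm * vD q w κ κ' w0 =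
    z * vD q w κ κ' w0 := by
  obtain ⟨z, hz, h⟩ := hD.exists_pp_mul_mul_pp (q := q) (Tw q u w0 * ev q u (pp (w ∘ Fin.rev) κ') *
    Tw q u w0.symm * ev q u (pp w κ) * Tw q u w0)
  refine ⟨z, hz, ?_⟩
  rw [← h]
  simp only [vD, mul_assoc]

variable {E : Type*} [Ring E] [Algebra R E] (D : HeckeModel r q u E)

theorem isUnit_Tw (D : HeckeModel r q u E) (w : Equiv.Perm (Fin r)) : IsUnit (Tw q u w) := by
  induction w using perm_induction with
  | h1 => rw [Tw_refl]; exact isUnit_one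
  | hs w i h ih =>
    rw [Tw_s_trans q u h, ← D.j_t]
    exact ((D.isUnit_t i).map D.j).mul ih

theorem exists_vD_mul_YA (hD : Datum u w κ κ' w0) (D : HeckeModel r q u E) {x' : H r q u}
    (hx' : x' ∈ YA q u κ') : ∃ x ∈ YA q u κ, x * Tw q u w0 = Tw q u w0 * x' ∧
      x' * Tw q u w0.symm = Tw q u w0.symm * x ∧
        x * vD q w κ κ' w0 = vD q w κ κ' w0 * x' := by
  obtain ⟨x, hx, e1, e2⟩ := hD.symm.exists_conj (q := q) hx'
  rw [Equiv.symm_symm] at e2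
  obtain ⟨x₁, -, e3, -, e4⟩ := hD.exists_mul_vD (q := q) hx
  have : x₁ = x' := (isUnit_Tw D w0).mul_left_cancel (e3.symm.trans e2)
  rw [this] at e4
  exact ⟨x, hx, e2, e1, e4⟩

variable [NeZero m] [Nontrivial R]

theorem mul_vD_cancel (hD : Datum u w κ κ' w0) (D : HeckeModel r q u E) {x y : H r q u}
    (hx : x ∈ Hfin r q u) (hy : y ∈ Hfin r q u)
    (h : x * vD q w κ κ' w0 = y * vD q w κ κ' w0) : x = y := by
  obtain ⟨x, rfl⟩ := exists_j_eq D hx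
  obtain ⟨y, rfl⟩ := exists_j_eq D hy
  have := congrArg (Phi D) h
  rw [Phi_j_mul, Phi_j_mul] at this
  rw [(hD.isUnit_Phi_vD D).mul_right_cancel this]

theorem vD_mul_cancel (hD : Datum u w κ κ' w0) (D : HeckeModel r q u E) {x y : H r q u}
    (hx : x ∈ Hfin r q u) (hy : y ∈ Hfin r q u)
    (h : vD q w κ κ' w0 * x = vD q w κ κ' w0 * y) : x = y := by
  obtain ⟨x, rfl⟩ := exists_j_eq D hx
  obtain ⟨y, rfl⟩ := exists_j_eq D hy
  have := congrArg (Phi D) h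
  rw [Phi_mul_j, Phi_mul_j] at this
  rw [(hD.isUnit_Phi_vD D).mul_left_cancel this]

section Z

variable {z z' : H r q u}

theorem z_comm (hD : Datum u w κ κ' w0) (D : HeckeModel r q u E) (hz : z ∈ YA q u κ)
    (h : vD q w κ κ' w0 * Tw q u w0.symm * vD q w κ κ' w0 = z * vD q w κ κ' w0)
    {x : H r q u} (hx : x ∈ YA q u κ) : z * x = x * z := by
  obtain ⟨x', hx', e1, e2, e3⟩ := hD.exists_mul_vD (q := q) hx
  refine hD.mul_vD_cancel D (YA_le_Hfin q u κ (Subalgebra.mul_mem _ hz hx))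
    (YA_le_Hfin q u κ (Subalgebra.mul_mem _ hx hz)) ?_
  set v := vD q w κ κ' w0
  set g' := Tw q u w0.symm
  calc z * x * v = z * v * x' := by rw [mul_assoc, e3, mul_assoc]
    _ = v * g' * x * v := by rw [← h, mul_assoc (v * g'), ← e3, ← mul_assoc]
    _ = v * x' * g' * v := by rw [mul_assoc v g' x, ← e2, mul_assoc v x' g']
    _ = x * z * v := by rw [← e3, mul_assoc x z v, ← h]; simp only [mul_assoc]

theorem z'_comm (hD : Datum u w κ κ' w0) (D : HeckeModel r q u E) (hz' : z' ∈ YA q u κ')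
    (h : vD q w κ κ' w0 * Tw q u w0.symm * vD q w κ κ' w0 = vD q w κ κ' w0 * z')
    {x' : H r q u} (hx' : x' ∈ YA q u κ') : z' * x' = x' * z' := by
  obtain ⟨x, hx, e1, e2, e3⟩ := hD.exists_vD_mul_YA D hx'
  refine hD.vD_mul_cancel D (YA_le_Hfin q u κ' (Subalgebra.mul_mem _ hz' hx'))
    (YA_le_Hfin q u κ' (Subalgebra.mul_mem _ hx' hz')) ?_
  set v := vD q w κ κ' w0
  set g' := Tw q u w0.symm
  calc v * (z' * x') = v * g' * v * x' := by rw [← mul_assoc, ← h]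
    _ = v * g' * x * v := by rw [mul_assoc (v * g'), ← e3, ← mul_assoc]
    _ = v * x' * g' * v := by rw [mul_assoc v g' x, ← e2, mul_assoc v x' g']
    _ = v * (x' * z') := by
      rw [← mul_assoc v x' z', ← e3, mul_assoc x v z', ← h]; simp only [mul_assoc]

/-- If `z` is invertible, then so is `z'`, and `v h z⁻¹` is an idempotent `e` with `e v = v`. -/
theorem of_inverse (hD : Datum u w κ κ' w0) (D : HeckeModel r q u E) (hz' : z' ∈ YA q u κ')
    (h : vD q w κ κ' w0 * Tw q u w0.symm * vD q w κ κ' w0 = z * vD q w κ κ' w0)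
    (h' : vD q w κ κ' w0 * Tw q u w0.symm * vD q w κ κ' w0 = vD q w κ κ' w0 * z')
    {y : H r q u} (hy : y ∈ YA q u κ) (h1 : z * y = 1) (h2 : y * z = 1) :
    (∃ y' ∈ YA q u κ', z' * y' = 1 ∧ y' * z' = 1) ∧
      vD q w κ κ' w0 * Tw q u w0.symm * y * vD q w κ κ' w0 = vD q w κ κ' w0 := by
  obtain ⟨y', hy', e1, e2, e3⟩ := hD.exists_mul_vD (q := q) hy
  have hm := Subalgebra.one_mem (Hfin r q u)
  set v := vD q w κ κ' w0 with hv
  set g' := Tw q u w0.symm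
  have hzv : z * v = v * z' := h.symm.trans h'
  have h3 : v * (z' * y') = v := by
    rw [← mul_assoc, ← hzv, mul_assoc, ← e3, ← mul_assoc, h1, one_mul]
  have h4 : v * (y' * z') = v := by
    rw [← mul_assoc, ← e3, mul_assoc, ← hzv, ← mul_assoc, h2, one_mul]
  refine ⟨⟨y', hy', ?_, ?_⟩, ?_⟩
  · exact hD.vD_mul_cancel D (YA_le_Hfin q u κ' (Subalgebra.mul_mem _ hz' hy')) hm
      (h3.trans (mul_one _).symm)
  · exact hD.vD_mul_cancel D (YA_le_Hfin q u κ' (Subalgebra.mul_mem _ hy' hz')) hm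
      (h4.trans (mul_one _).symm)
  · rw [mul_assoc (v * g'), e3, ← mul_assoc, h', mul_assoc, h3]

theorem of_inverse' (hD : Datum u w κ κ' w0) (D : HeckeModel r q u E) (hz : z ∈ YA q u κ)
    (hzv : z * vD q w κ κ' w0 = vD q w κ κ' w0 * z')
    {y' : H r q u} (hy' : y' ∈ YA q u κ') (h1 : z' * y' = 1) (h2 : y' * z' = 1) :
    ∃ y ∈ YA q u κ, z * y = 1 ∧ y * z = 1 := by
  obtain ⟨y, hy, e1, e2, e3⟩ := hD.exists_vD_mul_YA D hy'
  have hm := Subalgebra.one_mem (Hfin r q u)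
  refine ⟨y, hy, ?_, ?_⟩
  · refine hD.mul_vD_cancel D (YA_le_Hfin q u κ (Subalgebra.mul_mem _ hz hy)) hm ?_
    rw [mul_assoc, e3, ← mul_assoc, hzv, mul_assoc, h1, mul_one, one_mul]
  · refine hD.mul_vD_cancel D (YA_le_Hfin q u κ (Subalgebra.mul_mem _ hy hz)) hm ?_
    rw [mul_assoc, hzv, ← mul_assoc, e3, mul_assoc, h2, mul_one, one_mul]

/-- A splitting of `H → v H` is left multiplication by `c v` for some `c ∈ ℋ(𝔖_r)`, because
`H` is a Frobenius extension of `ℋ(𝔖_r)`. -/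
theorem exists_mul_vD_eq (hD : Datum u w κ κ' w0) (D : HeckeModel r q u E) {e : H r q u}
    (he : ∀ x, vD q w κ κ' w0 * x = 0 → e * x = 0) : ∃ c, e = c * vD q w κ κ' w0 := by
  obtain ⟨b, hb, hb'⟩ := isUnit_iff_exists.mp (hD.isUnit_Phi_vD D)
  refine ⟨D.j (Phi D e * b), sub_eq_zero.mp (eq_zero_of_Phi_mul_right D fun x => ?_)⟩
  obtain ⟨h, hh, e1⟩ := hD.exists_vD_mul (q := q) x
  obtain ⟨h, rfl⟩ := exists_j_eq D hh
  have e2 : e * x = e * D.j h := by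
    rw [← sub_eq_zero, ← mul_sub]
    exact he _ (by rw [mul_sub, e1, sub_self])
  rw [sub_mul, map_sub, e2, Phi_mul_j, mul_assoc, e1, ← mul_assoc, Phi_mul_j, Phi_j_mul,
    mul_assoc (Phi D e), hb', mul_one, sub_self]

/-- If `v H` is projective, then `z` is invertible. -/
theorem exists_inverse_of_projective (hD : Datum u w κ κ' w0) (D : HeckeModel r q u E)
    (hz : z ∈ YA q u κ)
    (h : vD q w κ κ' w0 * Tw q u w0.symm * vD q w κ κ' w0 = z * vD q w κ κ' w0)
    (hP : Module.Projective (H r q u)ᵐᵒᵖ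
      (Submodule.span (H r q u)ᵐᵒᵖ {(vD q w κ κ' w0 : H r q u)})) :
    ∃ y ∈ YA q u κ, z * y = 1 ∧ y * z = 1 := by
  obtain ⟨e, he, he'⟩ := exists_mul_eq_of_projective_span hP
  obtain ⟨c, rfl⟩ := hD.exists_mul_vD_eq D he'
  obtain ⟨x', hx', e1⟩ := hD.symm.exists_pp_mul_mul_pp (q := q) c
  have hw : (w ∘ Fin.rev) ∘ Fin.rev = w := by
    ext k
    simp
  rw [hw] at e1
  obtain ⟨x, hx, e2, -, -⟩ := hD.exists_vD_mul_YA D hx'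
  have e3 := (commute_pp_of_mem_YA q u w hx).eq
  have key : x * z * vD q w κ κ' w0 = vD q w κ κ' w0 := by
    conv_rhs => rw [← he]
    rw [mul_assoc x, ← h]
    set g := Tw q u w0 with hg
    set g' := Tw q u w0.symm with hg'
    set P := ev q u (pp w κ) with hP
    set P' := ev q u (pp (w ∘ Fin.rev) κ') with hP'
    have hv : vD q w κ κ' w0 = P * g * P' := rfl
    have hv' : vD q (w ∘ Fin.rev) κ' κ w0.symm = P' * g' * P := by
      rw [vD, hw]
    rw [hv'] at e1
    rw [hv]
    calc x * (P * g * P' * g' * (P * g * P'))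
        = x * P * g * P' * g' * P * g * P' := by simp only [mul_assoc]
      _ = P * (x * g) * P' * g' * P * g * P' := by rw [e3]; simp only [mul_assoc]
      _ = P * g * (x' * (P' * g' * P)) * g * P' := by rw [e2]; simp only [mul_assoc]
      _ = P * g * P' * (c * (P * g * P')) := by rw [← e1]; simp only [mul_assoc]
  have h1 : x * z = 1 := hD.mul_vD_cancel D (YA_le_Hfin q u κ (Subalgebra.mul_mem _ hx hz))
    (Subalgebra.one_mem _) (by rw [key, one_mul])
  exact ⟨x, hx, (hD.z_comm D hz h hx).trans h1, h1⟩

end Z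

end Datum

end Final


/-! ### The elements attached to `Λ[m,r]` -/

section Translation

open MvPolynomial

variable {R : Type*} [CommRing R] {m r : ℕ}

theorem Lam.lt_val_iff (a : Lam m r) (p : Fin r) (j : Fin (m + 1)) :
    (p : ℕ) < a.val j ↔ (a.block p : ℕ) < j := by
  have h := a.block_spec p
  constructor
  · intro hp
    by_contra hcon
    have : a.val j ≤ a.val (a.block p).castSucc := a.mono (not_lt.mp hcon)
    omega
  · intro hj
    have : a.val (a.block p).succ ≤ a.val j := a.mono (Nat.succ_le_of_lt hj)
    omega

theorem Lam.block_mono (a : Lam m r) : Monotone a.block := by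
  intro p p' h
  by_contra hcon
  have h1 := (a.lt_val_iff p' (a.block p).castSucc).mpr (not_le.mp hcon)
  have h2 := (a.lt_val_iff p (a.block p).castSucc).mp (lt_of_le_of_lt h h1)
  exact lt_irrefl _ h2

theorem Lam.block_eq (a : Lam m r) {p : Fin r} {i : Fin m} (h : a.val i.castSucc ≤ p)
    (h' : (p : ℕ) < a.val i.succ) : a.block p = i :=
  a.block_unique (a.block_spec p).1 (a.block_spec p).2 h h'

theorem Lam.w_val (a : Lam m r) (p : Fin r) :
    (a.w p : ℕ) = r - a.val (a.block p).succ + ((p : ℕ) - a.val (a.block p).castSucc) := rfl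

theorem Lam.dual_block_w (a : Lam m r) (p : Fin r) : a.dual.block (a.w p) = (a.block p).rev := by
  have h := a.block_spec p
  have hw := a.w_val p
  have hs := a.le_last (a.block p).succ
  have e1 : a.dual.val (a.block p).rev.castSucc = r - a.val (a.block p).succ := by
    simp [Lam.dual, Fin.rev_castSucc]
  have e2 : a.dual.val (a.block p).rev.succ = r - a.val (a.block p).castSucc := by
    simp [Lam.dual, Fin.rev_succ]
  exact a.dual.block_eq (by rw [e1, hw]; omega) (by rw [e2, hw]; omega)

theorem Lam.datum (u : Fin m → R) (a : Lam m r) : Datum u u a.block a.dual.block a.w where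
  hw := rfl
  mono := a.block_mono
  mono' := a.dual.block_mono
  map_block := a.dual_block_w
  inc p p' h hp := by
    have h1 := (a.block_spec p).1
    rw [Fin.lt_def, a.w_val, a.w_val, ← h]
    rw [Fin.lt_def] at hp
    omega

theorem Lam.dual_w (a : Lam m r) : a.dual.w = a.w.symm := Equiv.ext fun _ => rfl

theorem Lam.s_mem_young_iff (a : Lam m r) (i : Fin (r - 1)) :
    s i ∈ a.young ↔ a.block (lo i) = a.block (succIdx i) := by
  constructor
  · intro h
    have h1 : ∀ j : Fin (m + 1), (a.block (succIdx i) : ℕ) < j ↔ (a.block (lo i) : ℕ) < j := by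
      intro j
      rw [← a.lt_val_iff, ← a.lt_val_iff]
      have := h (lo i) j
      rwa [s_lo] at this
    refine Fin.ext (le_antisymm ?_ ?_)
    · exact Nat.lt_succ_iff.mp ((h1 (a.block (succIdx i)).succ).mp (Nat.lt_succ_self _))
    · exact Nat.lt_succ_iff.mp ((h1 (a.block (lo i)).succ).mpr (Nat.lt_succ_self _))
  · intro h p j
    rw [a.lt_val_iff, a.lt_val_iff]
    by_cases h1 : p = lo i
    · rw [h1, s_lo, h]
    by_cases h2 : p = succIdx i
    · rw [h2, s_hi, h]
    · rw [s_of_ne h1 h2]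

variable (q : Rˣ) (u : Fin m → R)

theorem heckeYoung_eq (a : Lam m r) : heckeYoung q u a = YA q u a.block := by
  rw [heckeYoung, YA]
  congr 1
  ext x
  constructor
  · rintro ⟨i, hi, rfl⟩
    exact ⟨i, (a.s_mem_young_iff i).mp hi, rfl⟩
  · rintro ⟨i, hi, rfl⟩
    exact ⟨i, (a.s_mem_young_iff i).mpr hi, rfl⟩

theorem piElt_eq (b : ℕ) (hb : b ≤ r) (x : R) :
    piElt q u b hb x =
    ev q u (∏ p ∈ Finset.univ.filter fun p : Fin r => (p : ℕ) < b, (X p - C x)) := by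
  have h1 : (∏ p ∈ Finset.univ.filter fun p : Fin r => (p : ℕ) < b, (X p - C x) : MvPolynomial (Fin r) R) =
      ∏ j : Fin b, (X (Fin.castLE hb j) - C x) := by
    refine (Finset.prod_bij' (fun j _ => Fin.castLE hb j)
      (fun p hp => ⟨p, (Finset.mem_filter.mp hp).2⟩) ?_ ?_ ?_ ?_ ?_).symm <;> simp
  rw [h1, ← List.prod_ofFn, map_list_prod, List.map_ofFn, piElt]
  congr 2
  ext j
  rw [Function.comp_apply, map_sub, ev_X, ← algebraMap_eq, AlgHom.commutes]
  rfl

theorem prod_piElt_eq (hm : 0 < m) (w : Fin m → R) (a : Lam m r) :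
    (List.ofFn fun i : Fin (m - 1) => piElt q u (a.val ⟨i + 1, by omega⟩) (a.le_last _)
      (w ⟨i + 1, by omega⟩)).prod = ev q u (pp w a.block) := by
  obtain ⟨n, rfl⟩ : ∃ n, m = n + 1 := ⟨m - 1, by omega⟩
  have h1 : pp w a.block = ∏ k : Fin (n + 1), ∏ p : Fin r with a.block p < k, (X p - C (w k)) := by
    rw [pp, PK]
    refine Finset.prod_comm' fun p k => ?_
    simp
  have h2 : (∏ p : Fin r with a.block p < 0, (X p - C (w 0)) : MvPolynomial (Fin r) R) = 1 := by
    refine Finset.prod_eq_one fun p hp => ?_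
    exact absurd (Finset.mem_filter.mp hp).2 (Fin.not_lt_zero _)
  rw [h1, Fin.prod_univ_succ, h2, one_mul, ← List.prod_ofFn, map_list_prod, List.map_ofFn]
  change (List.ofFn fun i : Fin n => _).prod = _
  congr 2
  ext i
  rw [piElt_eq, Function.comp_apply]
  congr 2
  ext p
  rw [Finset.mem_filter, Finset.mem_filter, a.lt_val_iff]
  rfl

theorem piA_eq (hm : 0 < m) (a : Lam m r) : piA q u a = ev q u (pp u a.block) :=
  prod_piElt_eq q u hm u a

theorem piTilde_eq (hm : 0 < m) (a : Lam m r) :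
    piTilde q u a = ev q u (pp (u ∘ Fin.rev) a.block) := by
  rw [← prod_piElt_eq q u hm (u ∘ Fin.rev) a, piTilde]
  congr 2
  ext i
  congr 1
  rw [Function.comp_apply]
  congr 1
  rw [Fin.ext_iff, Fin.val_rev]
  simp only
  omega

theorem vA_eq (hm : 0 < m) (a : Lam m r) : vA q u a = vD q u a.block a.dual.block a.w := by
  rw [vA, piA_eq q u hm, piTilde_eq q u hm]
  rfl

theorem hA_dual_eq (a : Lam m r) : hA q u a.dual = Tw q u a.w.symm := by
  rw [hA, a.dual_w]

/-- The subalgebra generated by the Hecke generators, as a model of `ℋ(𝔖_r)`. -/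
def finModel (r : ℕ) (q : Rˣ) (u : Fin m → R) : HeckeModel r q u (Hfin r q u) where
  t i := ⟨G q u i, G_mem_Hfin q u i⟩
  j := (Hfin r q u).val
  inj := Subtype.val_injective
  j_t _ := rfl
  adjoin_t := by
    refine Eq.trans (congrArg _ ?_)
      (Algebra.adjoin_adjoin_coe_preimage (R := R) (s := Set.range (G (r := r) q u)))
    ext x
    constructor
    · rintro ⟨i, rfl⟩
      exact ⟨i, rfl⟩
    · rintro ⟨i, hi⟩
      exact ⟨i, Subtype.ext hi⟩

end Translation

section Subalg

variable {R B : Type*} [CommRing R] [Ring B] [Algebra R B] {S : Subalgebra R B}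

theorem isUnit_subalgebra_iff {z : S} :
    IsUnit z ↔ ∃ y ∈ S, (z : B) * y = 1 ∧ y * (z : B) = 1 := by
  rw [isUnit_iff_exists]
  constructor
  · rintro ⟨y, h1, h2⟩
    exact ⟨y, y.2, congrArg Subtype.val h1, congrArg Subtype.val h2⟩
  · rintro ⟨y, hy, h1, h2⟩
    exact ⟨⟨y, hy⟩, Subtype.ext h1, Subtype.ext h2⟩

end Subalg

end ArikiKoike

theorem mainTheorem7 {R : Type*} [CommRing R] (m r : ℕ) (hm : 0 < m) (q : Rˣ) (u : Fin m → R)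
    (a : ArikiKoike.Lam m r) :
    (∃! z : ArikiKoike.heckeYoung q u a,
      ArikiKoike.vA q u a * ArikiKoike.hA q u a.dual * ArikiKoike.vA q u a
        = (z : ArikiKoike.H r q u) * ArikiKoike.vA q u a) ∧
    (∃! z' : ArikiKoike.heckeYoung q u a.dual,
      ArikiKoike.vA q u a * ArikiKoike.hA q u a.dual * ArikiKoike.vA q u a
        = ArikiKoike.vA q u a * (z' : ArikiKoike.H r q u)) ∧
    ∀ (z : ArikiKoike.heckeYoung q u a) (z' : ArikiKoike.heckeYoung q u a.dual),
      ArikiKoike.vA q u a * ArikiKoike.hA q u a.dual * ArikiKoike.vA q u a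
        = (z : ArikiKoike.H r q u) * ArikiKoike.vA q u a →
      ArikiKoike.vA q u a * ArikiKoike.hA q u a.dual * ArikiKoike.vA q u a
        = ArikiKoike.vA q u a * (z' : ArikiKoike.H r q u) →
      z ∈ Subalgebra.center R (ArikiKoike.heckeYoung q u a) ∧
      z' ∈ Subalgebra.center R (ArikiKoike.heckeYoung q u a.dual) ∧
      List.TFAE [
        IsUnit z,
        IsUnit z',
        ∃ y : ArikiKoike.heckeYoung q u a, z * y = 1 ∧ y * z = 1 ∧
          IsIdempotentElem (ArikiKoike.vA q u a * ArikiKoike.hA q u a.dual *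
            (y : ArikiKoike.H r q u)),
        Module.Projective (ArikiKoike.H r q u)ᵐᵒᵖ
          (Submodule.span (ArikiKoike.H r q u)ᵐᵒᵖ {ArikiKoike.vA q u a})] := by
  open ArikiKoike in
  rw [hA_dual_eq]
  have hv := vA_eq q u hm a
  have hY := heckeYoung_eq q u a
  have hY' := heckeYoung_eq q u a.dual
  have hD := a.datum u
  generalize vA q u a = v at *
  generalize heckeYoung q u a = Y at *
  generalize heckeYoung q u a.dual = Y' at *
  subst hv hY hY'
  -- Over the zero ring all assertions are trivial; the degree of the cyclotomic polynomial needs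
  -- `1 ≠ 0`.
  rcases subsingleton_or_nontrivial R with hR | hR
  · have hH : Subsingleton (H r q u) := Module.subsingleton R (H r q u)
    refine ⟨⟨0, Subsingleton.elim _ _, fun _ _ => Subsingleton.elim _ _⟩,
      ⟨0, Subsingleton.elim _ _, fun _ _ => Subsingleton.elim _ _⟩, fun z z' _ _ => ⟨?_, ?_, ?_⟩⟩
    · rw [Subsingleton.elim z 0]; exact Subalgebra.zero_mem _
    · rw [Subsingleton.elim z' 0]; exact Subalgebra.zero_mem _
    · tfae_have 1 → 2 := fun _ => isUnit_of_subsingleton _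
      tfae_have 2 → 3 := fun _ =>
        ⟨0, Subsingleton.elim _ _, Subsingleton.elim _ _, Subsingleton.elim _ _⟩
      tfae_have 3 → 4 := fun _ => projective_span_of_mul_eq (y := 0) (Subsingleton.elim _ _)
      tfae_have 4 → 1 := fun _ => isUnit_of_subsingleton _
      tfae_finish
  have : NeZero m := ⟨hm.ne'⟩
  have D := finModel r q u
  have hle := YA_le_Hfin q u a.block
  have hle' := YA_le_Hfin q u a.dual.block
  obtain ⟨z₀, hz₀, h₀⟩ := hD.exists_z (q := q)
  obtain ⟨z₁, hz₁, -, -, h₁⟩ := hD.exists_mul_vD (q := q) hz₀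
  refine ⟨⟨⟨z₀, hz₀⟩, h₀, fun z hz => Subtype.ext (hD.mul_vD_cancel D (hle z.2) (hle hz₀)
      (hz.symm.trans h₀))⟩, ⟨⟨z₁, hz₁⟩, h₀.trans h₁, fun z hz => Subtype.ext
        (hD.vD_mul_cancel D (hle' z.2) (hle' hz₁) (hz.symm.trans (h₀.trans h₁)))⟩, ?_⟩
  intro z z' h h'
  refine ⟨Subalgebra.mem_center_iff.mpr fun x => Subtype.ext (hD.z_comm D z.2 h x.2).symm,
    Subalgebra.mem_center_iff.mpr fun x => Subtype.ext (hD.z'_comm D z'.2 h' x.2).symm, ?_⟩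
  tfae_have 1 → 3 := by
    rintro hz
    obtain ⟨y, hy, h1, h2⟩ := isUnit_subalgebra_iff.mp hz
    refine ⟨⟨y, hy⟩, Subtype.ext h1, Subtype.ext h2, ?_⟩
    have h3 := (hD.of_inverse D z'.2 h h' hy h1 h2).2
    rw [IsIdempotentElem, ← mul_assoc, ← mul_assoc, h3]
  tfae_have 3 → 1 := fun ⟨y, h1, h2, _⟩ => isUnit_iff_exists.mpr ⟨y, h1, h2⟩
  tfae_have 1 → 2 := by
    intro hz
    obtain ⟨y, hy, h1, h2⟩ := isUnit_subalgebra_iff.mp hz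
    exact isUnit_subalgebra_iff.mpr (hD.of_inverse D z'.2 h h' hy h1 h2).1
  tfae_have 2 → 1 := by
    intro hz
    obtain ⟨y, hy, h1, h2⟩ := isUnit_subalgebra_iff.mp hz
    exact isUnit_subalgebra_iff.mpr (hD.of_inverse' D z.2 (h.symm.trans h') hy h1 h2)
  tfae_have 1 → 4 := by
    intro hz
    obtain ⟨y, hy, h1, h2⟩ := isUnit_subalgebra_iff.mp hz
    refine projective_span_of_mul_eq (y := Tw q u a.w.symm * y) ?_
    rw [← mul_assoc]
    exact (hD.of_inverse D z'.2 h h' hy h1 h2).2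
  tfae_have 4 → 1 := fun hP =>
    isUnit_subalgebra_iff.mpr (hD.exists_inverse_of_projective D z.2 h hP)
  tfae_finish
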